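/- **Theorem (Christoffel–Darboux formula for $\beta=4$).** Let $V$ be a real polynomial of even degree $D\ge 2$ with positive leading coefficient, and let $n\in\mathbb N=\{0,1,2,\dots\}$. *Skew-orthogonal polynomials.* For real polynomials $P,Q$ put $$\langle P,Q\rangle_4=\tfrac12\int_{\mathbb R}\bigl(P(x)Q'(x)-P'(x)Q(x)\bigr)e^{-2V(x)}\,dx .$$ A sequence $(P_m)_{m\ge0}$ of monic real polynomials with $\deg P_m=m$ is skew-orthogonal if $\langle P_{2k},P_{2l}\rangle_4=\langle P_{2k+1},P_{2l+1}\rangle_4=0$ for all $k,l$ and $\langle P_{2k},P_{2l+1}\rangle_4=0$ for $k\ne l$. Such sequences exist, and their skew norms $h_k=\langle P_{2k},P_{2k+1}\rangle_4$ are all positive. For such a sequence the pre-kernel is $$S_n(x,y)=\sum_{k=0}^{n-1}\frac{P_{2k}(x)e^{-V(x)}\frac{d}{dy}\bigl(P_{2k+1}(y)e^{-V(y)}\bigr)-P_{2k+1}(x)e^{-V(x)}\frac{d}{dy}\bigl(P_{2k}(y)e^{-V(y)}\bigr)}{2h_k},$$ for real $x,y$, and by the same expression for complex $x,y$. *The even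 Riemann–Hilbert problem.* Let $C_k=e^{2\pi i k/D}[0,\infty)$ for $0\le k\le D-1$, with $C_0$ oriented away from the origin and $C_1,\dots,C_{D-1}$ oriented towards it. Let $\Gamma_j=C_0\cup C_j$ for $1\le j\le D-1$, and $\Gamma=\bigcup_{j=1}^{D-1}\Gamma_j$. The problem is to find $A_n:\mathbb C\setminus\Gamma\to\mathcal M_{D+1}(\mathbb C)$ such that 1. $A_n$ is analytic on $\mathbb C\setminus\Gamma$; 2. $A_n$ extends continuously to $\Gamma\setminus\{0\}$ from the left ($+$) and from the right ($-$) side, with continuous boundary values $A_n^{\pm}$; 3. $A_n$ is bounded near $0$; 4. $A_n^+(x)=A_n^-(x)J(x)$ for $x\in\Gamma\setminus\{0\}$, where $J$ is the identity matrix with its first row replaced by $(1,\ e^{-2V}\chi_{\mathbb R},\ e^{-V}\chi_{\Gamma_1},\dots,e^{-V}\chi_{\Gamma_{D-1}})$; 5. $A_n(z)=\bigl(\mathbb I+\mathcal O(z^{-1})\bigr)\,\mathrm{diag}\bigl(z^{2n+D-1},z^{-2n},z^{-1},\dots,z^{-1}\bigr)$ as $z\to\infty$ in $\mathbb C\setminus\Gamma$.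 *Conclusion.* This problem has exactly one solution $A_n$, the matrix $A_n(z)$ is invertible for every $z\in\mathbb C\setminus\Gamma$, and for every skew-orthogonal sequence $$S_n(x,y)=-\frac1{4\pi i}\,e^{-V(x)-V(y)}\,\frac{\bigl(A_n^{-1}(x)A_n(y)\bigr)_{21}}{x-y}\qquad(x\ne y),$$ in the following sense. It holds for all complex $x\neq y$ in $\mathbb C\setminus\Gamma$. It holds for all nonzero real $x\ne y$ when $A_n(x)$ and $A_n(y)$ are each replaced by either of the boundary values $A_n^{\pm}$ at that point (which are invertible). And for all real $x\neq y$, zero included, the right-hand side evaluated at $(x',y')$ tends to $S_n(x,y)$ as $(x',y')\to(x,y)$ in $(\mathbb C\setminus\Gamma)^2$. -/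

import Mathlib

open Polynomial Filter Topology MeasureTheory

noncomputable section

namespace SkewRH

/-! ### Skew-orthogonal polynomials of symplectic type -/

/-- The skew-symmetric form `⟨P, Q⟩₄ = ½ ∫ (P Q' - P' Q) e^{-2V} dx` on real polynomials. -/
def skewInner (V P Q : ℝ[X]) : ℝ :=
  (1 / 2) * ∫ x : ℝ, (P.eval x * (derivative Q).eval x - (derivative P).eval x * Q.eval x)
    * Real.exp (-2 * V.eval x)

/-- `P 0, P 1, …` is a sequence of monic polynomials, `P n` of degree `n`, skew-orthogonal with
respect to `⟨·,·⟩₄`. (The odd members are only determined up to `P (2k+1) ↦ P (2k+1) + α P (2k)`.) -/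
structure IsSkewOrthogonal (V : ℝ[X]) (P : ℕ → ℝ[X]) : Prop where
  monic : ∀ m, (P m).Monic
  natDegree_eq : ∀ m, (P m).natDegree = m
  even_even : ∀ k l, skewInner V (P (2 * k)) (P (2 * l)) = 0
  odd_odd : ∀ k l, skewInner V (P (2 * k + 1)) (P (2 * l + 1)) = 0
  even_odd : ∀ k l, k ≠ l → skewInner V (P (2 * k)) (P (2 * l + 1)) = 0

/-- The skew norms `h_k = ⟨P_{2k}, P_{2k+1}⟩₄`. -/
def skewNorm (V : ℝ[X]) (P : ℕ → ℝ[X]) (k : ℕ) : ℝ :=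
  skewInner V (P (2 * k)) (P (2 * k + 1))

/-- The pre-kernel `S_n(x, y)` for real `x, y`. -/
def preKernel (V : ℝ[X]) (P : ℕ → ℝ[X]) (n : ℕ) (x y : ℝ) : ℝ :=
  ∑ k ∈ Finset.range n,
    ((P (2 * k)).eval x * Real.exp (-V.eval x)
        * deriv (fun t : ℝ => (P (2 * k + 1)).eval t * Real.exp (-V.eval t)) y
      - (P (2 * k + 1)).eval x * Real.exp (-V.eval x)
        * deriv (fun t : ℝ => (P (2 * k)).eval t * Real.exp (-V.eval t)) y)
      / (2 * skewNorm V P k)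

/-- The pre-kernel `S_n(x, y)` for complex `x, y`, given by the same expression. -/
def preKernelC (V : ℝ[X]) (P : ℕ → ℝ[X]) (n : ℕ) (x y : ℂ) : ℂ :=
  ∑ k ∈ Finset.range n,
    (aeval x (P (2 * k)) * Complex.exp (-aeval x V)
        * deriv (fun t : ℂ => aeval t (P (2 * k + 1)) * Complex.exp (-aeval t V)) y
      - aeval x (P (2 * k + 1)) * Complex.exp (-aeval x V)
        * deriv (fun t : ℂ => aeval t (P (2 * k)) * Complex.exp (-aeval t V)) y)
      / (2 * (skewNorm V P k : ℂ))

/-! ### The contours -/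

/-- The direction `e^{2πik/D}`. -/
def dir (D k : ℕ) : ℂ := Complex.exp (2 * Real.pi * Complex.I * k / D)

/-- The closed ray `C_k = e^{2πik/D} [0, ∞)`. -/
def ray (D k : ℕ) : Set ℂ := {z | ∃ t : ℝ, 0 ≤ t ∧ z = t * dir D k}

/-- `Γ_j = C_0 ∪ C_j`. -/
def arc (D j : ℕ) : Set ℂ := ray D 0 ∪ ray D j

/-- `Γ = Γ_1 ∪ … ∪ Γ_{D-1}`. -/
def contour (D : ℕ) : Set ℂ := {z | ∃ j, 1 ≤ j ∧ j < D ∧ z ∈ arc D j}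

/-- The direction in which `C_k` is traversed: `C_0` goes out to infinity, the other rays
come in towards the origin. -/
def tangent (D k : ℕ) : ℂ := if k = 0 then dir D k else -dir D k

/-- The open half-plane to the left of the oriented ray `C_k`. -/
def leftSide (D k : ℕ) : Set ℂ := {z | 0 < (z / tangent D k).im}

/-- The open half-plane to the right of the oriented ray `C_k`. -/
def rightSide (D k : ℕ) : Set ℂ := {z | (z / tangent D k).im < 0}

/-! ### The even Riemann-Hilbert problem -/

/-- `M` is the boundary value of `A` at the point `x` of `C_k`, from the `+` (left) side. -/
def IsPlusValue (D k : ℕ) (A : ℂ → Matrix (Fin (D + 1)) (Fin (D + 1)) ℂ) (x : ℂ)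
    (M : Matrix (Fin (D + 1)) (Fin (D + 1)) ℂ) : Prop :=
  Tendsto A (𝓝[leftSide D k \ contour D] x) (𝓝 M)

/-- `M` is the boundary value of `A` at the point `x` of `C_k`, from the `-` (right) side. -/
def IsMinusValue (D k : ℕ) (A : ℂ → Matrix (Fin (D + 1)) (Fin (D + 1)) ℂ) (x : ℂ)
    (M : Matrix (Fin (D + 1)) (Fin (D + 1)) ℂ) : Prop :=
  Tendsto A (𝓝[rightSide D k \ contour D] x) (𝓝 M)

/-- `M` is one of the two boundary values of `A` at the point `x ∈ Γ \ {0}`. -/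
def IsBoundaryValue (D : ℕ) (A : ℂ → Matrix (Fin (D + 1)) (Fin (D + 1)) ℂ) (x : ℂ)
    (M : Matrix (Fin (D + 1)) (Fin (D + 1)) ℂ) : Prop :=
  ∃ k < D, x ∈ ray D k ∧ x ≠ 0 ∧ (IsPlusValue D k A x M ∨ IsMinusValue D k A x M)

/-- The jump matrix: the identity except for the first row, which is
`(1, e^{-2V} χ_ℝ, e^{-V} χ_{Γ_1}, …, e^{-V} χ_{Γ_{D-1}})`. Rows and columns are counted from `0`,
so `Γ_j` belongs to column `j + 1`. -/
def jump (V : ℝ[X]) (D : ℕ) (x : ℂ) : Matrix (Fin (D + 1)) (Fin (D + 1)) ℂ :=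
  Matrix.of fun i j =>
    if i = j then 1
    else if i = 0 then
      if j = 1 then
        Set.indicator {w : ℂ | w.im = 0} (fun w => Complex.exp (-2 * aeval w V)) x
      else Set.indicator (arc D (j.val - 1)) (fun w => Complex.exp (-aeval w V)) x
    else 0

/-- `diag (z^{2n+D-1}, z^{-2n}, z^{-1}, …, z^{-1})`. -/
def growth (D n : ℕ) (z : ℂ) : Matrix (Fin (D + 1)) (Fin (D + 1)) ℂ :=
  Matrix.diagonal fun i =>
    if i = 0 then z ^ (2 * (n : ℤ) + D - 1) else if i = 1 then z ^ (-2 * (n : ℤ)) else z ^ (-1 : ℤ)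

/-- `A` solves the even Riemann-Hilbert problem with potential `V` of degree `D` and index `n`.
Only the values of `A` on `ℂ \ Γ` matter. -/
structure IsEvenSolution (V : ℝ[X]) (D n : ℕ)
    (A : ℂ → Matrix (Fin (D + 1)) (Fin (D + 1)) ℂ) : Prop where
  analytic : ∀ i j, DifferentiableOn ℂ (fun z => A z i j) (contour D)ᶜ
  boundary : ∃ Ap Am : ℂ → Matrix (Fin (D + 1)) (Fin (D + 1)) ℂ,
    ContinuousOn Ap (contour D \ {0}) ∧ ContinuousOn Am (contour D \ {0}) ∧
    (∀ k < D, ∀ x ∈ ray D k, x ≠ 0 →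
      IsPlusValue D k A x (Ap x) ∧ IsMinusValue D k A x (Am x)) ∧
    ∀ x ∈ contour D \ {0}, Ap x = Am x * jump V D x
  bounded_near_zero : ∃ r > (0 : ℝ), ∃ C : ℝ,
    ∀ z, z ∉ contour D → ‖z‖ < r → ∀ i j, ‖A z i j‖ ≤ C
  normalised : ∃ E : ℂ → Matrix (Fin (D + 1)) (Fin (D + 1)) ℂ,
    (∀ i j, (fun z => E z i j)
      =O[Bornology.cobounded ℂ ⊓ 𝓟 (contour D)ᶜ] (fun z : ℂ => z⁻¹)) ∧
    ∀ᶠ z in Bornology.cobounded ℂ ⊓ 𝓟 (contour D)ᶜ, A z = (1 + E z) * growth D n z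

/-- The right-hand side of the Christoffel-Darboux formula, with `M`, `N` in the places of
`A_n(x)` and `A_n(y)`; the `(2,1)` entry is the entry `1 0` when counting from `0`. -/
def cdRHS (V : ℝ[X]) (D : ℕ) (x y : ℂ) (M N : Matrix (Fin (D + 1)) (Fin (D + 1)) ℂ) : ℂ :=
  -(1 / (4 * Real.pi * Complex.I)) * Complex.exp (-aeval x V - aeval y V)
    * ((M⁻¹ * N) 1 0 / (x - y))

end SkewRH

end

noncomputable section

namespace SkewRH

/-! Write `T q = q' - V' q`, so that `(q e^{-V})' = (T q) e^{-V}`.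

Existence. A row of a solution has a polynomial `p` as first entry, and the jumps are met by taking
Cauchy transforms of `p e^{-2V}` over the real line and of `p e^{-V}` over the arcs as the other
entries. The normalisation at infinity then prescribes `2n` moments of `p` against `e^{-2V}` and its
`D - 1` integrals over the arcs: `2n + D - 1` linear conditions on polynomials of degree less than
`2n + D - 1` (`momentMap`). They are independent. Division with remainder gives `p = p₀ + T q` with
`deg p₀ < D - 1` and `deg q < 2n`. Since `T q` integrates to zero over each arc, `p₀` is killed by
all arcs, hence is zero (`eq_zero_of_arcMoment_eq_zero`). The remaining moments pair `q` with all
polynomials of degree less than `2n` in the skew form, which is non-degenerate there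
(`eq_zero_of_cskew_right`). Arc non-degeneracy is reduced to the weight `e^{-c z^D}`, where it is a
Vandermonde determinant. Skew non-degeneracy comes from `⟨q, X q⟩₄ = ½ ∫ q² e^{-2V}` and a variant
of it when `q` has a real root.

Uniqueness. If `A`, `B` are solutions, `B adj(A)` has no jump, is bounded near the origin and tends
to the identity, so it is the identity by Liouville (`IsEvenSolution.mul_adjugate_eq_one`). Taking
`B = A` gives `det A = 1`.

Formula. The unit row picking out the row of index 1 is not affected by the jump, so that row of
`A⁻¹` consists of polynomials of degree at most `2n`. Hence `(A⁻¹(x) A(y))₂₁ = (x - y) K(x)` with a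
polynomial `K` of degree less than `2n`. For `deg q < 2n`, the row of Cauchy transforms built from
`T q` times `A⁻¹` is entire up to an explicit Cauchy transform. Liouville computes it, and
multiplying back by `A(y)` yields `∫ K e^{-V} (q e^{-V})' = -2πi (T q)(y)`
(`IsEvenSolution.exists_kernel`). The pre-kernel, freed of its exponentials, reproduces `½ (T
q)(y)`. By non-degeneracy the two polynomials are proportional, with factor `-1/(4πi)`. The
statements on boundary values and at the origin follow by continuity. -/

/-! ### Removability of a line, and Liouville's theorem off a thin set -/

/-- A continuous function that is holomorphic off the real axis is holomorphic. -/
theorem differentiableOn_of_continuousOn_of_im_ne_zero {f : ℂ → ℂ} {U : Set ℂ} (hU : IsOpen U)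
    (hc : ContinuousOn f U) (hd : ∀ z ∈ U, z.im ≠ 0 → DifferentiableAt ℂ f z) :
    DifferentiableOn ℂ f U := by
  refine (Complex.isConservativeOn_and_continuousOn_iff_isDifferentiableOn hU).1 ⟨?_, hc⟩
  have key : ∀ z w : ℂ, Complex.Rectangle z w ⊆ U →
      (0 : ℝ) ∉ Set.Ioo (min z.im w.im) (max z.im w.im) →
      (∫ x : ℝ in z.re..w.re, f (x + z.im * Complex.I))
        - (∫ x : ℝ in z.re..w.re, f (x + w.im * Complex.I))
        + Complex.I • (∫ y : ℝ in z.im..w.im, f (w.re + y * Complex.I))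
        - Complex.I • (∫ y : ℝ in z.im..w.im, f (z.re + y * Complex.I)) = 0 := by
    intro z w hzw h0
    refine Complex.integral_boundary_rect_eq_zero_of_continuousOn_of_differentiableOn f z w
      (hc.mono hzw) fun x hx => (hd x (hzw ?_) ?_).differentiableWithinAt
    · rw [Complex.mem_reProdIm] at hx
      exact Complex.mem_reProdIm.2 ⟨Set.Ioo_subset_Icc_self hx.1, Set.Ioo_subset_Icc_self hx.2⟩
    · intro h
      rw [Complex.mem_reProdIm, h] at hx
      exact h0 hx.2
  intro z w hzw
  rw [← add_eq_zero_iff_eq_neg, Complex.wedgeIntegral_add_wedgeIntegral_eq]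
  -- Morera's theorem: Cauchy's theorem on a rectangle needs only continuity on the boundary, so a
  -- rectangle crossed by the axis is cut along it, and the two integrals over the cut cancel.
  by_cases h0 : (0 : ℝ) ∈ Set.Ioo (min z.im w.im) (max z.im w.im)
  · have h0' : (0 : ℝ) ∈ Set.uIcc z.im w.im := Set.Ioo_subset_Icc_self h0
    have s1 : Complex.Rectangle z (w.re + (0 : ℝ) * Complex.I) ⊆ Complex.Rectangle z w := by
      refine Set.inter_subset_inter (Set.preimage_mono (by simp)) (Set.preimage_mono ?_)
      simpa using Set.uIcc_subset_uIcc_left h0'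
    have s2 : Complex.Rectangle (z.re + (0 : ℝ) * Complex.I) w ⊆ Complex.Rectangle z w := by
      refine Set.inter_subset_inter (Set.preimage_mono (by simp)) (Set.preimage_mono ?_)
      simpa using Set.uIcc_subset_uIcc_right h0'
    have k1 := key z (w.re + (0 : ℝ) * Complex.I) (s1.trans hzw) (by
      simp only [Complex.add_im, Complex.ofReal_im, Complex.mul_im, Complex.ofReal_re,
        Complex.I_im, Complex.I_re]
      simp only [Set.mem_Ioo, not_and_or, not_lt]
      rcases le_total z.im 0 with h | h <;> simp [h])
    have k2 := key (z.re + (0 : ℝ) * Complex.I) w (s2.trans hzw) (by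
      simp only [Complex.add_im, Complex.ofReal_im, Complex.mul_im, Complex.ofReal_re,
        Complex.I_im, Complex.I_re]
      simp only [Set.mem_Ioo, not_and_or, not_lt]
      rcases le_total w.im 0 with h | h <;> simp [h])
    have hInt : ∀ a ∈ Set.uIcc z.re w.re, ∀ b c : ℝ, b ∈ Set.uIcc z.im w.im →
        c ∈ Set.uIcc z.im w.im →
        IntervalIntegrable (fun y : ℝ => f (a + y * Complex.I)) volume b c := by
      intro a ha b c hb hc'
      refine ContinuousOn.intervalIntegrable ((hc.mono hzw).comp (by fun_prop) ?_)
      intro y hy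
      refine Complex.mem_reProdIm.2 ⟨by simpa using ha, ?_⟩
      simpa using Set.uIcc_subset_uIcc hb hc' hy
    have e1 := intervalIntegral.integral_add_adjacent_intervals
      (hInt w.re Set.right_mem_uIcc z.im 0 Set.left_mem_uIcc h0')
      (hInt w.re Set.right_mem_uIcc 0 w.im h0' Set.right_mem_uIcc)
    have e2 := intervalIntegral.integral_add_adjacent_intervals
      (hInt z.re Set.left_mem_uIcc z.im 0 Set.left_mem_uIcc h0')
      (hInt z.re Set.left_mem_uIcc 0 w.im h0' Set.right_mem_uIcc)
    simp at k1 k2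
    rw [← e1, ← e2]
    simp only [smul_eq_mul]
    linear_combination k1 + k2
  · exact key z w hzw h0

/-- A continuous function that is holomorphic off a line through the origin is holomorphic. -/
theorem differentiableOn_of_continuousOn_of_div_im_ne_zero {f : ℂ → ℂ} {U : Set ℂ} {d : ℂ}
    (hd0 : d ≠ 0) (hU : IsOpen U) (hc : ContinuousOn f U)
    (hd : ∀ z ∈ U, (z / d).im ≠ 0 → DifferentiableAt ℂ f z) : DifferentiableOn ℂ f U := by
  have h1 : DifferentiableOn ℂ (fun u => f (u * d)) ((fun u : ℂ => u * d) ⁻¹' U) := by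
    refine differentiableOn_of_continuousOn_of_im_ne_zero (hU.preimage (by fun_prop))
      (hc.comp (by fun_prop) fun u hu => hu) fun u hu hi => ?_
    refine DifferentiableAt.fun_comp' u (hd _ hu (by rwa [mul_div_cancel_right₀ _ hd0])) (by fun_prop)
  have h2 : DifferentiableOn ℂ ((fun u => f (u * d)) ∘ fun z => z / d) U :=
    h1.comp (by fun_prop) fun z hz => by simpa [hd0] using hz
  refine h2.congr fun z _ => ?_
  simp [hd0]

/-- Liouville's theorem for an entire function whose limit at infinity is known only
along a dense set. -/
theorem eq_const_of_tendsto_cobounded_inf {g : ℂ → ℂ} (hg : Differentiable ℂ g) {S : Set ℂ}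
    (hS : Dense S) {c : ℂ} (h : Tendsto g (Bornology.cobounded ℂ ⊓ 𝓟 S) (𝓝 c)) (z : ℂ) :
    g z = c := by
  have hlim : Tendsto g (Filter.cocompact ℂ) (𝓝 c) := by
    rw [← Metric.cobounded_eq_cocompact, Metric.tendsto_nhds] 
    intro ε hε
    have h1 := (Metric.tendsto_nhds.1 h) (ε / 2) (half_pos hε)
    rw [eventually_inf_principal, Filter.HasBasis.eventually_iff (Metric.hasBasis_cobounded_compl_closedBall 0)] at h1
    obtain ⟨R, -, hR⟩ := h1
    rw [Filter.HasBasis.eventually_iff (Metric.hasBasis_cobounded_compl_closedBall (0 : ℂ))]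
    refine ⟨R, trivial, fun x hx => ?_⟩
    -- The bound holds on a dense part of the exterior of a disc and passes to all of it by
    -- continuity, where it becomes non-strict; hence the `ε / 2`.
    have hx' : x ∈ closure ((Metric.closedBall (0 : ℂ) R)ᶜ ∩ S) :=
      (hS.open_subset_closure_inter Metric.isClosed_closedBall.isOpen_compl) hx
    have h2 : dist (g x) c ≤ ε / 2 := by
      have hcl : IsClosed {y | dist (g y) c ≤ ε / 2} :=
        isClosed_le (hg.continuous.dist continuous_const) continuous_const
      refine closure_minimal (fun y hy => ?_) hcl hx'
      exact (hR hy.1 hy.2).le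
    linarith
  exact hg.apply_eq_of_tendsto_cocompact z hlim

/-- An entire function of polynomial growth along a dense set is a polynomial. -/
theorem exists_polynomial_of_isBigO_cobounded_inf {S : Set ℂ} (hS : Dense S) (N : ℕ) :
    ∀ {g : ℂ → ℂ}, Differentiable ℂ g →
      (g =O[Bornology.cobounded ℂ ⊓ 𝓟 S] fun z => z ^ N) →
      ∃ p : ℂ[X], p.natDegree ≤ N ∧ ∀ z, g z = p.eval z := by
  induction N with
  | zero =>
    intro g hg hO
    -- The quotient `(g z - g 0) / z` is entire and grows one order less than `g`; for bounded `g`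
    -- it tends to zero and so vanishes.
    have hds : Differentiable ℂ (dslope g 0) := by
      rw [← differentiableOn_univ] at hg ⊢
      exact (Complex.differentiableOn_dslope (by simp)).2 hg
    have h0 : ∀ z, dslope g 0 z = 0 := by
      refine eq_const_of_tendsto_cobounded_inf hds hS ?_
      have hz : Tendsto (fun z : ℂ => z⁻¹) (Bornology.cobounded ℂ ⊓ 𝓟 S) (𝓝 0) :=
        tendsto_inv₀_cobounded.mono_left inf_le_left
      have h1 : (fun z => g z - g 0) =O[Bornology.cobounded ℂ ⊓ 𝓟 S] fun _ => (1 : ℂ) := by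
        refine Asymptotics.IsBigO.sub (by simpa using hO) (Asymptotics.isBigO_const_const _ one_ne_zero _)
      have h2 := (Asymptotics.isBigO_refl (fun z : ℂ => z⁻¹) (Bornology.cobounded ℂ ⊓ 𝓟 S)).mul h1
      have h3 : (dslope g 0) =ᶠ[Bornology.cobounded ℂ ⊓ 𝓟 S] fun z => z⁻¹ * (g z - g 0) := by
        filter_upwards [(Bornology.eventually_ne_cobounded (0 : ℂ)).filter_mono inf_le_left] with z hz
        rw [dslope_of_ne _ hz, slope_def_field]
        simp; ring
      refine (h3.trans_isBigO h2).trans_tendsto ?_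
      simpa using hz
    refine ⟨C (g 0), by simp, fun z => ?_⟩
    have := sub_smul_dslope g 0 z
    rw [h0 z] at this
    simp at this
    simp [sub_eq_zero.1 this.symm]
  | succ N ih =>
    intro g hg hO
    have hds : Differentiable ℂ (dslope g 0) := by
      rw [← differentiableOn_univ] at hg ⊢
      exact (Complex.differentiableOn_dslope (by simp)).2 hg
    have hO' : (dslope g 0) =O[Bornology.cobounded ℂ ⊓ 𝓟 S] fun z => z ^ N := by
      have hone : (fun _ : ℂ => g 0) =O[Bornology.cobounded ℂ ⊓ 𝓟 S] fun z : ℂ => z ^ (N + 1) := by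
        refine Asymptotics.IsBigO.mono ?_ inf_le_left
        refine (Asymptotics.isLittleO_const_left.2 (Or.inr ?_)).isBigO
        simp only [Function.comp_def, norm_pow]
        exact (tendsto_pow_atTop (by omega)).comp tendsto_norm_cobounded_atTop
      have h1 := hO.sub hone
      have h2 := (Asymptotics.isBigO_refl (fun z : ℂ => z⁻¹) (Bornology.cobounded ℂ ⊓ 𝓟 S)).mul h1
      have hne : ∀ᶠ z : ℂ in Bornology.cobounded ℂ ⊓ 𝓟 S, z ≠ 0 :=
        (Bornology.eventually_ne_cobounded (0 : ℂ)).filter_mono inf_le_left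
      refine (h2.congr' ?_ ?_)
      · filter_upwards [hne] with z hz
        rw [dslope_of_ne _ hz, slope_def_field]
        simp; ring
      · filter_upwards [hne] with z hz
        rw [pow_succ]; field_simp
    obtain ⟨p, hp, hpe⟩ := ih hds hO'
    refine ⟨C (g 0) + X * p, ?_, fun z => ?_⟩
    · refine natDegree_add_le_of_degree_le (by simp) ((natDegree_mul_le).trans ?_)
      rw [natDegree_X]; omega
    · have := sub_smul_dslope g 0 z
      rw [hpe] at this
      simp at this
      simp [this]

/-! ### Geometry of the contour -/

theorem dir_eq_pow (D k : ℕ) : dir D k = Complex.exp (2 * Real.pi * Complex.I / D) ^ k := by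
  rw [dir, ← Complex.exp_nat_mul]; congr 1; ring

@[simp] theorem dir_zero (D : ℕ) : dir D 0 = 1 := by simp [dir]

@[simp] theorem dir_ne_zero (D k : ℕ) : dir D k ≠ 0 := Complex.exp_ne_zero _

@[simp] theorem norm_dir (D k : ℕ) : ‖dir D k‖ = 1 := by
  have : dir D k = Complex.exp ((2 * Real.pi * k / D : ℝ) * Complex.I) := by
    rw [dir]; congr 1; push_cast; ring
  rw [this, Complex.norm_exp_ofReal_mul_I]

theorem dir_pow_self {D : ℕ} (hD : D ≠ 0) (k : ℕ) : dir D k ^ D = 1 := by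
  rw [dir_eq_pow, ← pow_mul, Nat.mul_comm, pow_mul, (Complex.isPrimitiveRoot_exp D hD).pow_eq_one,
    one_pow]

theorem dir_inj {D : ℕ} (hD : D ≠ 0) {j k : ℕ} (hj : j < D) (hk : k < D)
    (h : dir D j = dir D k) : j = k := by
  rw [dir_eq_pow, dir_eq_pow] at h
  exact (Complex.isPrimitiveRoot_exp D hD).pow_inj hj hk h

/-- Evenness of `D` makes the negative half-axis one of the rays, and therefore the real line the
arc with index `D / 2`. -/
theorem dir_half {D : ℕ} (hD : Even D) (hD0 : D ≠ 0) : dir D (D / 2) = -1 := by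
  obtain ⟨m, rfl⟩ := hD
  have hm : (m : ℂ) ≠ 0 := by
    intro h; apply hD0; have : m = 0 := by exact_mod_cast h
    omega
  rw [dir, ← two_mul, Nat.mul_div_cancel_left m two_pos]
  rw [← Complex.exp_pi_mul_I]
  congr 1
  push_cast
  field_simp

theorem mem_ray_iff {D k : ℕ} {z : ℂ} :
    z ∈ ray D k ↔ 0 ≤ (z / dir D k).re ∧ (z / dir D k).im = 0 := by
  constructor
  · rintro ⟨t, ht, rfl⟩
    simp [ht]
  · rintro ⟨h1, h2⟩
    refine ⟨(z / dir D k).re, h1, ?_⟩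
    have : ((z / dir D k).re : ℂ) = z / dir D k := Complex.ext (by simp) (by simp [h2])
    rw [this]; simp

theorem isClosed_ray (D k : ℕ) : IsClosed (ray D k) := by
  have : ray D k = {z | 0 ≤ (z / dir D k).re} ∩ {z | (z / dir D k).im = 0} := by
    ext z; exact mem_ray_iff
  rw [this]
  exact (isClosed_le continuous_const (by fun_prop)).inter
    (isClosed_eq (by fun_prop) continuous_const)

theorem zero_mem_ray (D k : ℕ) : (0 : ℂ) ∈ ray D k := ⟨0, le_rfl, by simp⟩

theorem mem_contour_iff {D : ℕ} (hD : 2 ≤ D) {z : ℂ} :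
    z ∈ contour D ↔ ∃ k < D, z ∈ ray D k := by
  constructor
  · rintro ⟨j, -, h2, h | h⟩
    exacts [⟨0, by omega, h⟩, ⟨j, h2, h⟩]
  · rintro ⟨k, hk, h⟩
    rcases Nat.eq_zero_or_pos k with rfl | h0
    · exact ⟨1, le_rfl, by omega, Or.inl h⟩
    · exact ⟨k, h0, hk, Or.inr h⟩

theorem isClosed_contour {D : ℕ} (hD : 2 ≤ D) : IsClosed (contour D) := by
  have : contour D = ⋃ k ∈ Finset.range D, ray D k := by
    ext z; simp [mem_contour_iff hD]
  rw [this]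
  exact isClosed_biUnion_finset fun k _ => isClosed_ray D k

/-- Two distinct rays meet only at the origin. -/
theorem eq_of_mem_ray {D j k : ℕ} (hD : D ≠ 0) (hj : j < D) (hk : k < D) {z : ℂ} (hz : z ≠ 0)
    (h1 : z ∈ ray D j) (h2 : z ∈ ray D k) : j = k := by
  obtain ⟨s, hs, rfl⟩ := h1
  obtain ⟨t, ht, h⟩ := h2
  have hst : s = t := by
    have := congrArg norm h
    simpa [abs_of_nonneg hs, abs_of_nonneg ht] using this
  have hs0 : (s : ℂ) ≠ 0 := left_ne_zero_of_mul hz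
  rw [← hst] at h
  exact dir_inj hD hj hk (mul_left_cancel₀ hs0 h)

theorem div_dir_re_pos {D k : ℕ} {x : ℂ} (hx : x ∈ ray D k) (hx0 : x ≠ 0) :
    0 < (x / dir D k).re := by
  obtain ⟨h1, h2⟩ := mem_ray_iff.1 hx
  refine lt_of_le_of_ne h1 fun h => hx0 ?_
  have : x / dir D k = 0 := Complex.ext (by simp [← h]) (by simp [h2])
  simpa using this

/-- The other rays are closed and miss `x`, and a half-plane around `x` removes the opposite half of
the line. Locally the contour is thus a full line through the origin, to which removability applies.
-/
theorem eventually_mem_contour_iff {D k : ℕ} (hD : 2 ≤ D) (hk : k < D) {x : ℂ}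
    (hx : x ∈ ray D k) (hx0 : x ≠ 0) :
    ∀ᶠ z in 𝓝 x, (z ∈ contour D ↔ (z / dir D k).im = 0) := by
  have h1 : ∀ᶠ z in 𝓝 x, ∀ j ∈ Finset.range D, j ≠ k → z ∉ ray D j := by
    rw [Filter.eventually_all_finset]
    intro j hj
    by_cases hjk : j = k
    · simp [hjk]
    · have : ∀ᶠ z in 𝓝 x, z ∉ ray D j := (isClosed_ray D j).isOpen_compl.mem_nhds fun h =>
        hjk (eq_of_mem_ray (by omega) (Finset.mem_range.1 hj) hk hx0 h hx)
      exact this.mono fun z hz _ => hz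
  have h2 : ∀ᶠ z in 𝓝 x, 0 < (z / dir D k).re :=
    (isOpen_lt continuous_const (by fun_prop)).mem_nhds (div_dir_re_pos hx hx0)
  filter_upwards [h1, h2] with z hz1 hz2
  rw [mem_contour_iff hD]
  constructor
  · rintro ⟨j, hj, hzj⟩
    by_cases hjk : j = k
    · exact (mem_ray_iff.1 (hjk ▸ hzj)).2
    · exact absurd hzj (hz1 j (Finset.mem_range.2 hj) hjk)
  · intro h
    exact ⟨k, hk, mem_ray_iff.2 ⟨hz2.le, h⟩⟩

theorem im_div_tangent (D k : ℕ) (z : ℂ) :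
    (z / tangent D k).im = (if k = 0 then 1 else -1) * (z / dir D k).im := by
  unfold tangent
  split_ifs <;> simp [div_neg]

theorem nhdsWithin_compl_contour_le {D k : ℕ} (hD : 2 ≤ D) (hk : k < D) {x : ℂ}
    (hx : x ∈ ray D k) (hx0 : x ≠ 0) :
    𝓝[(contour D)ᶜ] x ≤ 𝓝[leftSide D k \ contour D] x ⊔ 𝓝[rightSide D k \ contour D] x := by
  rw [← nhdsWithin_union, nhdsWithin_le_iff]
  filter_upwards [self_mem_nhdsWithin,
    (eventually_mem_contour_iff hD hk hx hx0).filter_mono nhdsWithin_le_nhds] with z hz1 hz2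
  have : (z / dir D k).im ≠ 0 := fun h => hz1 (hz2.2 h)
  have h3 : (z / tangent D k).im ≠ 0 := by
    rw [im_div_tangent]; split_ifs <;> simpa
  rcases lt_or_gt_of_ne h3 with h | h
  exacts [Or.inr ⟨h, hz1⟩, Or.inl ⟨h, hz1⟩]

/-- The rays lie on finitely many lines, and finitely many dense open sets have a dense
intersection. -/
theorem dense_compl_contour {D : ℕ} (hD : 2 ≤ D) : Dense (contour D)ᶜ := by
  have h1 : ∀ k : Fin D, Dense {z : ℂ | (z / dir D k).im ≠ 0} := by
    intro k z
    by_cases hz : (z / dir D k).im ≠ 0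
    · exact subset_closure hz
    · rw [not_not] at hz
      have ht : Tendsto (fun ε : ℝ => z + ε * (Complex.I * dir D k)) (𝓝[>] 0) (𝓝 z) := by
        have : Tendsto (fun ε : ℝ => z + ε * (Complex.I * dir D k)) (𝓝 0)
            (𝓝 (z + (0 : ℝ) * (Complex.I * dir D k))) := Continuous.tendsto (by fun_prop) _
        simp only [Complex.ofReal_zero, zero_mul, add_zero] at this
        exact this.mono_left nhdsWithin_le_nhds
      refine mem_closure_of_tendsto ht ?_
      filter_upwards [self_mem_nhdsWithin] with ε hε
      have : (z + ε * (Complex.I * dir D k)) / dir D k = z / dir D k + ε * Complex.I := by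
        field_simp [dir_ne_zero]
      change ((z + ε * (Complex.I * dir D k)) / dir D k).im ≠ 0
      rw [this]
      simpa [hz] using (Set.mem_Ioi.1 hε).ne'
  have h2 : Dense (⋂ k : Fin D, {z : ℂ | (z / dir D k).im ≠ 0}) :=
    dense_iInter_of_isOpen (fun k => isOpen_ne_fun (by fun_prop) continuous_const) h1
  refine h2.mono fun z hz hc => ?_
  obtain ⟨k, hk, h⟩ := (mem_contour_iff hD).1 hc
  exact Set.mem_iInter.1 hz ⟨k, hk⟩ (mem_ray_iff.1 h).2

/-- Approach `x` along the normal to the ray. This makes the one-sided filters non-trivial, so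
boundary values are unique. -/
theorem mem_closure_side {D k : ℕ} (hD : 2 ≤ D) (hk : k < D) {x : ℂ}
    (hx : x ∈ ray D k) (hx0 : x ≠ 0) :
    x ∈ closure (leftSide D k \ contour D) ∧ x ∈ closure (rightSide D k \ contour D) := by
  have hT : tangent D k ≠ 0 := by unfold tangent; split_ifs <;> simp
  have hxT : (x / tangent D k).im = 0 := by rw [im_div_tangent, (mem_ray_iff.1 hx).2, mul_zero]
  have key : ∀ σ : ℝ, σ ≠ 0 → Tendsto (fun ε : ℝ => x + (σ * ε) * (Complex.I * tangent D k))
      (𝓝[>] 0) (𝓝 x) ∧ ∀ᶠ ε : ℝ in 𝓝[>] 0, x + (σ * ε) * (Complex.I * tangent D k) ∉ contour D ∧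
        ((x + (σ * ε) * (Complex.I * tangent D k)) / tangent D k).im = σ * ε := by
    intro σ hσ
    have ht : Tendsto (fun ε : ℝ => x + (σ * ε) * (Complex.I * tangent D k)) (𝓝[>] 0) (𝓝 x) := by
      have : Tendsto (fun ε : ℝ => x + (σ * ε) * (Complex.I * tangent D k)) (𝓝 0)
          (𝓝 (x + (σ * (0 : ℝ)) * (Complex.I * tangent D k))) := Continuous.tendsto (by fun_prop) _
      simp only [Complex.ofReal_zero, zero_mul, add_zero, mul_zero] at this
      exact this.mono_left nhdsWithin_le_nhds
    refine ⟨ht, ?_⟩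
    filter_upwards [self_mem_nhdsWithin, ht (eventually_mem_contour_iff hD hk hx hx0)] with ε hε hc
    have e : ((x + (σ * ε) * (Complex.I * tangent D k)) / tangent D k).im = σ * ε := by
      have : (x + (σ * ε) * (Complex.I * tangent D k)) / tangent D k
          = x / tangent D k + ((σ * ε : ℝ) : ℂ) * Complex.I := by
        push_cast; field_simp
      rw [this]
      simp only [Complex.add_im, hxT, zero_add, Complex.im_ofReal_mul,
        Complex.I_im, mul_one]
    refine ⟨fun h => ?_, e⟩
    have h2 := hc.1 h
    rw [im_div_tangent, h2, mul_zero] at e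
    exact mul_ne_zero hσ (Set.mem_Ioi.1 hε).ne' e.symm
  obtain ⟨t1, e1⟩ := key 1 one_ne_zero
  obtain ⟨t2, e2⟩ := key (-1) (by norm_num)
  constructor
  · refine mem_closure_of_tendsto t1 ?_
    filter_upwards [e1, self_mem_nhdsWithin] with ε hε h0
    refine ⟨?_, hε.1⟩
    simp only [leftSide, Set.mem_ofPred_eq]
    rw [hε.2, one_mul]; exact h0
  · refine mem_closure_of_tendsto t2 ?_
    filter_upwards [e2, self_mem_nhdsWithin] with ε hε h0
    refine ⟨?_, hε.1⟩
    simp only [rightSide, Set.mem_ofPred_eq]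
    rw [hε.2]; have := Set.mem_Ioi.1 h0; linarith

/-- A function that is analytic off the contour, takes equal boundary values from both sides and is
bounded near the origin extends to an entire function. -/
theorem exists_entire_of_no_jump {D : ℕ} (hD : 2 ≤ D) {f : ℂ → ℂ}
    (hf : DifferentiableOn ℂ f (contour D)ᶜ)
    (hj : ∀ k < D, ∀ x ∈ ray D k, x ≠ 0 → ∃ l, Tendsto f (𝓝[leftSide D k \ contour D] x) (𝓝 l) ∧
      Tendsto f (𝓝[rightSide D k \ contour D] x) (𝓝 l))
    (hb : ∃ r > (0 : ℝ), ∃ C : ℝ, ∀ z, z ∉ contour D → ‖z‖ < r → ‖f z‖ ≤ C) :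
    ∃ g : ℂ → ℂ, Differentiable ℂ g ∧ ∀ z, z ∉ contour D → f z = g z := by
  have hlim : ∀ x ∈ ({0}ᶜ : Set ℂ), ∃ l, Tendsto f (𝓝[(contour D)ᶜ] x) (𝓝 l) := by
    intro x hx
    by_cases hxc : x ∈ contour D
    · obtain ⟨k, hk, hxk⟩ := (mem_contour_iff hD).1 hxc
      obtain ⟨l, h1, h2⟩ := hj k hk x hxk hx
      exact ⟨l, (h1.sup h2).mono_left (nhdsWithin_compl_contour_le hD hk hxk hx)⟩
    · exact ⟨f x, (hf x hxc).continuousWithinAt⟩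
  set g := extendFrom (contour D)ᶜ f with hg
  have hgf : ∀ z, z ∉ contour D → g z = f z := fun z hz =>
    extendFrom_eq (subset_closure hz) (hf z hz).continuousWithinAt
  have hgc : ContinuousOn g {0}ᶜ :=
    continuousOn_extendFrom (fun x _ => dense_compl_contour hD x) hlim
  have hgd : ∀ z, z ∉ contour D → DifferentiableAt ℂ g z := fun z hz => by
    have hn := (isClosed_contour hD).isOpen_compl.mem_nhds hz
    refine (hf.differentiableAt hn).congr_of_eventuallyEq ?_
    filter_upwards [hn] with w hw using hgf w hw
  have hgd' : DifferentiableOn ℂ g {0}ᶜ := by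
    intro x hx
    by_cases hxc : x ∈ contour D
    · obtain ⟨k, hk, hxk⟩ := (mem_contour_iff hD).1 hxc
      -- At a nonzero point of the contour the continuous extension can fail to be holomorphic only
      -- on a line.
      obtain ⟨U, hU, hUo, hxU⟩ := _root_.eventually_nhds_iff.1
        ((eventually_mem_contour_iff hD hk hxk hx).and (isOpen_compl_singleton.mem_nhds hx))
      have := differentiableOn_of_continuousOn_of_div_im_ne_zero (dir_ne_zero D k) hUo
        (hgc.mono fun z hz => (hU z hz).2) fun z hz hi => hgd z fun h => hi ((hU z hz).1.1 h)
      exact (this.differentiableAt (hUo.mem_nhds hxU)).differentiableWithinAt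
    · exact (hgd x hxc).differentiableWithinAt
  obtain ⟨r, hr, C, hC⟩ := hb
  have hbd : ∀ z ∈ Metric.ball (0 : ℂ) r \ {0}, ‖g z‖ ≤ C := by
    intro z hz
    have hcl : z ∈ closure ((Metric.ball (0 : ℂ) r \ {0}) ∩ (contour D)ᶜ) :=
      (dense_compl_contour hD).open_subset_closure_inter
        (Metric.isOpen_ball.sdiff isClosed_singleton) hz
    have hne : (𝓝[(Metric.ball (0 : ℂ) r \ {0}) ∩ (contour D)ᶜ] z).NeBot :=
      mem_closure_iff_nhdsWithin_neBot.1 hcl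
    have ht : Tendsto g (𝓝[(Metric.ball (0 : ℂ) r \ {0}) ∩ (contour D)ᶜ] z) (𝓝 (g z)) :=
      (hgc z hz.2).mono fun w hw => hw.1.2
    refine le_of_tendsto ht.norm ?_
    filter_upwards [self_mem_nhdsWithin] with w hw
    rw [hgf w hw.2]
    exact hC w hw.2 (by simpa using hw.1.1)
  -- At the origin, where the rays meet, boundedness makes the isolated singularity removable.
  have hrem := Complex.differentiableOn_update_limUnder_of_bddAbove
    (f := g) (Metric.ball_mem_nhds (0 : ℂ) hr) (hgd'.mono fun z hz => hz.2)
    ⟨C, by rintro _ ⟨z, hz, rfl⟩; exact hbd z hz⟩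
  refine ⟨Function.update g 0 (limUnder (𝓝[≠] 0) g), fun z => ?_, fun z hz => ?_⟩
  · by_cases hz : z = 0
    · subst hz
      exact hrem.differentiableAt (Metric.ball_mem_nhds 0 hr)
    · have hn := isOpen_compl_singleton.mem_nhds hz
      refine (hgd'.differentiableAt hn).congr_of_eventuallyEq ?_
      filter_upwards [hn] with w hw
      rw [Function.update_of_ne hw]
  · have hz0 : z ≠ 0 := by
      rintro rfl
      exact hz ((mem_contour_iff hD).2 ⟨0, by omega, zero_mem_ray D 0⟩)
    rw [Function.update_of_ne hz0, hgf z hz]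

/-! ### Exponential weights on the rays -/

theorem exists_norm_eval_le (p : ℂ[X]) {N : ℕ} (hN : p.natDegree ≤ N) :
    ∃ B, 0 ≤ B ∧ ∀ z, ‖p.eval z‖ ≤ B * (1 + ‖z‖) ^ N := by
  refine ⟨∑ i ∈ Finset.range (N + 1), ‖p.coeff i‖, by positivity, fun z => ?_⟩
  rw [eval_eq_sum_range' (Nat.lt_succ_of_le hN), Finset.sum_mul]
  refine (norm_sum_le _ _).trans (Finset.sum_le_sum fun i hi => ?_)
  rw [norm_mul, norm_pow]
  refine mul_le_mul_of_nonneg_left ?_ (norm_nonneg _)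
  calc ‖z‖ ^ i ≤ (1 + ‖z‖) ^ i := by gcongr; linarith
    _ ≤ (1 + ‖z‖) ^ N := pow_le_pow_right₀ (by linarith [norm_nonneg z])
        (Nat.lt_succ_iff.1 (Finset.mem_range.1 hi))

/-- Leaving the axis by at most 1 costs one power of growth, because `u^(n+2) - τ^(n+2) = u (u^(n+1)
- τ^(n+1)) + (u - τ) τ^(n+1)` with `τ = u.re`. -/
theorem norm_pow_sub_re_pow_le {u : ℂ} (h0 : 0 ≤ u.re) (h1 : |u.im| ≤ 1) (n : ℕ) :
    ‖u ^ (n + 1) - (u.re : ℂ) ^ (n + 1)‖ ≤ (n + 1) * (2 + u.re) ^ n := by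
  have hd : ‖u - u.re‖ ≤ 1 := by
    have : u - u.re = u.im * Complex.I := by
      rw [sub_eq_iff_eq_add, add_comm, Complex.re_add_im]
    rw [this]; simpa using h1
  have hu : ‖u‖ ≤ 2 + u.re := by
    calc ‖u‖ = ‖(u - u.re) + u.re‖ := by ring_nf
      _ ≤ ‖u - u.re‖ + ‖(u.re : ℂ)‖ := norm_add_le _ _
      _ ≤ 2 + u.re := by rw [Complex.norm_real, Real.norm_eq_abs, abs_of_nonneg h0]; linarith
  induction n with
  | zero => simpa using hd
  | succ n ih =>
    have e : u ^ (n + 1 + 1) - (u.re : ℂ) ^ (n + 1 + 1)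
        = u * (u ^ (n + 1) - (u.re : ℂ) ^ (n + 1)) + (u - u.re) * (u.re : ℂ) ^ (n + 1) := by ring
    rw [e]
    refine (norm_add_le _ _).trans ?_
    rw [norm_mul, norm_mul, norm_pow, Complex.norm_real, Real.norm_eq_abs, abs_of_nonneg h0]
    have h2 : u.re ^ (n + 1) ≤ (2 + u.re) ^ (n + 1) := by gcongr; linarith
    calc ‖u‖ * ‖u ^ (n + 1) - (u.re : ℂ) ^ (n + 1)‖ + ‖u - u.re‖ * u.re ^ (n + 1)
        ≤ (2 + u.re) * ((n + 1) * (2 + u.re) ^ n) + 1 * (2 + u.re) ^ (n + 1) := by gcongr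
      _ = _ := by push_cast; ring

/-- The summand `2 * τ` serves two ends later: one factor `e^{-τ}` absorbs a polynomial, the other
is the decay that remains. -/
theorem exists_add_le_mul_pow {c : ℝ} (hc : 0 < c) {B : ℝ} (hB : 0 ≤ B) {D : ℕ} (hD : 2 ≤ D) :
    ∃ K, ∀ τ : ℝ, 0 ≤ τ → B * (2 + τ) ^ (D - 1) + 2 * τ ≤ c * τ ^ D + K := by
  obtain ⟨m, rfl⟩ : ∃ m, D = m + 2 := ⟨D - 2, by omega⟩
  set B' := B * 2 ^ (m + 1) + 2 with hB'
  -- Beyond `M` one has `2 + τ ≤ 2τ` and `B' ≤ c τ`, so no constant is needed; below `M` the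
  -- constant does everything.
  set M := max 2 (B' / c) with hM
  have hM2 : 2 ≤ M := le_max_left _ _
  refine ⟨B * (2 + M) ^ (m + 1) + 2 * M, fun τ hτ => ?_⟩
  rw [show m + 2 - 1 = m + 1 from rfl]
  rcases le_total τ M with h | h
  · have h1 : (2 + τ) ^ (m + 1) ≤ (2 + M) ^ (m + 1) := by gcongr
    have h2 : 0 ≤ c * τ ^ (m + 2) := by positivity
    nlinarith [mul_le_mul_of_nonneg_left h1 hB]
  · have hτ2 : 2 ≤ τ := hM2.trans h
    have h1 : (2 + τ) ^ (m + 1) ≤ (2 * τ) ^ (m + 1) := by gcongr; linarith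
    have h2 : τ ≤ τ ^ (m + 1) := le_self_pow₀ (by linarith) (by omega)
    have h3 : B' ≤ c * τ := by
      have := (le_max_right 2 (B' / c)).trans h
      rwa [div_le_iff₀ hc, mul_comm] at this
    have h4 : B' * τ ^ (m + 1) ≤ c * τ * τ ^ (m + 1) := by gcongr
    have h5 : 0 ≤ B * (2 + M) ^ (m + 1) + 2 * M := by positivity
    rw [mul_pow] at h1
    have h6 := mul_le_mul_of_nonneg_left h1 hB
    calc B * (2 + τ) ^ (m + 1) + 2 * τ ≤ B * (2 ^ (m + 1) * τ ^ (m + 1)) + 2 * τ ^ (m + 1) := by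
          linarith
      _ = B' * τ ^ (m + 1) := by rw [hB']; ring
      _ ≤ c * τ * τ ^ (m + 1) := h4
      _ = c * τ ^ (m + 2) := by ring
      _ ≤ _ := by linarith

/-- The potentials considered here: complex polynomials of degree `D` with positive leading
coefficient. -/
structure IsPotential (D : ℕ) (U : ℂ[X]) : Prop where
  natDegree_eq : U.natDegree = D
  leadingCoeff_pos : ∃ c : ℝ, 0 < c ∧ U.leadingCoeff = c

/-- Since `dir D k ^ D = 1`, the leading term equals `c u^D` along every ray, and in the half-strip
everything else is of order `τ^(D-1)`. The spare factor `exp (B (2 + τ)^(D-1))` will pay for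
expanding the exponential of the lower-order terms of `U`. -/
theorem IsPotential.exists_norm_mul_exp_le {D : ℕ} {U : ℂ[X]} (hU : IsPotential D U) (hD : 2 ≤ D)
    (k : ℕ) (p : ℂ[X]) {B : ℝ} (hB : 0 ≤ B) :
    ∃ K, 0 ≤ K ∧ ∀ u : ℂ, 0 ≤ u.re → |u.im| ≤ 1 →
      ‖p.eval (u * dir D k)‖ * Real.exp (-(U.eval (u * dir D k)).re + B * (2 + u.re) ^ (D - 1))
        ≤ K * Real.exp (-u.re) := by
  obtain ⟨c, hc, hlc⟩ := hU.leadingCoeff_pos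
  have hW : U.eraseLead.natDegree ≤ D - 1 := by
    rw [← hU.natDegree_eq]; exact eraseLead_natDegree_le U
  obtain ⟨B1, hB1, hW⟩ := exists_norm_eval_le U.eraseLead hW
  obtain ⟨B2, hB2, hp⟩ := exists_norm_eval_le p le_rfl
  obtain ⟨K, hK⟩ := exists_add_le_mul_pow hc (B := c * D + B1 + B) (by positivity) hD
  refine ⟨B2 * (p.natDegree.factorial * Real.exp 2) * Real.exp K, by positivity,
    fun u h0 h1 => ?_⟩
  set τ := u.re with hτ
  have hn : ‖u * dir D k‖ ≤ τ + 1 := by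
    rw [norm_mul, norm_dir, mul_one]
    refine (Complex.norm_le_abs_re_add_abs_im u).trans ?_
    rw [abs_of_nonneg h0]; linarith
  have hp' : ‖p.eval (u * dir D k)‖ ≤ B2 * (p.natDegree.factorial * Real.exp 2) * Real.exp τ := by
    refine (hp _).trans ?_
    have h2 : (1 + ‖u * dir D k‖) ^ p.natDegree ≤ (2 + τ) ^ p.natDegree :=
      pow_le_pow_left₀ (by positivity) (by linarith) _
    have h3 := Real.pow_div_factorial_le_exp (2 + τ) (by linarith) p.natDegree
    rw [div_le_iff₀ (by positivity), Real.exp_add] at h3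
    calc B2 * (1 + ‖u * dir D k‖) ^ p.natDegree ≤ B2 * (2 + τ) ^ p.natDegree :=
          mul_le_mul_of_nonneg_left h2 hB2
      _ ≤ B2 * (Real.exp 2 * Real.exp τ * p.natDegree.factorial) := by gcongr
      _ = _ := by ring
  have hUre : c * τ ^ D - (c * D + B1) * (2 + τ) ^ (D - 1) ≤ (U.eval (u * dir D k)).re := by
    have e : U.eval (u * dir D k)
        = (c * τ ^ D : ℝ) + (c * (u ^ D - (τ : ℂ) ^ D) + U.eraseLead.eval (u * dir D k)) := by
      have := congrArg (eval (u * dir D k)) (eraseLead_add_C_mul_X_pow U)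
      rw [eval_add, eval_mul, eval_C, eval_pow, eval_X, hlc, hU.natDegree_eq, mul_pow,
        dir_pow_self (by omega)] at this
      rw [← this]; push_cast; ring
    have h2 : ‖(c * (u ^ D - (τ : ℂ) ^ D) + U.eraseLead.eval (u * dir D k))‖
        ≤ (c * D + B1) * (2 + τ) ^ (D - 1) := by
      refine (norm_add_le _ _).trans ?_
      have h3 := norm_pow_sub_re_pow_le h0 h1 (D - 1)
      rw [Nat.sub_add_cancel (by omega)] at h3
      have h4 : ((D - 1 : ℕ) : ℝ) + 1 = D := by
        rw [Nat.cast_sub (by omega)]; simp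
      rw [h4] at h3
      rw [norm_mul, Complex.norm_real, Real.norm_eq_abs, abs_of_pos hc, add_mul, mul_assoc c]
      refine add_le_add (mul_le_mul_of_nonneg_left h3 hc.le) ((hW _).trans ?_)
      exact mul_le_mul_of_nonneg_left (pow_le_pow_left₀ (by positivity) (by linarith) _) hB1
    rw [e, Complex.add_re, Complex.ofReal_re]
    have := (abs_le.1 (Complex.abs_re_le_norm _)).1.trans' (neg_le_neg h2)
    linarith
  have hK' := hK τ h0
  calc ‖p.eval (u * dir D k)‖ * Real.exp (-(U.eval (u * dir D k)).re + B * (2 + τ) ^ (D - 1))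
      ≤ (B2 * (p.natDegree.factorial * Real.exp 2) * Real.exp τ) * Real.exp (K - 2 * τ) := by
        gcongr
        linarith
    _ = B2 * (p.natDegree.factorial * Real.exp 2) * Real.exp K * Real.exp (-τ) := by
        rw [mul_assoc _ (Real.exp τ), ← Real.exp_add, mul_assoc _ (Real.exp K), ← Real.exp_add]
        congr 2; ring

/-- The entire function `p e^{-U}`. -/
def weighted (U p : ℂ[X]) (z : ℂ) : ℂ := p.eval z * Complex.exp (-U.eval z)

/-- The polynomial `q' - U' q`, for which `(q e^{-U})' = (q' - U' q) e^{-U}`. -/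
def twist (U q : ℂ[X]) : ℂ[X] := derivative q - derivative U * q

theorem hasDerivAt_weighted (U q : ℂ[X]) (z : ℂ) :
    HasDerivAt (weighted U q) (weighted U (twist U q) z) z := by
  have h := (q.hasDerivAt z).mul ((U.hasDerivAt z).fun_neg.cexp)
  refine h.congr_deriv ?_
  simp only [weighted, twist, eval_sub, eval_mul]; ring

theorem differentiable_weighted (U q : ℂ[X]) : Differentiable ℂ (weighted U q) :=
  fun z => (hasDerivAt_weighted U q z).differentiableAt

theorem continuous_weighted (U q : ℂ[X]) : Continuous (weighted U q) :=
  (differentiable_weighted U q).continuous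

theorem deriv_weighted (U q : ℂ[X]) : deriv (weighted U q) = weighted U (twist U q) :=
  funext fun z => (hasDerivAt_weighted U q z).deriv

theorem weighted_mul (U p q : ℂ[X]) (z : ℂ) : weighted U (p * q) z = p.eval z * weighted U q z := by
  simp [weighted, mul_assoc]

/-- Exponential decay on the half-strip around the ray `C_k`. -/
def StripDecay (D k : ℕ) (f : ℂ → ℂ) : Prop :=
  ∃ C, 0 ≤ C ∧ ∀ u : ℂ, 0 ≤ u.re → |u.im| ≤ 1 → ‖f (u * dir D k)‖ ≤ C * Real.exp (-u.re)

theorem IsPotential.stripDecay {D : ℕ} {U : ℂ[X]} (hU : IsPotential D U) (hD : 2 ≤ D)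
    (k : ℕ) (p : ℂ[X]) : StripDecay D k (weighted U p) := by
  obtain ⟨K, hK0, hK⟩ := hU.exists_norm_mul_exp_le hD k p le_rfl
  refine ⟨K, hK0, fun u h0 h1 => ?_⟩
  have := hK u h0 h1
  rw [weighted, norm_mul, Complex.norm_exp]
  simpa using this

theorem StripDecay.norm_ray_le {D k : ℕ} {f : ℂ → ℂ} (hf : StripDecay D k f) :
    ∃ C, 0 ≤ C ∧ ∀ t : ℝ, 0 ≤ t → ‖f (t * dir D k)‖ ≤ C * Real.exp (-t) := by
  obtain ⟨C, hC0, hC⟩ := hf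
  exact ⟨C, hC0, fun t ht => by simpa using hC t (by simpa using ht) (by simp)⟩

theorem integrableOn_exp_neg : IntegrableOn (fun t : ℝ => Real.exp (-t)) (Set.Ioi 0) := by
  simpa using exp_neg_integrableOn_Ioi 0 one_pos

theorem StripDecay.integrableOn {D k : ℕ} {f : ℂ → ℂ} (hf : StripDecay D k f)
    (hc : Continuous f) : IntegrableOn (fun t : ℝ => f (t * dir D k)) (Set.Ioi 0) := by
  obtain ⟨C, hC0, hC⟩ := hf.norm_ray_le
  refine Integrable.mono' (integrableOn_exp_neg.const_mul C)
    (Continuous.aestronglyMeasurable (by fun_prop)) ?_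
  exact (ae_restrict_mem measurableSet_Ioi).mono fun t ht => hC t (Set.mem_Ioi.1 ht).le

theorem StripDecay.tendsto_zero {D k : ℕ} {f : ℂ → ℂ} (hf : StripDecay D k f) :
    Tendsto (fun t : ℝ => f (t * dir D k)) atTop (𝓝 0) := by
  obtain ⟨C, hC0, hC⟩ := hf.norm_ray_le
  refine squeeze_zero_norm' (a := fun t => C * Real.exp (-t)) ?_ ?_
  · filter_upwards [eventually_ge_atTop 0] with t ht using hC t ht
  · simpa using (Real.tendsto_exp_neg_atTop_nhds_zero).const_mul C

/-! ### Ray integrals as functionals on polynomials. -/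

/-- The integral over the ray `C_k`, traversed outwards. -/
def rayIntegral (D k : ℕ) (f : ℂ → ℂ) : ℂ :=
  ∫ t in Set.Ioi (0 : ℝ), f (t * dir D k) * dir D k

theorem rayIntegral_add {D k : ℕ} {f g : ℂ → ℂ} (hf : StripDecay D k f) (hg : StripDecay D k g)
    (hfc : Continuous f) (hgc : Continuous g) :
    rayIntegral D k (fun z => f z + g z) = rayIntegral D k f + rayIntegral D k g := by
  simp only [rayIntegral, add_mul]
  exact integral_add ((hf.integrableOn hfc).mul_const _) ((hg.integrableOn hgc).mul_const _)

theorem rayIntegral_const_mul {D k : ℕ} (c : ℂ) (f : ℂ → ℂ) :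
    rayIntegral D k (fun z => c * f z) = c * rayIntegral D k f := by
  simp only [rayIntegral, mul_assoc]
  exact integral_const_mul c _

/-- The integral of `p e^{-U}` over the ray `C_k`, as a linear functional of `p`. -/
def rayMoment {D : ℕ} {U : ℂ[X]} (hU : IsPotential D U) (hD : 2 ≤ D) (k : ℕ) : ℂ[X] →ₗ[ℂ] ℂ where
  toFun p := rayIntegral D k (weighted U p)
  map_add' p q := by
    rw [← rayIntegral_add (hU.stripDecay hD k p) (hU.stripDecay hD k q)
      (continuous_weighted U p) (continuous_weighted U q)]
    congr 1; ext z; simp [weighted, add_mul]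
  map_smul' c p := by
    rw [RingHom.id_apply, smul_eq_mul, ← rayIntegral_const_mul]
    congr 1; ext z; simp [weighted, mul_assoc]

theorem rayMoment_apply {D : ℕ} {U : ℂ[X]} (hU : IsPotential D U) (hD : 2 ≤ D) (k : ℕ) (p : ℂ[X]) :
    rayMoment hU hD k p = rayIntegral D k (weighted U p) := rfl

/-- The integrand is the derivative of `q e^{-U}`. What survives at the origin is the same for every
ray, so it disappears from arcs and from all combinations of total weight zero. -/
theorem rayMoment_twist {D : ℕ} {U : ℂ[X]} (hU : IsPotential D U) (hD : 2 ≤ D) (k : ℕ) (q : ℂ[X]) :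
    rayMoment hU hD k (twist U q) = -weighted U q 0 := by
  have h := integral_Ioi_of_hasDerivAt_of_tendsto' (a := (0 : ℝ)) (m := 0)
    (f := fun t : ℝ => weighted U q (t * dir D k))
    (f' := fun t : ℝ => weighted U (twist U q) (t * dir D k) * dir D k)
    (fun t _ => ?_) (((hU.stripDecay hD k _).integrableOn (continuous_weighted _ _)).mul_const _)
    (hU.stripDecay hD k q).tendsto_zero
  · rw [rayMoment_apply, rayIntegral, h]; simp
  · have h1 : HasDerivAt (fun t : ℝ => (t : ℂ) * dir D k) (dir D k) t := by
      simpa using (Complex.ofRealCLM.hasDerivAt (x := t)).mul_const (dir D k)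
    exact HasDerivAt.comp t (hasDerivAt_weighted U q (t * dir D k)) h1

/-! ### Non-degeneracy of the pairing between polynomials and arcs -/

theorem natDegree_derivative_eq_pred {U : ℂ[X]} {D : ℕ} (hU : U.natDegree = D) :
    (derivative U).natDegree = D - 1 := by
  rw [natDegree_derivative, hU]

/-- Division with remainder by `q ↦ q' - U' q`. -/
theorem exists_eq_add_twist {D : ℕ} {U : ℂ[X]} (hU : IsPotential D U) (hD : 2 ≤ D) (N : ℕ) :
    ∀ p : ℂ[X], p.degree < (N + (D - 1) : ℕ) →
      ∃ p₀ q : ℂ[X], p₀.degree < (D - 1 : ℕ) ∧ q.degree < N ∧ p = p₀ + twist U q := by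
  induction N with
  | zero => exact fun p hp => ⟨p, 0, by simpa using hp, by simp, by simp [twist]⟩
  | succ N ih =>
    intro p hp
    set M := N + (D - 1) with hM
    have hU0 : U.leadingCoeff ≠ 0 := by
      obtain ⟨c, hc, h⟩ := hU.leadingCoeff_pos
      rw [h]; exact_mod_cast hc.ne'
    have hDc : ((D : ℕ) : ℂ) ≠ 0 := by exact_mod_cast (by omega : D ≠ 0)
    have hcoef : (derivative U).coeff (D - 1) = U.leadingCoeff * D := by
      rw [coeff_derivative, leadingCoeff, hU.natDegree_eq, Nat.sub_add_cancel (by omega)]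
      congr 1
      rw [Nat.cast_sub (by omega)]; simp
    -- `twist U` raises the degree by `D - 1` and multiplies the leading coefficient by
    -- `-(U.leadingCoeff * D)`, so this `a` removes the coefficient of `p` at `M`.
    set a := -(p.coeff M) / (U.leadingCoeff * D) with ha
    have hlt : (p - twist U (C a * X ^ N)).degree < (M : ℕ) := by
      rw [degree_lt_iff_coeff_zero]
      intro m hm
      have hd1 : (derivative (C a * X ^ N : ℂ[X])).coeff m = 0 := by
        rw [coeff_derivative, coeff_C_mul, coeff_X_pow, if_neg (by omega)]; simp
      rw [coeff_sub, twist, coeff_sub, hd1]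
      rcases hm.eq_or_lt with rfl | hm
      · have : (derivative U * (C a * X ^ N)).coeff M = U.leadingCoeff * D * a := by
          rw [show derivative U * (C a * X ^ N) = C a * (derivative U * X ^ N) by ring, coeff_C_mul,
            hM, add_comm, coeff_mul_X_pow, hcoef]; ring
        rw [this, ha]; field_simp; ring
      · have h1 : p.coeff m = 0 := by
          refine coeff_eq_zero_of_degree_lt (hp.trans_le ?_)
          exact_mod_cast (by omega : N + 1 + (D - 1) ≤ m)
        have : (derivative U * (C a * X ^ N)).coeff m = 0 := by
          rw [show derivative U * (C a * X ^ N) = C a * (derivative U * X ^ N) by ring, coeff_C_mul,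
            coeff_mul_X_pow', if_pos (by omega), coeff_eq_zero_of_natDegree_lt, mul_zero]
          rw [natDegree_derivative_eq_pred hU.natDegree_eq]; omega
        rw [h1, this]; simp
    obtain ⟨p₀, q, h1, h2, h3⟩ := ih _ hlt
    refine ⟨p₀, q + C a * X ^ N, h1, ?_, ?_⟩
    · refine (degree_add_le _ _).trans_lt (max_lt (h2.trans ?_) ((degree_C_mul_X_pow_le _ _).trans_lt ?_)) <;>
      exact_mod_cast Nat.lt_succ_self N
    · rw [sub_eq_iff_eq_add] at h3
      rw [h3, twist, twist, twist, derivative_add]; ring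

/-- With `U = c X^D + W` one has `e^{-c z^D} = e^{-U} e^W`; expanding `e^W` turns an integral for
the monomial weight into a series of moments for `U`. Domination holds because `|W|` is of order `D
- 1` only. -/
theorem hasSum_rayMoment_eraseLead {D : ℕ} {U : ℂ[X]} (hU : IsPotential D U) (hD : 2 ≤ D)
    (k i : ℕ) :
    HasSum (fun m : ℕ => rayMoment hU hD k (C ((m.factorial : ℂ)⁻¹) * (X ^ i * U.eraseLead ^ m)))
      (rayIntegral D k (weighted (C U.leadingCoeff * X ^ D) (X ^ i))) := by
  obtain ⟨B, hB, hW⟩ := exists_norm_eval_le U.eraseLead (eraseLead_natDegree_le U)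
  rw [hU.natDegree_eq] at hW
  obtain ⟨K, hK0, hK⟩ := hU.exists_norm_mul_exp_le hD k (X ^ i) hB
  have hexp : ∀ z : ℂ, HasSum (fun m : ℕ => weighted U (X ^ i) z * (U.eraseLead.eval z ^ m / m.factorial))
      (weighted U (X ^ i) z * Complex.exp (U.eraseLead.eval z)) := fun z => by
    rw [Complex.exp_eq_exp_ℂ]
    exact (NormedSpace.expSeries_div_hasSum_exp (U.eraseLead.eval z)).mul_left _
  refine hasSum_integral_of_dominated_convergence
    (bound := fun m t => ‖weighted U (X ^ i) (t * dir D k)‖ *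
      (‖U.eraseLead.eval (t * dir D k)‖ ^ m / m.factorial)) (fun m => ?_) (fun m => ?_) ?_ ?_ ?_
  · exact (((continuous_weighted _ _).comp (by fun_prop)).mul continuous_const).aestronglyMeasurable
  · refine ae_of_all _ fun t => le_of_eq ?_
    rw [norm_mul, norm_dir, mul_one, weighted_mul, mul_comm (X ^ i), weighted_mul]
    simp; ring
  · exact ae_of_all _ fun t => (Real.summable_pow_div_factorial _).mul_left _
  · have h1 : ∀ t : ℝ, ∑' m : ℕ, ‖weighted U (X ^ i) (t * dir D k)‖ *
        (‖U.eraseLead.eval (t * dir D k)‖ ^ m / m.factorial)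
        = ‖weighted U (X ^ i) (t * dir D k)‖ * Real.exp ‖U.eraseLead.eval (t * dir D k)‖ := by
      intro t
      rw [tsum_mul_left, Real.exp_eq_exp_ℝ, NormedSpace.exp_eq_tsum_div]
    simp only [h1]
    refine Integrable.mono' (integrableOn_exp_neg.const_mul K) (Continuous.aestronglyMeasurable ?_) ?_
    · have := continuous_weighted U (X ^ i)
      have := U.eraseLead.continuous
      fun_prop
    · refine (ae_restrict_mem measurableSet_Ioi).mono fun t ht => ?_
      have ht' : (0 : ℝ) ≤ t := (Set.mem_Ioi.1 ht).le
      have h2 := hK t (by simpa using ht') (by simp)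
      have h3 := hW (t * dir D k)
      rw [norm_mul, norm_dir, mul_one, Complex.norm_real, Real.norm_eq_abs, abs_of_nonneg ht'] at h3
      rw [Real.norm_eq_abs, abs_of_nonneg (by positivity), weighted, norm_mul, Complex.norm_exp,
        mul_assoc, ← Real.exp_add]
      refine le_trans ?_ h2
      gcongr
      · simp
      · refine h3.trans ?_
        gcongr
        · norm_num
        · simp
  · refine ae_of_all _ fun t => ?_
    have h := (hexp (t * dir D k)).mul_right (dir D k)
    have e : weighted U (X ^ i) (t * dir D k) * Complex.exp (U.eraseLead.eval (t * dir D k))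
        = weighted (C U.leadingCoeff * X ^ D) (X ^ i) (t * dir D k) := by
      rw [weighted, weighted, mul_assoc, ← Complex.exp_add]
      have := congrArg (eval (t * dir D k)) (eraseLead_add_C_mul_X_pow U)
      rw [hU.natDegree_eq, eval_add] at this
      rw [← this]; congr 2; ring
    rw [e] at h
    refine h.congr_fun fun m => ?_
    rw [weighted_mul, mul_comm (X ^ i), weighted_mul]
    simp; ring

/-- For the monomial weight the rays differ only by a rotation, which leaves a power of a root of
unity. -/
theorem rayIntegral_monomial {D : ℕ} (hD : D ≠ 0) (c : ℝ) (k i : ℕ) :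
    rayIntegral D k (weighted (C (c : ℂ) * X ^ D) (X ^ i))
      = dir D k ^ i * dir D k * ((∫ t in Set.Ioi (0 : ℝ), t ^ i * Real.exp (-(c * t ^ D)) : ℝ) : ℂ) := by
  rw [rayIntegral, ← integral_complex_ofReal, ← integral_const_mul]
  congr 1; ext t
  simp only [weighted, eval_mul, eval_pow, eval_X, eval_C, mul_pow, dir_pow_self hD]
  push_cast; ring_nf

theorem integral_pow_mul_exp_pos {D : ℕ} (hD : 2 ≤ D) {c : ℝ} (hc : 0 < c) (i : ℕ) :
    0 < ∫ t in Set.Ioi (0 : ℝ), t ^ i * Real.exp (-(c * t ^ D)) := by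
  have hU : IsPotential D (C (c : ℂ) * X ^ D) :=
    ⟨natDegree_C_mul_X_pow _ _ (by exact_mod_cast hc.ne'), c, hc, by simp⟩
  have hInt := ((hU.stripDecay hD 0 (X ^ i)).integrableOn (continuous_weighted _ _)).re
  rw [setIntegral_pos_iff_support_of_nonneg_ae]
  · have : Function.support (fun t : ℝ => t ^ i * Real.exp (-(c * t ^ D))) ∩ Set.Ioi 0 = Set.Ioi 0 := by
      refine Set.inter_eq_right.2 fun t ht => ?_
      have : (0 : ℝ) < t := ht
      exact (by positivity : t ^ i * Real.exp (-(c * t ^ D)) ≠ 0)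
    rw [this]; simp
  · exact (ae_restrict_mem measurableSet_Ioi).mono fun t ht => by
      have : (0 : ℝ) < t := ht
      simp only [Pi.zero_apply]; positivity
  · refine hInt.congr (ae_of_all _ fun t => ?_)
    have : weighted (C (c : ℂ) * X ^ D) (X ^ i) (t * dir D 0)
        = ((t ^ i * Real.exp (-(c * t ^ D)) : ℝ) : ℂ) := by
      simp [weighted]
    simp only [this]
    exact Complex.ofReal_re _

/-- A combination of ray integrals with total weight zero that kills all polynomials of degree at
most `D - 2` is trivial. -/
theorem eq_zero_of_rayMoment_eq_zero {D : ℕ} {U : ℂ[X]} (hU : IsPotential D U) (hD : 2 ≤ D)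
    (c : Fin D → ℂ) (hc : ∑ k, c k = 0)
    (h : ∀ m < D - 1, ∑ k, c k * rayMoment hU hD k (X ^ m) = 0) : c = 0 := by
  -- Modulo the image of `twist U`, on which the combination vanishes because its total weight is
  -- zero, every polynomial has degree at most `D - 2`.
  have hall : ∀ p : ℂ[X], ∑ k, c k * rayMoment hU hD k p = 0 := by
    have hlow : ∀ p : ℂ[X], p.degree < (D - 1 : ℕ) → ∑ k, c k * rayMoment hU hD k p = 0 := by
      intro p hp
      have e : p = ∑ m ∈ Finset.range (D - 1), p.coeff m • X ^ m := by
        have h0 : p ∈ degreeLT ℂ (D - 1) := mem_degreeLT.2 hp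
        rcases eq_or_ne p 0 with rfl | hp0
        · simp
        · conv_lhs => rw [p.as_sum_range' (D - 1) ((natDegree_lt_iff_degree_lt hp0).2 hp)]
          simp [smul_X_eq_monomial]
      rw [e]
      simp only [map_sum, map_smul, smul_eq_mul, Finset.mul_sum]
      rw [Finset.sum_comm]
      refine Finset.sum_eq_zero fun m hm => ?_
      rw [← mul_zero (p.coeff m), ← h m (Finset.mem_range.1 hm), Finset.mul_sum]
      exact Finset.sum_congr rfl fun k _ => by ring
    intro p
    obtain ⟨p₀, q, h1, -, rfl⟩ := exists_eq_add_twist hU hD (p.natDegree + 1) p (by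
      refine degree_le_natDegree.trans_lt ?_
      exact_mod_cast (by omega : p.natDegree < p.natDegree + 1 + (D - 1)))
    simp only [map_add, mul_add, Finset.sum_add_distrib, hlow p₀ h1, rayMoment_twist,
      ← Finset.sum_mul, hc, zero_mul, add_zero]
  obtain ⟨a, ha, hlc⟩ := hU.leadingCoeff_pos
  -- All moments vanish, hence so do the integrals for the weight `e^{-a z^D}`. Dividing by the
  -- positive radial integrals leaves a Vandermonde system in the distinct directions.
  have hV : ∀ i : Fin D, ∑ k : Fin D, (c k * dir D k) * dir D k ^ (i : ℕ) = 0 := by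
    intro i
    have hs : HasSum (fun _ : ℕ => (0 : ℂ))
        (∑ k : Fin D, c k * rayIntegral D k (weighted (C U.leadingCoeff * X ^ D) (X ^ (i : ℕ)))) := by
      have := hasSum_sum (s := Finset.univ) fun k (_ : k ∈ (Finset.univ : Finset (Fin D))) =>
        (hasSum_rayMoment_eraseLead hU hD k i).mul_left (c k)
      simpa only [hall] using this
    have h0 := hs.unique hasSum_zero
    simp only [hlc, rayIntegral_monomial (by omega : D ≠ 0)] at h0
    have hI := integral_pow_mul_exp_pos hD ha i
    have h1 : (∑ k : Fin D, (c k * dir D k) * dir D k ^ (i : ℕ)) *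
        ((∫ t in Set.Ioi (0 : ℝ), t ^ (i : ℕ) * Real.exp (-(a * t ^ D)) : ℝ) : ℂ) = 0 := by
      rw [← h0, Finset.sum_mul]
      exact Finset.sum_congr rfl fun k _ => by ring
    exact (mul_eq_zero.1 h1).resolve_right (by exact_mod_cast hI.ne')
  have := Matrix.eq_zero_of_forall_pow_sum_mul_pow_eq_zero (f := fun k : Fin D => dir D k)
    (fun j k hjk => Fin.ext (dir_inj (by omega) j.2 k.2 hjk)) hV
  ext k
  have hk := congrFun this k
  simpa using hk

/-! ### The Cauchy transform on a half-line -/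

/-- The closed positive half-axis in the complex plane. -/
def halfAxis : Set ℂ := {u | 0 ≤ u.re ∧ u.im = 0}

/-- The Cauchy transform (without the factor `1 / 2πi`) on the positive half-axis. -/
def halfCauchy (f : ℂ → ℂ) (u : ℂ) : ℂ := ∫ t in Set.Ioi (0 : ℝ), f t / (t - u)

/-- Exponential decay on the half-strip around the positive half-axis. -/
def HalfDecay (f : ℂ → ℂ) : Prop :=
  ∃ C, 0 ≤ C ∧ ∀ u : ℂ, 0 ≤ u.re → |u.im| ≤ 1 → ‖f u‖ ≤ C * Real.exp (-u.re)

theorem isClosed_halfAxis : IsClosed halfAxis :=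
  (isClosed_le continuous_const Complex.continuous_re).inter
    (isClosed_eq Complex.continuous_im continuous_const)

theorem ofReal_mem_halfAxis {t : ℝ} (ht : 0 ≤ t) : (t : ℂ) ∈ halfAxis := ⟨by simpa, by simp⟩

theorem HalfDecay.integrableOn {f : ℂ → ℂ} (hf : HalfDecay f) (hc : Continuous f) :
    IntegrableOn (fun t : ℝ => f t) (Set.Ioi 0) := by
  obtain ⟨C, hC0, hC⟩ := hf
  refine Integrable.mono' (integrableOn_exp_neg.const_mul C)
    (Continuous.aestronglyMeasurable (by fun_prop)) ?_
  exact (ae_restrict_mem measurableSet_Ioi).mono fun t ht => by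
    simpa using hC t (by simpa using (Set.mem_Ioi.1 ht).le) (by simp)

theorem integrableOn_div_sub {f : ℂ → ℂ} (hc : Continuous f) {s : Set ℝ} (hs : MeasurableSet s)
    (hf : IntegrableOn (fun t : ℝ => f t) s) {u : ℂ} {δ : ℝ} (hδ : 0 < δ)
    (h : ∀ t ∈ s, δ ≤ ‖(t : ℂ) - u‖) : IntegrableOn (fun t : ℝ => f t / (t - u)) s := by
  have hm : Measurable fun t : ℝ => f t / (t - u) := by
    have := hc.measurable
    fun_prop
  refine Integrable.mono' (hf.norm.mul_const δ⁻¹) hm.aestronglyMeasurable ?_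
  refine (ae_restrict_mem hs).mono fun t ht => ?_
  rw [norm_div, div_eq_mul_inv]
  exact mul_le_mul_of_nonneg_left (inv_anti₀ hδ (h t ht)) (norm_nonneg _)

theorem exists_le_norm_sub_of_notMem {u : ℂ} (hu : u ∉ halfAxis) :
    ∃ δ > 0, ∀ v ∈ Metric.ball u δ, ∀ t : ℝ, 0 ≤ t → δ ≤ ‖(t : ℂ) - v‖ := by
  obtain ⟨ε, hε, h⟩ := Metric.isOpen_iff.1 isClosed_halfAxis.isOpen_compl u hu
  refine ⟨ε / 2, half_pos hε, fun v hv t ht => ?_⟩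
  by_contra hlt
  rw [not_le] at hlt
  refine h (a := (t : ℂ)) ?_ (ofReal_mem_halfAxis ht)
  rw [Metric.mem_ball, dist_eq_norm] at *
  calc ‖(t : ℂ) - u‖ = ‖((t : ℂ) - v) + (v - u)‖ := by ring_nf
    _ ≤ ‖(t : ℂ) - v‖ + ‖v - u‖ := norm_add_le _ _
    _ < ε := by linarith

theorem integrableOn_halfCauchy {f : ℂ → ℂ} (hf : HalfDecay f) (hc : Continuous f) {u : ℂ}
    (hu : u ∉ halfAxis) : IntegrableOn (fun t : ℝ => f t / (t - u)) (Set.Ioi 0) := by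
  obtain ⟨δ, hδ, h⟩ := exists_le_norm_sub_of_notMem hu
  exact integrableOn_div_sub hc measurableSet_Ioi (hf.integrableOn hc) hδ fun t ht =>
    h u (Metric.mem_ball_self hδ) t (Set.mem_Ioi.1 ht).le

theorem differentiableAt_halfCauchy {f : ℂ → ℂ} (hf : HalfDecay f) (hc : Continuous f) {u : ℂ}
    (hu : u ∉ halfAxis) : DifferentiableAt ℂ (halfCauchy f) u := by
  obtain ⟨δ, hδ, h⟩ := exists_le_norm_sub_of_notMem hu
  have hm := hc.measurable
  refine (hasDerivAt_integral_of_dominated_loc_of_deriv_le (Metric.ball_mem_nhds u hδ)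
    (μ := volume.restrict (Set.Ioi 0)) (F := fun v (t : ℝ) => f t / (t - v))
    (F' := fun v (t : ℝ) => f t / (t - v) ^ 2) (bound := fun t : ℝ => ‖f t‖ * (δ ^ 2)⁻¹)
    ?_ (integrableOn_halfCauchy hf hc hu) ?_ ?_ ((hf.integrableOn hc).norm.mul_const _)
    ?_).2.differentiableAt
  · exact Eventually.of_forall fun v => Measurable.aestronglyMeasurable (by fun_prop)
  · exact Measurable.aestronglyMeasurable (by fun_prop)
  · refine (ae_restrict_mem measurableSet_Ioi).mono fun t ht v hv => ?_
    rw [norm_div, norm_pow, div_eq_mul_inv]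
    have := h v hv t (Set.mem_Ioi.1 ht).le
    gcongr
  · refine (ae_restrict_mem measurableSet_Ioi).mono fun t ht v hv => ?_
    have h1 := h v hv t (Set.mem_Ioi.1 ht).le
    have hne : (t : ℂ) - v ≠ 0 := fun h0 => by rw [h0, norm_zero] at h1; linarith
    have h2 := (hasDerivAt_const v (f t)).div ((hasDerivAt_id' v).const_sub (t : ℂ)) hne
    refine h2.congr_deriv ?_
    ring

/-- A value `r ≤ 0` of `1 - t / u` would put `u = t / (1 - r)` on the half-axis. So the principal
logarithm is a primitive along the whole segment of integration. -/
theorem one_sub_div_mem_slitPlane {u : ℂ} (hu : u ∉ halfAxis) {t : ℝ} (ht : 0 ≤ t) :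
    1 - (t : ℂ) / u ∈ Complex.slitPlane := by
  have hu0 : u ≠ 0 := fun h => hu (h ▸ ofReal_mem_halfAxis (t := 0) le_rfl)
  rw [Complex.mem_slitPlane_iff]
  by_contra hcon
  push Not at hcon
  obtain ⟨h1, h2⟩ := hcon
  set r := (1 - (t : ℂ) / u).re with hr
  have e : 1 - (t : ℂ) / u = r := Complex.ext (by simp [hr]) (by simpa using h2)
  have e2 : u = ((t / (1 - r) : ℝ) : ℂ) := by
    have h3 : (1 - r : ℂ) ≠ 0 := by
      have : (1 - r : ℝ) ≠ 0 := by linarith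
      exact_mod_cast this
    have h4 : (t : ℂ) / u = 1 - r := by rw [← e]; ring
    push_cast
    rw [eq_div_iff h3, ← h4]
    field_simp
  exact hu (e2 ▸ ofReal_mem_halfAxis (div_nonneg ht (by linarith)))

theorem intervalIntegral_inv_sub {u : ℂ} (hu : u ∉ halfAxis) {R : ℝ} (hR : 0 ≤ R) :
    ∫ t in (0 : ℝ)..R, ((t : ℂ) - u)⁻¹ = Complex.log (1 - R / u) := by
  have hu0 : u ≠ 0 := fun h => hu (h ▸ ofReal_mem_halfAxis (t := 0) le_rfl)
  have hne : ∀ t ∈ Set.uIcc 0 R, (t : ℂ) - u ≠ 0 := fun t ht h => by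
    rw [Set.uIcc_of_le hR] at ht
    exact hu (sub_eq_zero.1 h ▸ ofReal_mem_halfAxis ht.1)
  have h := intervalIntegral.integral_eq_sub_of_hasDerivAt (a := 0) (b := R)
    (f := fun t : ℝ => Complex.log (1 - t / u)) (f' := fun t : ℝ => ((t : ℂ) - u)⁻¹) ?_ ?_
  · rw [h]; simp
  · intro t ht
    have ht' := ht
    rw [Set.uIcc_of_le hR] at ht'
    have h1 : HasDerivAt (fun t : ℝ => 1 - (t : ℂ) / u) (-(1 / u)) t :=
      ((Complex.ofRealCLM.hasDerivAt (x := t)).div_const u).const_sub 1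
    have hs := one_sub_div_mem_slitPlane hu ht'.1
    refine (h1.clog_real hs).congr_deriv ?_
    have h2 := hne t ht
    have h3 : (1 : ℂ) - t / u ≠ 0 := Complex.slitPlane_ne_zero hs
    have h4 : u - t ≠ 0 := fun h => h2 (by linear_combination -h)
    field_simp
    ring
  · refine ContinuousOn.intervalIntegrable ?_
    exact ContinuousOn.inv₀ (by fun_prop) hne

/-- The part of the Cauchy transform that is continuous on the ball of radius `R`. -/
def regularPart (R : ℝ) (f : ℂ → ℂ) (u : ℂ) : ℂ :=
  (∫ t in Set.Ioc (0 : ℝ) R, (f t - f u) / (t - u)) + ∫ t in Set.Ioi R, f t / (t - u)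

theorem norm_slope_le {f : ℂ → ℂ} (hf : Differentiable ℂ f) {S : Set ℂ} (hS : Convex ℝ S) {M : ℝ}
    (hM0 : 0 ≤ M) (hM : ∀ z ∈ S, ‖deriv f z‖ ≤ M) {a b : ℂ} (ha : a ∈ S) (hb : b ∈ S) :
    ‖(f a - f b) / (a - b)‖ ≤ M := by
  have h := hS.norm_image_sub_le_of_norm_deriv_le (fun x _ => hf x) hM hb ha
  rw [norm_div]
  exact div_le_of_le_mul₀ (norm_nonneg _) hM0 h

/-- The difference quotient is bounded by the maximum of `|f'|` on the ball, and the tail keeps a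
distance from `u`; dominated convergence applies to both, even when `u` lies on the half-axis. -/
theorem continuousAt_regularPart {f : ℂ → ℂ} (hf : HalfDecay f) (hd : Differentiable ℂ f) {R : ℝ}
    {u : ℂ} (hu : ‖u‖ < R) : ContinuousAt (regularPart R f) u := by
  have hR : 0 < R := (norm_nonneg u).trans_lt hu
  have hcd : Continuous (deriv f) :=
    (hd.contDiff (n := 1)).continuous_deriv le_rfl
  have hm := hd.continuous.measurable
  obtain ⟨M, hM⟩ := (isCompact_closedBall (0 : ℂ) R).exists_bound_of_continuousOn hcd.continuousOn
  have hM0 : 0 ≤ M := (norm_nonneg _).trans (hM 0 (Metric.mem_closedBall_self hR.le))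
  have hball : ∀ᶠ v in 𝓝 u, ‖v‖ < R := (isOpen_lt continuous_norm continuous_const).mem_nhds hu
  refine ContinuousAt.add ?_ ?_
  · refine continuousAt_of_dominated (bound := fun _ => M) ?_ ?_ ?_ ?_
    · exact Eventually.of_forall fun v => Measurable.aestronglyMeasurable (by fun_prop)
    · filter_upwards [hball] with v hv
      refine (ae_restrict_mem measurableSet_Ioc).mono fun t ht => ?_
      refine norm_slope_le hd (convex_closedBall 0 R) hM0 hM ?_ ?_
      · simp [abs_of_pos ht.1, ht.2]
      · simpa using hv.le
    · exact integrableOn_const (by simp)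
    · have h0 : ∀ᵐ t : ℝ ∂(volume.restrict (Set.Ioc 0 R)), t ≠ u.re :=
        ae_restrict_of_ae (by simp [ae_iff])
      filter_upwards [h0] with t ht
      have hne : (t : ℂ) - u ≠ 0 := fun h => ht (by
        have := congrArg Complex.re h
        simpa [sub_eq_zero] using this)
      have := hd.continuous.continuousAt (x := u)
      exact ContinuousAt.div (by fun_prop) (by fun_prop) hne
  · set δ := (R - ‖u‖) / 2 with hδ
    have hδ0 : 0 < δ := by rw [hδ]; linarith
    have hδu : ∀ v : ℂ, ‖v‖ < ‖u‖ + δ → ∀ t ∈ Set.Ioi R, δ ≤ ‖(t : ℂ) - v‖ := by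
      intro v hv t ht
      have h1 := norm_sub_norm_le (t : ℂ) v
      rw [Complex.norm_real, Real.norm_eq_abs] at h1
      have h2 := (le_abs_self t)
      have h3 : R < t := ht
      rw [hδ] at *
      linarith
    have hev : ∀ᶠ v in 𝓝 u, ‖v‖ < ‖u‖ + δ :=
      (isOpen_lt continuous_norm continuous_const).mem_nhds (by
        show ‖u‖ < ‖u‖ + δ; linarith)
    have hInt : IntegrableOn (fun t : ℝ => f t) (Set.Ioi R) :=
      (hf.integrableOn hd.continuous).mono_set (Set.Ioi_subset_Ioi hR.le)
    refine continuousAt_of_dominated (bound := fun t : ℝ => ‖f t‖ * δ⁻¹) ?_ ?_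
      (hInt.norm.mul_const _) ?_
    · exact Eventually.of_forall fun v => Measurable.aestronglyMeasurable (by fun_prop)
    · filter_upwards [hev] with v hv
      refine (ae_restrict_mem measurableSet_Ioi).mono fun t ht => ?_
      rw [norm_div, div_eq_mul_inv]
      exact mul_le_mul_of_nonneg_left (inv_anti₀ hδ0 (hδu v hv t ht)) (norm_nonneg _)
    · refine (ae_restrict_mem measurableSet_Ioi).mono fun t ht => ?_
      have h1 := hδu u (by linarith) t ht
      have hne : (t : ℂ) - u ≠ 0 := fun h0 => by rw [h0, norm_zero] at h1; linarith
      exact ContinuousAt.div (by fun_prop) (by fun_prop) hne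

/-- Subtracting `f u` near the pole puts the whole singular behaviour, jump and end point alike,
into an explicit logarithm. -/
theorem halfCauchy_eq_regularPart {f : ℂ → ℂ} (hf : HalfDecay f) (hd : Differentiable ℂ f) {R : ℝ}
    (hR : 0 ≤ R) {u : ℂ} (hu : u ∉ halfAxis) :
    halfCauchy f u = regularPart R f u + f u * Complex.log (1 - R / u) := by
  have hInt := integrableOn_halfCauchy hf hd.continuous hu
  obtain ⟨δ, hδ, hδu⟩ := exists_le_norm_sub_of_notMem hu
  have hδ' : ∀ t ∈ Set.Ioc 0 R, δ ≤ ‖(t : ℂ) - u‖ := fun t ht =>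
    hδu u (Metric.mem_ball_self hδ) t ht.1.le
  have h1 : IntegrableOn (fun t : ℝ => f t / (t - u)) (Set.Ioc 0 R) :=
    hInt.mono_set Set.Ioc_subset_Ioi_self
  have h2 : IntegrableOn (fun t : ℝ => f u / ((t : ℂ) - u)) (Set.Ioc 0 R) :=
    integrableOn_div_sub (f := fun _ => f u) continuous_const measurableSet_Ioc
      (integrableOn_const (by simp)) hδ hδ'
  rw [halfCauchy, regularPart, ← Set.Ioc_union_Ioi_eq_Ioi hR,
    setIntegral_union (Set.Ioc_disjoint_Ioi le_rfl) measurableSet_Ioi h1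
      (hInt.mono_set (Set.Ioi_subset_Ioi hR))]
  have h3 : ∫ t in Set.Ioc (0 : ℝ) R, f u / ((t : ℂ) - u) = f u * Complex.log (1 - R / u) := by
    simp only [div_eq_mul_inv (f u)]
    rw [integral_const_mul, ← intervalIntegral.integral_of_le hR, intervalIntegral_inv_sub hu hR]
  have h4 : ∫ t in Set.Ioc (0 : ℝ) R, (f t - f u) / (t - u)
      = (∫ t in Set.Ioc (0 : ℝ) R, f t / (t - u)) - ∫ t in Set.Ioc (0 : ℝ) R, f u / ((t : ℂ) - u) := by
    rw [← integral_sub h1 h2]; simp only [sub_div]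
  rw [h4, h3]; ring

theorem im_one_sub_div (R : ℝ) (u : ℂ) :
    (1 - (R : ℂ) / u).im = R * u.im / Complex.normSq u := by
  simp [Complex.div_im]

/-- For `R > x` the number `1 - R / x` lies on the cut of the logarithm, and `1 - R / u` has an
imaginary part of the sign of `u.im`. The one-sided limits of the logarithm therefore differ by
`2πi`. -/
theorem tendsto_halfCauchy {f : ℂ → ℂ} (hf : HalfDecay f) (hd : Differentiable ℂ f) {x : ℝ}
    (hx : 0 < x) : ∃ N : ℂ,
      Tendsto (halfCauchy f) (𝓝[{u | 0 < u.im}] (x : ℂ)) (𝓝 (N + f x * (Real.pi * Complex.I))) ∧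
      Tendsto (halfCauchy f) (𝓝[{u | u.im < 0}] (x : ℂ)) (𝓝 (N - f x * (Real.pi * Complex.I))) := by
  set R := x + 1 with hRdef
  have hR : 0 < R := by positivity
  have hx0 : (x : ℂ) ≠ 0 := by exact_mod_cast hx.ne'
  have hreg := continuousAt_regularPart hf hd (R := R) (u := x) (by
    rw [Complex.norm_real, Real.norm_eq_abs, abs_of_pos hx, hRdef]; linarith)
  have hcont : ContinuousAt (fun u : ℂ => 1 - (R : ℂ) / u) x :=
    continuousAt_const.sub (continuousAt_const.div continuousAt_id hx0)
  have hval : 1 - (R : ℂ) / x = ((1 - R / x : ℝ) : ℂ) := by push_cast; rfl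
  have hneg : 1 - R / x < 0 := by rw [sub_neg, one_lt_div hx]; linarith
  have hre : (1 - (R : ℂ) / x).re < 0 := by rw [hval, Complex.ofReal_re]; exact hneg
  have him : (1 - (R : ℂ) / x).im = 0 := by rw [hval, Complex.ofReal_im]
  have hfc := hd.continuous.continuousAt (x := (x : ℂ))
  refine ⟨regularPart R f x + f x * Real.log ‖1 - (R : ℂ) / x‖, ?_, ?_⟩
  · have hlog : Tendsto (fun u : ℂ => Complex.log (1 - R / u)) (𝓝[{u | 0 < u.im}] (x : ℂ))
        (𝓝 (Real.log ‖1 - (R : ℂ) / x‖ + Real.pi * Complex.I)) := by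
      refine (Complex.tendsto_log_nhdsWithin_im_nonneg_of_re_neg_of_im_zero hre him).comp ?_
      refine tendsto_nhdsWithin_iff.2 ⟨hcont.tendsto.mono_left nhdsWithin_le_nhds, ?_⟩
      filter_upwards [self_mem_nhdsWithin] with u hu
      have : 0 < u.im := hu
      change 0 ≤ (1 - (R : ℂ) / u).im
      rw [im_one_sub_div]
      exact div_nonneg (by positivity) (Complex.normSq_nonneg u)
    have := (hreg.tendsto.mono_left nhdsWithin_le_nhds).add
      ((hfc.tendsto.mono_left nhdsWithin_le_nhds).mul hlog)
    rw [mul_add, ← add_assoc] at this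
    refine this.congr' ?_
    filter_upwards [self_mem_nhdsWithin] with u hu
    exact (halfCauchy_eq_regularPart hf hd hR.le fun h => (ne_of_gt hu) h.2).symm
  · have hlog : Tendsto (fun u : ℂ => Complex.log (1 - R / u)) (𝓝[{u | u.im < 0}] (x : ℂ))
        (𝓝 (Real.log ‖1 - (R : ℂ) / x‖ - Real.pi * Complex.I)) := by
      refine (Complex.tendsto_log_nhdsWithin_im_neg_of_re_neg_of_im_zero hre him).comp ?_
      refine tendsto_nhdsWithin_iff.2 ⟨hcont.tendsto.mono_left nhdsWithin_le_nhds, ?_⟩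
      filter_upwards [self_mem_nhdsWithin] with u hu
      have hu' : u.im < 0 := hu
      have hu0 : u ≠ 0 := fun h => by rw [h] at hu'; simp at hu'
      change (1 - (R : ℂ) / u).im < 0
      rw [im_one_sub_div]
      exact div_neg_of_neg_of_pos (mul_neg_of_pos_of_neg hR hu') (Complex.normSq_pos.2 hu0)
    have := (hreg.tendsto.mono_left nhdsWithin_le_nhds).add
      ((hfc.tendsto.mono_left nhdsWithin_le_nhds).mul hlog)
    rw [mul_sub, ← add_sub_assoc] at this
    refine this.congr' ?_
    filter_upwards [self_mem_nhdsWithin] with u hu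
    exact (halfCauchy_eq_regularPart hf hd hR.le fun h => (ne_of_lt hu) h.2).symm

/-- After the term `log ‖u‖` cancels, what remains is `log ‖u - 1‖`, with `‖u - 1‖` between `1/2`
and `2`, and an argument. -/
theorem norm_log_one_sub_inv_add_log_norm_le {u : ℂ} (hu0 : u ≠ 0) (hu : ‖u‖ < 1 / 2) :
    ‖Complex.log (1 - (1 : ℝ) / u) + Real.log ‖u‖‖ ≤ Real.log 2 + Real.pi := by
  have hnu : 0 < ‖u‖ := norm_pos_iff.2 hu0
  have h1 : ‖u - 1‖ ≤ 2 := by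
    have := norm_sub_le u 1
    rw [norm_one] at this; linarith
  have h2 : 1 / 2 ≤ ‖u - 1‖ := by
    have := norm_sub_norm_le 1 u
    rw [norm_one, norm_sub_rev] at this; linarith
  have hn : ‖1 - ((1 : ℝ) : ℂ) / u‖ = ‖u - 1‖ / ‖u‖ := by
    rw [← norm_div]; congr 1; field_simp; simp
  have e : Complex.log (1 - (1 : ℝ) / u) + Real.log ‖u‖
      = (Real.log ‖u - 1‖ : ℝ) + (Complex.arg (1 - (1 : ℝ) / u) : ℝ) * Complex.I := by
    rw [Complex.log, hn, Real.log_div (by linarith) hnu.ne']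
    push_cast; ring
  rw [e]
  refine (norm_add_le _ _).trans (add_le_add ?_ ?_)
  · rw [Complex.norm_real, Real.norm_eq_abs, abs_le]
    constructor
    · rw [← Real.log_inv]
      exact Real.log_le_log (by norm_num) (by linarith)
    · exact Real.log_le_log (by linarith) h1
  · rw [norm_mul, Complex.norm_I, mul_one, Complex.norm_real, Real.norm_eq_abs]
    exact Complex.abs_arg_le_pi _

/-- The logarithmic singularity of the Cauchy transform at the end point. -/
theorem exists_norm_halfCauchy_add_log_le {f : ℂ → ℂ} (hf : HalfDecay f)
    (hd : Differentiable ℂ f) : ∃ r > 0, ∃ C, ∀ u ∉ halfAxis, ‖u‖ < r →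
      ‖halfCauchy f u + f u * Real.log ‖u‖‖ ≤ C := by
  have hreg := continuousAt_regularPart hf hd (R := 1) (u := 0) (by simp)
  have hfc := hd.continuous.continuousAt (x := (0 : ℂ))
  have h1 : ∀ᶠ u in 𝓝 (0 : ℂ), ‖regularPart 1 f u‖ < ‖regularPart 1 f 0‖ + 1 :=
    hreg.norm.eventually (gt_mem_nhds (by linarith))
  have h2 : ∀ᶠ u in 𝓝 (0 : ℂ), ‖f u‖ < ‖f 0‖ + 1 :=
    hfc.norm.eventually (gt_mem_nhds (by linarith))
  obtain ⟨r, hr, h⟩ := Metric.eventually_nhds_iff.1 (h1.and h2)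
  refine ⟨min r (1 / 2), by positivity, (‖regularPart 1 f 0‖ + 1) +
    (‖f 0‖ + 1) * (Real.log 2 + Real.pi), fun u hu hur => ?_⟩
  have hu0 : u ≠ 0 := fun h => hu (h ▸ ofReal_mem_halfAxis (t := 0) le_rfl)
  obtain ⟨h3, h4⟩ := h (y := u) (by simpa using hur.trans_le (min_le_left _ _))
  rw [halfCauchy_eq_regularPart hf hd zero_le_one hu, add_assoc, ← mul_add]
  refine (norm_add_le _ _).trans (add_le_add h3.le ?_)
  rw [norm_mul]
  exact mul_le_mul h4.le
    (norm_log_one_sub_inv_add_log_norm_le hu0 (hur.trans_le (min_le_right _ _)))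
    (norm_nonneg _) (by positivity)

theorem norm_log_sub_log_le {a b : ℂ} (h : ‖a‖ = ‖b‖) :
    ‖Complex.log a - Complex.log b‖ ≤ 2 * Real.pi := by
  have : Complex.log a - Complex.log b = ((a.arg - b.arg : ℝ) : ℂ) * Complex.I := by
    rw [Complex.log, Complex.log, h]; push_cast; ring
  rw [this, norm_mul, Complex.norm_I, mul_one, Complex.norm_real, Real.norm_eq_abs, two_mul]
  exact (abs_sub _ _).trans (add_le_add (Complex.abs_arg_le_pi _) (Complex.abs_arg_le_pi _))

theorem norm_setIntegral_div_sub_le {f : ℂ → ℂ} (hc : Continuous f) {s : Set ℝ}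
    (hs : MeasurableSet s) (hsub : s ⊆ Set.Ioi 0)
    (hf : IntegrableOn (fun t : ℝ => f t) (Set.Ioi 0)) {u : ℂ}
    (h : ∀ t ∈ s, 1 ≤ ‖(t : ℂ) - u‖) :
    ‖∫ t in s, f t / (t - u)‖ ≤ ∫ t in Set.Ioi (0 : ℝ), ‖f t‖ := by
  have h1 := integrableOn_div_sub hc hs (hf.mono_set hsub) one_pos h
  calc ‖∫ t in s, f t / (t - u)‖ ≤ ∫ t in s, ‖f t / (t - u)‖ := norm_integral_le_integral_norm _
    _ ≤ ∫ t in s, ‖f t‖ := by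
        refine setIntegral_mono_on h1.norm (hf.mono_set hsub).norm hs fun t ht => ?_
        rw [norm_div]
        exact div_le_self (norm_nonneg _) (h t ht)
    _ ≤ ∫ t in Set.Ioi (0 : ℝ), ‖f t‖ :=
        setIntegral_mono_set hf.norm (ae_of_all _ fun _ => norm_nonneg _)
          (LE.le.eventuallyLE hsub)

/-- The Cauchy transform is bounded at infinity, uniformly up to the half-axis. -/
theorem exists_norm_halfCauchy_le {f : ℂ → ℂ} (hf : HalfDecay f) (hd : Differentiable ℂ f)
    (hf' : HalfDecay (deriv f)) : ∃ C, ∀ u ∉ halfAxis, 3 ≤ ‖u‖ → ‖halfCauchy f u‖ ≤ C := by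
  have hInt := hf.integrableOn hd.continuous
  obtain ⟨C₀, hC₀, hC⟩ := hf
  obtain ⟨C₁, hC₁, hC'⟩ := hf'
  have hf : HalfDecay f := ⟨C₀, hC₀, hC⟩
  set I₀ := ∫ t in Set.Ioi (0 : ℝ), ‖f t‖ with hI
  have hI0 : 0 ≤ I₀ := integral_nonneg fun _ => norm_nonneg _
  refine ⟨I₀ + (C₁ * 2 + C₀ * (2 * Real.pi)), fun u hu hu3 => ?_⟩
  have hrest : 0 ≤ C₁ * 2 + C₀ * (2 * Real.pi) := by positivity
  -- Away from the axis the `L¹` norm of `f` is a bound. Close to it, a window of length 2 around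
  -- `u.re` is treated separately.
  by_cases hfar : ∀ t ∈ Set.Ioi (0 : ℝ), 1 ≤ ‖(t : ℂ) - u‖
  · have := norm_setIntegral_div_sub_le hd.continuous measurableSet_Ioi subset_rfl hInt hfar
    rw [halfCauchy]; linarith
  · push Not at hfar
    obtain ⟨t₀, ht₀, hlt⟩ := hfar
    have ht₀' : 0 < t₀ := ht₀
    have him : |u.im| < 1 := by
      have := (Complex.abs_im_le_norm ((t₀ : ℂ) - u)).trans_lt hlt
      simpa using this
    have hre : |t₀ - u.re| < 1 := by
      have := (Complex.abs_re_le_norm ((t₀ : ℂ) - u)).trans_lt hlt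
      simpa using this
    -- This is where `3 ≤ ‖u‖` is needed: it keeps the window inside the positive axis, away from
    -- the end point.
    have hτ : 2 ≤ u.re := by
      have h1 := Complex.norm_le_abs_re_add_abs_im u
      have h2 : 2 ≤ |u.re| := by linarith
      rcases le_abs.1 h2 with h | h
      · exact h
      · have := (abs_lt.1 hre).2; linarith
    set τ := u.re with hτd
    have hη : u.im ≠ 0 := fun h => hu ⟨by linarith, h⟩
    have hsplit : Set.Ioi (0 : ℝ) = (Set.Ioi 0 \ Set.Ioc (τ - 1) (τ + 1)) ∪ Set.Ioc (τ - 1) (τ + 1) := by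
      rw [Set.sdiff_union_of_subset]
      exact fun t ht => Set.mem_Ioi.2 (by linarith [ht.1])
    have hIntC := integrableOn_halfCauchy hf hd.continuous hu
    have hsub : Set.Ioc (τ - 1) (τ + 1) ⊆ Set.Ioi 0 := fun t ht => Set.mem_Ioi.2 (by linarith [ht.1])
    have hI1 : ‖∫ t in Set.Ioi 0 \ Set.Ioc (τ - 1) (τ + 1), f (t : ℝ) / (t - u)‖ ≤ I₀ := by
      refine norm_setIntegral_div_sub_le hd.continuous (measurableSet_Ioi.diff measurableSet_Ioc)
        Set.sdiff_subset hInt fun t ht => ?_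
      refine le_trans ?_ (Complex.abs_re_le_norm _)
      have h2 := ht.2
      simp only [Set.mem_Ioc, not_and_or, not_lt, not_le] at h2
      simp only [Complex.sub_re, Complex.ofReal_re]
      rw [le_abs]
      rcases h2 with h | h
      · right; linarith
      · left; linarith
    have hnorm : ∀ t : ℝ, |u.im| ≤ ‖(t : ℂ) - u‖ := fun t => by
      simpa using Complex.abs_im_le_norm ((t : ℂ) - u)
    have hi2 : IntegrableOn (fun t : ℝ => f u / ((t : ℂ) - u)) (Set.Ioc (τ - 1) (τ + 1)) :=
      integrableOn_div_sub (f := fun _ => f u) continuous_const measurableSet_Ioc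
        (integrableOn_const (by simp)) (abs_pos.2 hη) fun t _ => hnorm t
    have hi1 := hIntC.mono_set hsub
    have hconv : Convex ℝ {v : ℂ | 0 ≤ v.re ∧ |v.im| ≤ 1} := by
      have e : {v : ℂ | 0 ≤ v.re ∧ |v.im| ≤ 1}
          = Complex.reLm ⁻¹' Set.Ici 0 ∩ Complex.imLm ⁻¹' Set.Icc (-1) 1 := by
        ext v; simp [abs_le]
      rw [e]
      exact ((convex_Ici 0).linear_preimage _).inter ((convex_Icc _ _).linear_preimage _)
    have hle1 : ∀ v : ℂ, 0 ≤ v.re → Real.exp (-v.re) ≤ 1 := fun v hv => by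
      rw [Real.exp_le_one_iff]; linarith
    -- The mean value inequality in the convex half-strip bounds the quotient by `C₁`, and the
    -- window has length 2.
    have hslope : ‖∫ t in Set.Ioc (τ - 1) (τ + 1), (f (t : ℝ) - f u) / (t - u)‖ ≤ C₁ * 2 := by
      have := norm_setIntegral_le_of_norm_le_const (μ := volume) (s := Set.Ioc (τ - 1) (τ + 1))
        (f := fun t : ℝ => (f (t : ℝ) - f u) / (t - u)) (C := C₁) (by simp) (fun t ht => ?_)
      · refine this.trans (le_of_eq ?_)
        rw [Real.volume_real_Ioc_of_le (by linarith)]; ring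
      · refine norm_slope_le hd hconv hC₁ (fun v hv => (hC' v hv.1 hv.2).trans ?_)
          ⟨by simpa using (hsub ht).le, by simp⟩ ⟨by linarith, him.le⟩
        exact mul_le_of_le_one_right hC₁ (hle1 v hv.1)
    have hlogint : ∫ t in Set.Ioc (τ - 1) (τ + 1), f u / ((t : ℂ) - u)
        = f u * (Complex.log ((τ + 1 : ℝ) - u) - Complex.log ((τ - 1 : ℝ) - u)) := by
      simp only [div_eq_mul_inv (f u)]
      rw [integral_const_mul, ← intervalIntegral.integral_of_le (by linarith)]
      congr 1
      have hne : ∀ t : ℝ, (t : ℂ) - u ≠ 0 := fun t h => hη (by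
        have := congrArg Complex.im h
        simpa using this)
      refine intervalIntegral.integral_eq_sub_of_hasDerivAt
        (f := fun t : ℝ => Complex.log ((t : ℂ) - u)) (fun t _ => ?_) ?_
      · have h1 : HasDerivAt (fun t : ℝ => (t : ℂ) - u) 1 t :=
          (Complex.ofRealCLM.hasDerivAt (x := t)).sub_const u
        refine (h1.clog_real ?_).congr_deriv (by simp)
        rw [Complex.mem_slitPlane_iff]
        right; simpa using hη
      · exact (Continuous.inv₀ (by fun_prop) hne).intervalIntegrable _ _
    -- The window is centred at `u.re`, so its ends are equidistant from `u` and only arguments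
    -- differ, however close `u` is to the axis.
    have hlogbd : ‖f u * (Complex.log ((τ + 1 : ℝ) - u) - Complex.log ((τ - 1 : ℝ) - u))‖
        ≤ C₀ * (2 * Real.pi) := by
      rw [norm_mul]
      refine mul_le_mul ?_ (norm_log_sub_log_le ?_) (norm_nonneg _) hC₀
      · exact (hC u (by linarith) him.le).trans (mul_le_of_le_one_right hC₀ (hle1 u (by linarith)))
      · rw [← sq_eq_sq₀ (norm_nonneg _) (norm_nonneg _), Complex.sq_norm, Complex.sq_norm,
          Complex.normSq_apply, Complex.normSq_apply]
        simp [← hτd]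
    have hmid : ∫ t in Set.Ioc (τ - 1) (τ + 1), f (t : ℝ) / (t - u)
        = (∫ t in Set.Ioc (τ - 1) (τ + 1), (f (t : ℝ) - f u) / (t - u))
          + ∫ t in Set.Ioc (τ - 1) (τ + 1), f u / ((t : ℂ) - u) := by
      have : IntegrableOn (fun t : ℝ => (f (t : ℝ) - f u) / (t - u)) (Set.Ioc (τ - 1) (τ + 1)) :=
        (hi1.sub hi2).congr (ae_of_all _ fun t => by simp [sub_div])
      rw [← integral_add this hi2]
      congr 1; ext t; ring
    have hsum : halfCauchy f u = (∫ t in Set.Ioi 0 \ Set.Ioc (τ - 1) (τ + 1), f (t : ℝ) / (t - u))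
        + ∫ t in Set.Ioc (τ - 1) (τ + 1), f (t : ℝ) / (t - u) := by
      rw [halfCauchy]
      conv_lhs => rw [hsplit]
      exact setIntegral_union Set.disjoint_sdiff_left measurableSet_Ioc
        (hIntC.mono_set Set.sdiff_subset) hi1
    rw [hsum, hmid, hlogint]
    exact (norm_add_le _ _).trans (add_le_add hI1 ((norm_add_le _ _).trans (add_le_add hslope hlogbd)))

/-! ### Cauchy transforms on rays and arcs -/

/-- The Cauchy transform (without the factor `1 / 2πi`) on the ray `C_k`, traversed outwards. -/
def rayCauchy (D k : ℕ) (f : ℂ → ℂ) (z : ℂ) : ℂ :=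
  -- With `s = t * dir D k` one has `ds / (s - z) = dt / (t - z / dir D k)`, so no factor `dir D k`
  -- is left.
  halfCauchy (fun u => f (u * dir D k)) (z / dir D k)

theorem div_dir_mem_halfAxis_iff {D k : ℕ} {z : ℂ} : z / dir D k ∈ halfAxis ↔ z ∈ ray D k :=
  mem_ray_iff.symm

theorem norm_div_dir (D k : ℕ) (z : ℂ) : ‖z / dir D k‖ = ‖z‖ := by simp

theorem differentiableAt_rayCauchy {D k : ℕ} {f : ℂ → ℂ} (hf : StripDecay D k f)
    (hd : Differentiable ℂ f) {z : ℂ} (hz : z ∉ ray D k) :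
    DifferentiableAt ℂ (rayCauchy D k f) z := by
  have hc := hd.continuous
  have h := differentiableAt_halfCauchy (f := fun u => f (u * dir D k)) hf (by fun_prop)
    (u := z / dir D k) (fun h => hz (div_dir_mem_halfAxis_iff.1 h))
  exact DifferentiableAt.comp (g := halfCauchy fun u => f (u * dir D k))
    (f := fun z => z / dir D k) z h (by fun_prop)

/-- The integral runs outwards on every ray, while left and right refer to the contour, whose rays
other than `C_0` come in; hence the sign. -/
theorem tendsto_rayCauchy {D k : ℕ} {f : ℂ → ℂ} (hf : StripDecay D k f)
    (hd : Differentiable ℂ f) {x : ℂ} (hx : x ∈ ray D k) (hx0 : x ≠ 0) : ∃ N : ℂ,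
      Tendsto (rayCauchy D k f) (𝓝[leftSide D k \ contour D] x)
        (𝓝 (N + (if k = 0 then 1 else -1) * (f x * (Real.pi * Complex.I)))) ∧
      Tendsto (rayCauchy D k f) (𝓝[rightSide D k \ contour D] x)
        (𝓝 (N - (if k = 0 then 1 else -1) * (f x * (Real.pi * Complex.I)))) := by
  obtain ⟨t, ht, rfl⟩ := hx
  have ht0 : 0 < t := lt_of_le_of_ne ht fun h => hx0 (by simp [← h])
  have hfd : Differentiable ℂ fun u => f (u * dir D k) := hd.comp (by fun_prop)
  obtain ⟨N, h1, h2⟩ := tendsto_halfCauchy (f := fun u => f (u * dir D k)) hf hfd ht0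
  have hlim : Tendsto (fun z : ℂ => z / dir D k) (𝓝 (t * dir D k)) (𝓝 (t : ℂ)) := by
    have : Tendsto (fun z : ℂ => z / dir D k) (𝓝 (t * dir D k)) (𝓝 (t * dir D k / dir D k)) :=
      Continuous.tendsto (by fun_prop) _
    rwa [mul_div_cancel_right₀ _ (dir_ne_zero D k)] at this
  have hup : ∀ S : Set ℂ, (∀ z ∈ S, 0 < (z / dir D k).im) →
      Tendsto (rayCauchy D k f) (𝓝[S] (t * dir D k))
        (𝓝 (N + f (t * dir D k) * (Real.pi * Complex.I))) := fun S hS =>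
    h1.comp (tendsto_nhdsWithin_iff.2 ⟨hlim.mono_left nhdsWithin_le_nhds,
      eventually_nhdsWithin_of_forall hS⟩)
  have hdn : ∀ S : Set ℂ, (∀ z ∈ S, (z / dir D k).im < 0) →
      Tendsto (rayCauchy D k f) (𝓝[S] (t * dir D k))
        (𝓝 (N - f (t * dir D k) * (Real.pi * Complex.I))) := fun S hS =>
    h2.comp (tendsto_nhdsWithin_iff.2 ⟨hlim.mono_left nhdsWithin_le_nhds,
      eventually_nhdsWithin_of_forall hS⟩)
  refine ⟨N, ?_⟩
  by_cases hk : k = 0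
  · rw [if_pos hk, one_mul]
    refine ⟨hup _ fun z hz => ?_, hdn _ fun z hz => ?_⟩
    · have : 0 < (z / tangent D k).im := hz.1
      rwa [im_div_tangent, if_pos hk, one_mul] at this
    · have : (z / tangent D k).im < 0 := hz.1
      rwa [im_div_tangent, if_pos hk, one_mul] at this
  · rw [if_neg hk, neg_one_mul, ← sub_eq_add_neg, sub_neg_eq_add]
    refine ⟨hdn _ fun z hz => ?_, hup _ fun z hz => ?_⟩
    · have : 0 < (z / tangent D k).im := hz.1
      rw [im_div_tangent, if_neg hk] at this
      linarith
    · have : (z / tangent D k).im < 0 := hz.1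
      rw [im_div_tangent, if_neg hk] at this
      linarith

theorem exists_norm_rayCauchy_add_log_le {D k : ℕ} {f : ℂ → ℂ} (hf : StripDecay D k f)
    (hd : Differentiable ℂ f) : ∃ r > 0, ∃ C, ∀ z ∉ ray D k, ‖z‖ < r →
      ‖rayCauchy D k f z + f z * Real.log ‖z‖‖ ≤ C := by
  obtain ⟨r, hr, C, hC⟩ := exists_norm_halfCauchy_add_log_le (f := fun u => f (u * dir D k)) hf
    (hd.comp (by fun_prop))
  refine ⟨r, hr, C, fun z hz hzr => ?_⟩
  have := hC (z / dir D k) (fun h => hz (div_dir_mem_halfAxis_iff.1 h)) (by rwa [norm_div_dir])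
  rwa [norm_div_dir, div_mul_cancel₀ _ (dir_ne_zero D k)] at this

/-- The Cauchy transform on the arc `Γ_j`, with its orientation. -/
def arcCauchy (D j : ℕ) (f : ℂ → ℂ) (z : ℂ) : ℂ :=
  (2 * Real.pi * Complex.I)⁻¹ * (rayCauchy D 0 f z - rayCauchy D j f z)

theorem notMem_ray_of_notMem_contour {D k : ℕ} (hD : 2 ≤ D) (hk : k < D) {z : ℂ}
    (hz : z ∉ contour D) : z ∉ ray D k := fun h => hz ((mem_contour_iff hD).2 ⟨k, hk, h⟩)

theorem ne_zero_of_notMem_contour {D : ℕ} (hD : 2 ≤ D) {z : ℂ} (hz : z ∉ contour D) : z ≠ 0 :=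
  fun h => notMem_ray_of_notMem_contour hD (k := 0) (by omega) hz (h ▸ zero_mem_ray D 0)

/-! ### Jumps, expansions at infinity and moments on the arcs. -/

section arc

variable {D : ℕ} {U : ℂ[X]} (hU : IsPotential D U) (hD : 2 ≤ D) {j : ℕ}

theorem differentiableOn_arcCauchy (hU : IsPotential D U) (hD : 2 ≤ D) (hj : j < D) (p : ℂ[X]) :
    DifferentiableOn ℂ (arcCauchy D j (weighted U p)) (contour D)ᶜ := fun z hz => by
  have h0 := differentiableAt_rayCauchy (hU.stripDecay hD 0 p) (differentiable_weighted U p)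
    (notMem_ray_of_notMem_contour hD (by omega) hz)
  have h1 := differentiableAt_rayCauchy (hU.stripDecay hD j p) (differentiable_weighted U p)
    (notMem_ray_of_notMem_contour hD hj hz)
  exact ((h0.sub h1).const_mul _).differentiableWithinAt

/-- The Plemelj formula. On `C_j` the minus sign of the transform and the reversed orientation
compensate, so the jump is the density itself on both rays of the arc; across all other rays the
transform is continuous. -/
theorem tendsto_arcCauchy (hU : IsPotential D U) (hD : 2 ≤ D) (hj0 : 1 ≤ j) (hj : j < D) (p : ℂ[X])
    {k : ℕ} (hk : k < D) {x : ℂ} (hx : x ∈ ray D k) (hx0 : x ≠ 0) : ∃ b : ℂ,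
      Tendsto (arcCauchy D j (weighted U p)) (𝓝[leftSide D k \ contour D] x)
        (𝓝 (b + Set.indicator (arc D j) (weighted U p) x)) ∧
      Tendsto (arcCauchy D j (weighted U p)) (𝓝[rightSide D k \ contour D] x) (𝓝 b) := by
  have hd := differentiable_weighted U p
  have hoff : ∀ l < D, l ≠ k → x ∉ ray D l := fun l hl hlk h =>
    hlk (eq_of_mem_ray (by omega) hl hk hx0 h hx)
  have hcont : ∀ l < D, l ≠ k → ∀ S : Set ℂ,
      Tendsto (rayCauchy D l (weighted U p)) (𝓝[S] x) (𝓝 (rayCauchy D l (weighted U p) x)) :=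
    fun l hl hlk S => ((differentiableAt_rayCauchy (hU.stripDecay hD l p) hd
      (hoff l hl hlk)).continuousAt.tendsto).mono_left nhdsWithin_le_nhds
  have hpi : (Real.pi : ℂ) ≠ 0 := by exact_mod_cast Real.pi_ne_zero
  obtain ⟨N, h1, h2⟩ := tendsto_rayCauchy (hU.stripDecay hD k p) hd hx hx0
  by_cases hk0 : k = 0
  · subst hk0
    have hmem : x ∈ arc D j := Or.inl hx
    rw [Set.indicator_of_mem hmem]
    refine ⟨_, ?_, (h2.sub (hcont j hj (by omega) _)).const_mul _⟩
    convert (h1.sub (hcont j hj (by omega) _)).const_mul (2 * Real.pi * Complex.I : ℂ)⁻¹ using 2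
    · rfl
    · simp only [if_true, one_mul]
      field_simp
      ring
  · by_cases hkj : k = j
    · subst hkj
      have hmem : x ∈ arc D k := Or.inr hx
      rw [Set.indicator_of_mem hmem]
      refine ⟨_, ?_, ((hcont 0 (by omega) (by omega) _).sub h2).const_mul _⟩
      convert ((hcont 0 (by omega) (by omega) _).sub h1).const_mul
        (2 * Real.pi * Complex.I : ℂ)⁻¹ using 2
      · rfl
      · simp only [if_neg hk0]
        field_simp
        ring
    · have hmem : x ∉ arc D j := by
        rintro (h | h)
        exacts [hoff 0 (by omega) (by omega) h, hoff j hj (by omega) h]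
      rw [Set.indicator_of_notMem hmem, ]
      refine ⟨_, ?_, ((hcont 0 (by omega) (by omega) _).sub (hcont j hj (by omega) _)).const_mul _⟩
      rw [add_zero]
      exact ((hcont 0 (by omega) (by omega) _).sub (hcont j hj (by omega) _)).const_mul _

/-- Both rays contribute the same singular term, the density times `log ‖z‖`, and it cancels because
one ray leaves the origin and the other arrives there. -/
theorem exists_norm_arcCauchy_le_near_zero (hU : IsPotential D U) (hD : 2 ≤ D) (hj : j < D)
    (p : ℂ[X]) : ∃ r > (0 : ℝ), ∃ C : ℝ,
      ∀ z, z ∉ contour D → ‖z‖ < r → ‖arcCauchy D j (weighted U p) z‖ ≤ C := by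
  have hd := differentiable_weighted U p
  obtain ⟨r₀, hr₀, C₀, h₀⟩ := exists_norm_rayCauchy_add_log_le (hU.stripDecay hD 0 p) hd
  obtain ⟨r₁, hr₁, C₁, h₁⟩ := exists_norm_rayCauchy_add_log_le (hU.stripDecay hD j p) hd
  refine ⟨min r₀ r₁, lt_min hr₀ hr₁, ‖(2 * Real.pi * Complex.I : ℂ)⁻¹‖ * (C₀ + C₁),
    fun z hz hzr => ?_⟩
  have a0 := h₀ z (notMem_ray_of_notMem_contour hD (by omega) hz) (hzr.trans_le (min_le_left _ _))
  have a1 := h₁ z (notMem_ray_of_notMem_contour hD hj hz) (hzr.trans_le (min_le_right _ _))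
  rw [arcCauchy, norm_mul]
  refine mul_le_mul_of_nonneg_left ?_ (norm_nonneg _)
  calc ‖rayCauchy D 0 (weighted U p) z - rayCauchy D j (weighted U p) z‖
      = ‖(rayCauchy D 0 (weighted U p) z + weighted U p z * Real.log ‖z‖)
          - (rayCauchy D j (weighted U p) z + weighted U p z * Real.log ‖z‖)‖ := by ring_nf
    _ ≤ C₀ + C₁ := (norm_sub_le _ _).trans (add_le_add a0 a1)

theorem exists_norm_rayCauchy_le (hU : IsPotential D U) (hD : 2 ≤ D) (k : ℕ) (p : ℂ[X]) :
    ∃ C, ∀ z ∉ ray D k, 3 ≤ ‖z‖ → ‖rayCauchy D k (weighted U p) z‖ ≤ C := by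
  have hd : Differentiable ℂ fun u => weighted U p (u * dir D k) :=
    (differentiable_weighted U p).comp (by fun_prop)
  have hder : deriv (fun u => weighted U p (u * dir D k))
      = fun u => weighted U (twist U p) (u * dir D k) * dir D k := by
    ext u
    have h1 : HasDerivAt (fun u : ℂ => u * dir D k) (dir D k) u := by
      simpa using (hasDerivAt_id' u).mul_const (dir D k)
    exact (HasDerivAt.comp u (hasDerivAt_weighted U p (u * dir D k)) h1).deriv
  have hdec : HalfDecay (deriv fun u => weighted U p (u * dir D k)) := by
    rw [hder]
    obtain ⟨C, hC0, hC⟩ := hU.stripDecay hD k (twist U p)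
    exact ⟨C, hC0, fun u h0 h1 => by simpa using hC u h0 h1⟩
  obtain ⟨C, hC⟩ := exists_norm_halfCauchy_le (hU.stripDecay hD k p) hd hdec
  exact ⟨C, fun z hz hz3 => hC _ (fun h => hz (div_dir_mem_halfAxis_iff.1 h))
    (by rwa [norm_div_dir])⟩

theorem arcCauchy_isBigO_one (hU : IsPotential D U) (hD : 2 ≤ D) (hj : j < D) (p : ℂ[X]) :
    arcCauchy D j (weighted U p) =O[Bornology.cobounded ℂ ⊓ 𝓟 (contour D)ᶜ]
      fun _ => (1 : ℂ) := by
  obtain ⟨C₀, h₀⟩ := exists_norm_rayCauchy_le hU hD 0 p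
  obtain ⟨C₁, h₁⟩ := exists_norm_rayCauchy_le hU hD j p
  refine Asymptotics.IsBigO.of_bound (‖(2 * Real.pi * Complex.I : ℂ)⁻¹‖ * (C₀ + C₁)) ?_
  rw [eventually_inf_principal]
  filter_upwards [tendsto_norm_cobounded_atTop.eventually_ge_atTop 3] with z hz3 hz
  rw [arcCauchy, norm_mul, norm_one, mul_one]
  refine mul_le_mul_of_nonneg_left ?_ (norm_nonneg _)
  exact (norm_sub_le _ _).trans (add_le_add
    (h₀ z (notMem_ray_of_notMem_contour hD (by omega) hz) hz3)
    (h₁ z (notMem_ray_of_notMem_contour hD hj hz) hz3))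

/-- Integrate `1 / (s - z) = z⁻¹ (s / (s - z) - 1)`. Each use splits off one moment, so vanishing
moments become decay at infinity. -/
theorem rayCauchy_eq (hU : IsPotential D U) (hD : 2 ≤ D) (k : ℕ) (p : ℂ[X]) {z : ℂ}
    (hz : z ∉ ray D k) :
    rayCauchy D k (weighted U p) z
      = z⁻¹ * (rayCauchy D k (weighted U (X * p)) z - rayMoment hU hD k p) := by
  have hz0 : z ≠ 0 := fun h => hz (h ▸ zero_mem_ray D k)
  have hz' : z / dir D k ∉ halfAxis := fun h => hz (div_dir_mem_halfAxis_iff.1 h)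
  have hc : ∀ q : ℂ[X], Continuous fun u => weighted U q (u * dir D k) := fun q =>
    (continuous_weighted U q).comp (by fun_prop)
  have hi := integrableOn_halfCauchy (f := fun u => weighted U (X * p) (u * dir D k))
    (hU.stripDecay hD k _) (hc _) hz'
  rw [eq_inv_mul_iff_mul_eq₀ hz0, rayMoment_apply, rayIntegral, rayCauchy, rayCauchy, halfCauchy,
    halfCauchy, ← integral_sub hi (((hU.stripDecay hD k p).integrableOn
      (continuous_weighted U p)).mul_const _), ← integral_const_mul]
  refine setIntegral_congr_fun measurableSet_Ioi fun t ht => ?_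
  have hne : (t : ℂ) - z / dir D k ≠ 0 := fun h => hz' (by
    rw [← sub_eq_zero.1 h]; exact ofReal_mem_halfAxis (Set.mem_Ioi.1 ht).le)
  have hne' : (t : ℂ) * dir D k - z ≠ 0 := fun h => hne (by
    have := dir_ne_zero D k
    field_simp
    rw [h, mul_zero])
  simp only [weighted_mul, eval_X]
  have := dir_ne_zero D k
  field_simp
  ring

/-- The integral of `p e^{-U}` over the arc `Γ_j`, as a linear functional of `p`. -/
def arcMoment (hU : IsPotential D U) (hD : 2 ≤ D) (j : ℕ) : ℂ[X] →ₗ[ℂ] ℂ :=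
  rayMoment hU hD 0 - rayMoment hU hD j

theorem arcMoment_apply (p : ℂ[X]) :
    arcMoment hU hD j p = rayMoment hU hD 0 p - rayMoment hU hD j p := rfl

theorem arcMoment_twist (q : ℂ[X]) : arcMoment hU hD j (twist U q) = 0 := by
  rw [arcMoment_apply, rayMoment_twist, rayMoment_twist, sub_self]

theorem arcCauchy_eq (hj : j < D) (p : ℂ[X]) {z : ℂ} (hz : z ∉ contour D) :
    arcCauchy D j (weighted U p) z = z⁻¹ * (arcCauchy D j (weighted U (X * p)) z
      - (2 * Real.pi * Complex.I)⁻¹ * arcMoment hU hD j p) := by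
  rw [arcCauchy, rayCauchy_eq hU hD 0 p (notMem_ray_of_notMem_contour hD (by omega) hz),
    rayCauchy_eq hU hD j p (notMem_ray_of_notMem_contour hD hj hz), arcMoment_apply, arcCauchy]
  ring

theorem arcCauchy_eq_pow (hj : j < D) (p : ℂ[X]) {z : ℂ} (hz : z ∉ contour D) (N : ℕ)
    (h : ∀ m < N, arcMoment hU hD j (X ^ m * p) = 0) :
    arcCauchy D j (weighted U p) z = z⁻¹ ^ N * arcCauchy D j (weighted U (X ^ N * p)) z := by
  induction N with
  | zero => simp
  | succ N ih =>
    rw [ih fun m hm => h m (by omega), arcCauchy_eq hU hD hj _ hz, h N (by omega), pow_succ,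
      pow_succ, mul_comm (X ^ N) X, mul_assoc X]
    ring

theorem arcCauchy_isBigO_inv (hU : IsPotential D U) (hD : 2 ≤ D) (hj : j < D) (p : ℂ[X]) :
    arcCauchy D j (weighted U p) =O[Bornology.cobounded ℂ ⊓ 𝓟 (contour D)ᶜ] fun z => z⁻¹ := by
  have h1 : (fun z => arcCauchy D j (weighted U (X * p)) z
      - (2 * Real.pi * Complex.I)⁻¹ * arcMoment hU hD j p)
      =O[Bornology.cobounded ℂ ⊓ 𝓟 (contour D)ᶜ] fun _ => (1 : ℂ) :=
    (arcCauchy_isBigO_one hU hD hj _).sub (Asymptotics.isBigO_const_const _ one_ne_zero _)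
  have h2 := (Asymptotics.isBigO_refl (fun z : ℂ => z⁻¹)
    (Bornology.cobounded ℂ ⊓ 𝓟 (contour D)ᶜ)).mul h1
  refine h2.congr' ?_ (by simp)
  rw [EventuallyEq, eventually_inf_principal]
  exact Eventually.of_forall fun z hz => (arcCauchy_eq hU hD hj p hz).symm

/-- If the integrals over all the arcs vanish, a polynomial of degree at most `D - 2` is zero. -/
theorem eq_zero_of_arcMoment_eq_zero (p : ℂ[X]) (hp : p.degree < (D - 1 : ℕ))
    (h : ∀ j, 1 ≤ j → j < D → arcMoment hU hD j p = 0) : p = 0 := by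
  obtain ⟨N, rfl⟩ : ∃ N, D = N + 1 := ⟨D - 1, by omega⟩
  rw [Nat.add_sub_cancel] at hp
  let M : Matrix (Fin N) (Fin N) ℂ := fun m j => arcMoment hU hD (j + 1) (X ^ (m : ℕ))
  have hdet : M.det ≠ 0 := by
    intro h0
    obtain ⟨c, hc, hMc⟩ := Matrix.exists_mulVec_eq_zero_iff.2 h0
    refine hc ?_
    -- A relation between arcs with coefficients `c` puts weight `∑ c` on `C_0` and `-c` on the
    -- other rays, in total zero.
    have hz := eq_zero_of_rayMoment_eq_zero hU hD (Fin.cons (∑ j, c j) fun j => -c j)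
      (by simp [Fin.sum_univ_succ]) (fun m hm => by
        have := congrFun hMc ⟨m, by omega⟩
        simp only [Matrix.mulVec, dotProduct, M, arcMoment_apply, Pi.zero_apply] at this
        rw [Fin.sum_univ_succ]
        simp only [Fin.cons_zero, Fin.cons_succ, Fin.val_zero, Fin.val_succ]
        rw [← this, Finset.sum_mul, ← Finset.sum_add_distrib]
        exact Finset.sum_congr rfl fun j _ => by ring)
    ext j
    have := congrFun hz j.succ
    simpa using this
  have hv : Matrix.vecMul (fun m : Fin N => p.coeff m) M = 0 := by
    ext j
    have hpj := h (j + 1) (by omega) (by omega)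
    have e : p = ∑ m ∈ Finset.range N, p.coeff m • X ^ m := by
      rcases eq_or_ne p 0 with rfl | hp0
      · simp
      · conv_lhs => rw [p.as_sum_range' N ((natDegree_lt_iff_degree_lt hp0).2 hp)]
        simp [smul_X_eq_monomial]
    rw [e] at hpj
    simp only [map_sum, map_smul, smul_eq_mul] at hpj
    rw [Finset.sum_range] at hpj
    exact hpj
  have h0 := Matrix.eq_zero_of_vecMul_eq_zero hdet hv
  ext m
  by_cases hm : m < N
  · exact congrFun h0 ⟨m, hm⟩
  · rw [coeff_eq_zero_of_degree_lt (hp.trans_le (by exact_mod_cast not_lt.1 hm)), coeff_zero]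

end arc

/-! ### The symplectic form on real polynomials -/

/-- A real polynomial, viewed as a complex one. -/
abbrev toC (P : ℝ[X]) : ℂ[X] := P.map (algebraMap ℝ ℂ)

theorem aeval_eq_eval_toC (P : ℝ[X]) (z : ℂ) : aeval z P = (toC P).eval z :=
  (eval_map_algebraMap P z).symm

theorem eval_toC_ofReal (P : ℝ[X]) (x : ℝ) : (toC P).eval (x : ℂ) = ((P.eval x : ℝ) : ℂ) := by
  rw [← aeval_eq_eval_toC]; exact aeval_algebraMap_apply_eq_algebraMap_eval x P

theorem isPotential_toC {V : ℝ[X]} {D : ℕ} (hD : V.natDegree = D) (hV : 0 < V.leadingCoeff) :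
    IsPotential D (toC V) :=
  ⟨by rw [natDegree_map, hD], V.leadingCoeff, hV, by rw [leadingCoeff_map]; rfl⟩

theorem IsPotential.two_mul {U : ℂ[X]} {D : ℕ} (hU : IsPotential D U) :
    IsPotential D (C 2 * U) := by
  obtain ⟨c, hc, h⟩ := hU.leadingCoeff_pos
  refine ⟨by rw [natDegree_C_mul two_ne_zero, hU.natDegree_eq], 2 * c, by positivity, ?_⟩
  rw [leadingCoeff_mul, leadingCoeff_C, h]; push_cast; rfl

section line

variable {D : ℕ} {U : ℂ[X]}

/-- `C_{D/2}` is the negative half-axis run towards the origin, so the arc is the real line from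
left to right. -/
theorem integrable_weighted (hU : IsPotential D U) (hD : 2 ≤ D) (hDe : Even D) (p : ℂ[X]) :
    Integrable (fun x : ℝ => weighted U p x) ∧
      ∫ x : ℝ, weighted U p x = arcMoment hU hD (D / 2) p := by
  have hdir := dir_half hDe (by omega)
  have h0 := (hU.stripDecay hD 0 p).integrableOn (continuous_weighted U p)
  have h1 := (hU.stripDecay hD (D / 2) p).integrableOn (continuous_weighted U p)
  simp only [dir_zero, mul_one] at h0
  simp only [hdir, mul_neg, mul_one] at h1
  have h1' : IntegrableOn (fun x : ℝ => weighted U p x) (Set.Iic 0) := by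
    have := integrableOn_Ici_iff_integrableOn_Ioi (by simp) |>.2 h1
    have h2 := (MeasurePreserving.integrableOn_comp_preimage (Measure.measurePreserving_neg volume)
      (Homeomorph.neg ℝ).measurableEmbedding (f := fun x : ℝ => weighted U p x)
      (s := Set.Iic 0)).1
    refine h2 ?_
    simpa [Function.comp_def] using this
  have hInt : Integrable (fun x : ℝ => weighted U p x) := by
    rw [← integrableOn_univ, ← Set.Iic_union_Ioi (a := (0 : ℝ))]
    exact h1'.union h0
  refine ⟨hInt, ?_⟩
  rw [← intervalIntegral.integral_Iic_add_Ioi h1' h0, arcMoment_apply, rayMoment_apply,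
    rayMoment_apply, rayIntegral, rayIntegral]
  have := integral_comp_neg_Ioi (0 : ℝ) (fun x : ℝ => weighted U p x)
  rw [neg_zero] at this
  rw [← this]
  simp only [hdir, dir_zero, mul_one, mul_neg, integral_neg, sub_neg_eq_add]
  rw [add_comm]
  simp

end line

section real

variable {V : ℝ[X]} {D : ℕ}

theorem weighted_toC_ofReal (V P : ℝ[X]) (x : ℝ) :
    weighted (C 2 * toC V) (toC P) x = ((P.eval x * Real.exp (-2 * V.eval x) : ℝ) : ℂ) := by
  rw [weighted, eval_mul, eval_C, eval_toC_ofReal, eval_toC_ofReal]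
  push_cast; ring_nf

/-- The linear functional `P ↦ ∫ P e^{-2V}` on real polynomials. -/
def lineMoment (hU : IsPotential D (toC V)) (hD : 2 ≤ D) (hDe : Even D) : ℝ[X] →ₗ[ℝ] ℝ where
  toFun P := ∫ x : ℝ, P.eval x * Real.exp (-2 * V.eval x)
  map_add' P Q := by
    have h : ∀ P : ℝ[X], Integrable fun x : ℝ => P.eval x * Real.exp (-2 * V.eval x) := fun P => by
      have := (integrable_weighted hU.two_mul hD hDe (toC P)).1.re
      simpa only [weighted_toC_ofReal, RCLike.ofReal_re, Complex.ofReal_re, RCLike.re_to_complex]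
        using this
    rw [← integral_add (h P) (h Q)]
    simp only [eval_add, add_mul]
  map_smul' c P := by
    rw [RingHom.id_apply, smul_eq_mul, ← integral_const_mul]
    simp only [eval_smul, smul_eq_mul, mul_assoc]

variable (hU : IsPotential D (toC V)) (hD : 2 ≤ D) (hDe : Even D)

theorem lineMoment_apply (P : ℝ[X]) :
    lineMoment hU hD hDe P = ∫ x : ℝ, P.eval x * Real.exp (-2 * V.eval x) := rfl

theorem ofReal_lineMoment (P : ℝ[X]) :
    ((lineMoment hU hD hDe P : ℝ) : ℂ) = arcMoment hU.two_mul hD (D / 2) (toC P) := by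
  rw [← (integrable_weighted hU.two_mul hD hDe (toC P)).2, lineMoment_apply,
    ← integral_complex_ofReal]
  simp only [weighted_toC_ofReal]

theorem lineMoment_sq_pos {P : ℝ[X]} (hP : P ≠ 0) : 0 < lineMoment hU hD hDe (P * P) := by
  have hi : Integrable fun x : ℝ => (P * P).eval x * Real.exp (-2 * V.eval x) := by
    have := (integrable_weighted hU.two_mul hD hDe (toC (P * P))).1.re
    simpa only [weighted_toC_ofReal, RCLike.ofReal_re, Complex.ofReal_re, RCLike.re_to_complex]
      using this
  rw [lineMoment_apply, integral_pos_iff_support_of_nonneg _ hi]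
  · have hc : Continuous fun x : ℝ => (P * P).eval x * Real.exp (-2 * V.eval x) := by fun_prop
    refine hc.isOpen_support.measure_pos volume ?_
    obtain ⟨x, hx⟩ : ∃ x, P.eval x ≠ 0 := by
      by_contra h
      push Not at h
      exact hP (Polynomial.funext (by simpa using h))
    exact ⟨x, mul_ne_zero (by rw [eval_mul]; exact mul_ne_zero hx hx) (Real.exp_ne_zero _)⟩
  · intro x
    simp only [Pi.zero_apply, eval_mul]
    exact mul_nonneg (mul_self_nonneg _) (Real.exp_pos _).le

/-- `⟨P, Q⟩₄` as a bilinear form. -/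
def skewForm (hU : IsPotential D (toC V)) (hD : 2 ≤ D) (hDe : Even D) :
    ℝ[X] →ₗ[ℝ] ℝ[X] →ₗ[ℝ] ℝ :=
  LinearMap.mk₂ ℝ
    (fun P Q => 2⁻¹ * lineMoment hU hD hDe (P * derivative Q - derivative P * Q))
    (fun P P' Q => by rw [← mul_add, ← map_add]; congr 2; rw [derivative_add]; ring)
    (fun c P Q => by
      rw [smul_eq_mul, mul_left_comm, ← smul_eq_mul c, ← map_smul]; congr 2
      rw [derivative_smul]; simp only [smul_mul_assoc, smul_sub])
    (fun P Q Q' => by rw [← mul_add, ← map_add]; congr 2; rw [derivative_add]; ring)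
    (fun c P Q => by
      rw [smul_eq_mul, mul_left_comm, ← smul_eq_mul c, ← map_smul]; congr 2
      rw [derivative_smul]; simp only [mul_smul_comm, smul_sub])

theorem skewForm_apply (P Q : ℝ[X]) : skewForm hU hD hDe P Q
    = 2⁻¹ * lineMoment hU hD hDe (P * derivative Q - derivative P * Q) := rfl

theorem skewInner_eq_skewForm (P Q : ℝ[X]) : skewInner V P Q = skewForm hU hD hDe P Q := by
  rw [skewInner, skewForm_apply, lineMoment_apply]
  simp

theorem skewForm_swap (P Q : ℝ[X]) : skewForm hU hD hDe P Q = -skewForm hU hD hDe Q P := by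
  rw [skewForm_apply, skewForm_apply, ← mul_neg, ← map_neg]; congr 2; ring

theorem skewForm_self (P : ℝ[X]) : skewForm hU hD hDe P P = 0 := by
  have := skewForm_swap hU hD hDe P P
  linarith

/-- The source of positivity: `P (X P)' - P' (X P) = P²`. -/
theorem skewForm_X_mul (P : ℝ[X]) :
    skewForm hU hD hDe P (X * P) = 2⁻¹ * lineMoment hU hD hDe (P * P) := by
  rw [skewForm_apply, derivative_mul, derivative_X]; congr 2; ring

/-- Without roots, the sign at `0` would have to agree with the signs at both ends of the line,
which are opposite in odd degree. -/
theorem exists_isRoot_of_odd_natDegree {P : ℝ[X]} (hP : Odd P.natDegree) : ∃ x, P.IsRoot x := by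
  by_contra hno
  push Not at hno
  rcases le_total 0 P.leadingCoeff with h | h
  · have h1 := zero_lt_eval_of_roots_lt_of_leadingCoeff_nonneg (P := P) (x := 0)
      (fun y hy => absurd hy (hno y)) h
    have h2 := zero_lt_negOnePow_mul_eval_of_lt_roots_of_leadingCoeff_nonneg (P := P) (x := 0)
      (fun y hy => absurd hy (hno y)) h
    rw [Int.negOnePow_odd _ (by exact_mod_cast hP)] at h2
    push_cast at h2; linarith
  · have h1 := eval_lt_zero_of_roots_lt_of_leadingCoeff_nonpos (P := P) (x := 0)
      (fun y hy => absurd hy (hno y)) h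
    have h2 := negOnePow_mul_eval_lt_zero_of_lt_roots_of_leadingCoeff_nonpos (P := P) (x := 0)
      (fun y hy => absurd hy (hno y)) h
    rw [Int.negOnePow_odd _ (by exact_mod_cast hP)] at h2
    push_cast at h2; linarith

/-- The skew form is non-degenerate on the polynomials of degree less than `2k`. -/
theorem skewForm_nondegenerate {k : ℕ} {q : ℝ[X]} (hq : q.degree < (2 * k : ℕ))
    (h : ∀ r : ℝ[X], r.degree < (2 * k : ℕ) → skewForm hU hD hDe q r = 0) : q = 0 := by
  by_contra hq0
  have hqn : q.natDegree < 2 * k := (natDegree_lt_iff_degree_lt hq0).2 hq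
  -- If the degree of `q` leaves room, test against `X * q`.
  by_cases hlt : q.natDegree + 1 < 2 * k
  · have h1 := h (X * q) (by
      rw [← natDegree_lt_iff_degree_lt (mul_ne_zero X_ne_zero hq0), natDegree_X_mul hq0]
      exact hlt)
    rw [skewForm_X_mul] at h1
    have := lineMoment_sq_pos hU hD hDe hq0
    linarith
  · obtain ⟨x, hx⟩ := exists_isRoot_of_odd_natDegree (P := q) ⟨k - 1, by omega⟩
    obtain ⟨s, rfl⟩ := dvd_iff_isRoot.2 hx
    have hs0 : s ≠ 0 := right_ne_zero_of_mul hq0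
    have h1 := h s (by
      rw [← natDegree_lt_iff_degree_lt hs0]
      rw [natDegree_mul (X_sub_C_ne_zero x) hs0, natDegree_X_sub_C] at hqn
      omega)
    have e : (X - C x) * s * derivative s - derivative ((X - C x) * s) * s = -(s * s) := by
      rw [derivative_mul, derivative_X_sub_C]; ring
    rw [skewForm_apply, e, map_neg] at h1
    have := lineMoment_sq_pos hU hD hDe hs0
    linarith

instance finiteDimensional_degreeLT (K : Type*) [Field K] (n : ℕ) :
    FiniteDimensional K (degreeLT K n) :=
  Module.Finite.equiv (degreeLTEquiv K n).symm

theorem finrank_degreeLT (K : Type*) [Field K] (n : ℕ) : Module.finrank K (degreeLT K n) = n := by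
  rw [(degreeLTEquiv K n).finrank_eq, Module.finrank_fin_fun]

/-- Every polynomial can be made skew-orthogonal to the polynomials of degree less than `2k`
by a correction of degree less than `2k`. -/
theorem exists_skewForm_sub_eq_zero (k : ℕ) (f : ℝ[X]) : ∃ q : ℝ[X], q.degree < (2 * k : ℕ) ∧
    ∀ r : ℝ[X], r.degree < (2 * k : ℕ) → skewForm hU hD hDe (f - q) r = 0 := by
  let W := degreeLT ℝ (2 * k)
  let T : W →ₗ[ℝ] Module.Dual ℝ W := ((skewForm hU hD hDe).domRestrict₁₂ W W)
  have hinj : Function.Injective T := by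
    rw [← LinearMap.ker_eq_bot, LinearMap.ker_eq_bot']
    intro q hq
    refine Subtype.ext (skewForm_nondegenerate hU hD hDe (mem_degreeLT.1 q.2) fun r hr => ?_)
    exact LinearMap.congr_fun hq ⟨r, mem_degreeLT.2 hr⟩
  have hsurj := (LinearMap.injective_iff_surjective_of_finrank_eq_finrank
    (Subspace.dual_finrank_eq (K := ℝ) (V := W)).symm).1 hinj
  obtain ⟨q, hq⟩ := hsurj (((skewForm hU hD hDe) f).domRestrict W)
  refine ⟨q, mem_degreeLT.1 q.2, fun r hr => ?_⟩
  have := LinearMap.congr_fun hq ⟨r, mem_degreeLT.2 hr⟩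
  rw [map_sub, LinearMap.sub_apply, sub_eq_zero]
  exact this.symm

theorem exists_isSkewOrthogonal (hU : IsPotential D (toC V)) (hD : 2 ≤ D) (hDe : Even D) :
    ∃ P : ℕ → ℝ[X], IsSkewOrthogonal V P := by
  -- Both members of the pair `2k`, `2k + 1` are corrected against all degrees below `2k`; inside a
  -- pair only antisymmetry is needed.
  choose q hq1 hq2 using fun m : ℕ => exists_skewForm_sub_eq_zero hU hD hDe (m / 2) (X ^ m)
  have hdeg : ∀ m, (q m).degree < (m : ℕ) := fun m =>
    (hq1 m).trans_le (by exact_mod_cast (by omega : 2 * (m / 2) ≤ m))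
  have hmonic : ∀ m, (X ^ m - q m).Monic := fun m =>
    (monic_X_pow m).sub_of_left (by rw [degree_X_pow]; exact hdeg m)
  have hnat : ∀ m, (X ^ m - q m).natDegree = m := fun m => by
    refine natDegree_eq_of_degree_eq_some ?_
    rw [degree_sub_eq_left_of_degree_lt, degree_X_pow]
    rw [degree_X_pow]; exact hdeg m
  have hlt : ∀ a b, b / 2 < a / 2 → skewForm hU hD hDe (X ^ a - q a) (X ^ b - q b) = 0 := by
    intro a b hab
    refine hq2 a _ ?_
    rw [← natDegree_lt_iff_degree_lt (hmonic b).ne_zero, hnat]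
    omega
  have hne : ∀ a b, a / 2 ≠ b / 2 → skewForm hU hD hDe (X ^ a - q a) (X ^ b - q b) = 0 := by
    intro a b hab
    rcases lt_or_gt_of_ne hab with h | h
    · rw [skewForm_swap, hlt b a h, neg_zero]
    · exact hlt a b h
  refine ⟨fun m => X ^ m - q m, hmonic, hnat, fun k l => ?_, fun k l => ?_, fun k l hkl => ?_⟩
  · rw [skewInner_eq_skewForm hU hD hDe]
    rcases eq_or_ne k l with rfl | h
    · exact skewForm_self hU hD hDe _
    · exact hne _ _ (by omega)
  · rw [skewInner_eq_skewForm hU hD hDe]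
    rcases eq_or_ne k l with rfl | h
    · exact skewForm_self hU hD hDe _
    · exact hne _ _ (by omega)
  · rw [skewInner_eq_skewForm hU hD hDe]
    exact hne _ _ (by omega)

/-- Expansion in a sequence of monic polynomials of all degrees. -/
theorem exists_eq_sum_of_monic {K : Type*} [Field K] {P : ℕ → K[X]} (hP : ∀ m, (P m).Monic)
    (hd : ∀ m, (P m).natDegree = m) (N : ℕ) :
    ∀ q : K[X], q.degree < (N : ℕ) → ∃ c : ℕ → K, q = ∑ j ∈ Finset.range N, c j • P j := by
  induction N with
  | zero =>
    intro q hq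
    have : q = 0 := by simpa using hq
    exact ⟨0, by simp [this]⟩
  | succ N ih =>
    intro q hq
    obtain ⟨c, hc⟩ := ih (q - q.coeff N • P N) (by
      rw [degree_lt_iff_coeff_zero]
      intro m hm
      rw [coeff_sub, coeff_smul, smul_eq_mul]
      rcases hm.eq_or_lt with rfl | hm
      · have := (hP N).coeff_natDegree
        rw [hd] at this
        rw [this, mul_one, sub_self]
      · rw [coeff_eq_zero_of_natDegree_lt (p := P N) (by rw [hd]; exact hm),
          coeff_eq_zero_of_degree_lt (hq.trans_le (by exact_mod_cast hm))]
        simp)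
    refine ⟨fun j => if j = N then q.coeff N else c j, ?_⟩
    rw [Finset.sum_range_succ]
    simp only [if_true]
    rw [← sub_eq_iff_eq_add, hc]
    refine Finset.sum_congr rfl fun j hj => ?_
    rw [if_neg (Finset.mem_range.1 hj).ne]

theorem IsSkewOrthogonal.skewInner_eq_zero {P : ℕ → ℝ[X]} (hP : IsSkewOrthogonal V P)
    (hU : IsPotential D (toC V)) (hD : 2 ≤ D) (hDe : Even D) {a b : ℕ}
    (h : a = b ∨ a / 2 ≠ b / 2) : skewInner V (P a) (P b) = 0 := by
  rcases h with rfl | h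
  · rw [skewInner_eq_skewForm hU hD hDe, skewForm_self]
  · obtain ⟨k, rfl | rfl⟩ := Nat.even_or_odd' a <;> obtain ⟨l, rfl | rfl⟩ := Nat.even_or_odd' b
    · exact hP.even_even k l
    · exact hP.even_odd k l (by omega)
    · rw [skewInner_eq_skewForm hU hD hDe, skewForm_swap, ← skewInner_eq_skewForm,
        hP.even_odd l k (by omega), neg_zero]
    · exact hP.odd_odd k l

/-- `X P_{2k}` and `P_{2k+1}` differ by a combination of `P_0, …, P_{2k}`, all skew-orthogonal to
`P_{2k}`. So `h_k = ⟨P_{2k}, X P_{2k}⟩₄ = ½ ∫ P_{2k}² e^{-2V}`. -/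
theorem IsSkewOrthogonal.skewNorm_pos {P : ℕ → ℝ[X]} (hP : IsSkewOrthogonal V P)
    (hU : IsPotential D (toC V)) (hD : 2 ≤ D) (hDe : Even D) (k : ℕ) : 0 < skewNorm V P k := by
  have hP0 := (hP.monic (2 * k)).ne_zero
  have hmon : (X * P (2 * k)).Monic := monic_X.mul (hP.monic _)
  obtain ⟨c, hc⟩ := exists_eq_sum_of_monic hP.monic hP.natDegree_eq (2 * k + 1)
    (X * P (2 * k) - P (2 * k + 1)) (by
      have h1 : (X * P (2 * k)).degree = ((2 * k + 1 : ℕ) : WithBot ℕ) := by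
        rw [degree_eq_natDegree hmon.ne_zero, natDegree_X_mul hP0, hP.natDegree_eq]
      rw [← h1]
      refine degree_sub_lt_left ?_ hmon.ne_zero ?_
      · rw [h1, degree_eq_natDegree (hP.monic _).ne_zero, hP.natDegree_eq]
      · rw [hmon.leadingCoeff, (hP.monic _).leadingCoeff])
  have h0 : skewForm hU hD hDe (P (2 * k)) (X * P (2 * k) - P (2 * k + 1)) = 0 := by
    rw [hc, map_sum]
    refine Finset.sum_eq_zero fun j hj => ?_
    have hj' := Finset.mem_range.1 hj
    rw [map_smul, ← skewInner_eq_skewForm, hP.skewInner_eq_zero hU hD hDe (by omega), smul_zero]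
  rw [skewNorm, skewInner_eq_skewForm hU hD hDe]
  rw [map_sub, sub_eq_zero, skewForm_X_mul] at h0
  rw [← h0]
  have := lineMoment_sq_pos hU hD hDe hP0
  positivity

/-! ### The symplectic form on complex polynomials -/

/-- The form `(P, Q) ↦ ∫ P e^{-V} (Q e^{-V})'` on complex polynomials. -/
def cskew (hU : IsPotential D (toC V)) (hD : 2 ≤ D) (P Q : ℂ[X]) : ℂ :=
  arcMoment hU.two_mul hD (D / 2) (P * twist (toC V) Q)

theorem twist_sum_smul (U : ℂ[X]) (N : ℕ) (c : ℕ → ℂ) (P : ℕ → ℂ[X]) :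
    twist U (∑ j ∈ Finset.range N, c j • P j) = ∑ j ∈ Finset.range N, c j • twist U (P j) := by
  simp only [twist, derivative_sum, derivative_smul, Finset.mul_sum, smul_sub, mul_smul_comm,
    Finset.sum_sub_distrib]

/-- The two integrands differ by the exact derivative `½ (P Q e^{-2V})'`. -/
theorem cskew_toC (hDe : Even D) (P Q : ℝ[X]) :
    cskew hU hD (toC P) (toC Q) = ((skewInner V P Q : ℝ) : ℂ) := by
  rw [skewInner_eq_skewForm hU hD hDe, skewForm_apply, cskew]
  push_cast
  rw [ofReal_lineMoment]
  have e : toC P * twist (toC V) (toC Q) - (2⁻¹ : ℂ) • toC (P * derivative Q - derivative P * Q)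
      = (2⁻¹ : ℂ) • twist (C 2 * toC V) (toC P * toC Q) := by
    simp only [twist, toC, Polynomial.map_sub, Polynomial.map_mul, derivative_mul, derivative_C,
      smul_eq_C_mul, ← derivative_map]
    have h2 : (C (2⁻¹ : ℂ)) * C 2 = 1 := by rw [← C_mul]; norm_num
    have h3 : (C (2 : ℂ)) = 2 := map_ofNat C 2
    rw [h3] at h2 ⊢
    linear_combination (-(map (algebraMap ℝ ℂ) P * derivative (map (algebraMap ℝ ℂ) Q))
      + map (algebraMap ℝ ℂ) P * map (algebraMap ℝ ℂ) Q * derivative (map (algebraMap ℝ ℂ) V)) * h2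
  have h := congrArg (arcMoment hU.two_mul hD (D / 2)) e
  rw [map_sub, map_smul, map_smul, arcMoment_twist, smul_zero, sub_eq_zero] at h
  exact h

theorem cskew_sum_left (N : ℕ) (c : ℕ → ℂ) (P : ℕ → ℂ[X]) (Q : ℂ[X]) :
    cskew hU hD (∑ j ∈ Finset.range N, c j • P j) Q
      = ∑ j ∈ Finset.range N, c j * cskew hU hD (P j) Q := by
  simp only [cskew, Finset.sum_mul, map_sum, smul_mul_assoc, map_smul, smul_eq_mul]

theorem cskew_sum_right (N : ℕ) (c : ℕ → ℂ) (P : ℕ → ℂ[X]) (Q : ℂ[X]) :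
    cskew hU hD Q (∑ j ∈ Finset.range N, c j • P j)
      = ∑ j ∈ Finset.range N, c j * cskew hU hD Q (P j) := by
  simp only [cskew, twist_sum_smul, Finset.mul_sum, map_sum, mul_smul_comm, map_smul, smul_eq_mul]

theorem IsSkewOrthogonal.exists_eq_sum {P : ℕ → ℝ[X]} (hP : IsSkewOrthogonal V P) {N : ℕ}
    {q : ℂ[X]} (hq : q.degree < (N : ℕ)) :
    ∃ c : ℕ → ℂ, q = ∑ j ∈ Finset.range N, c j • toC (P j) :=
  exists_eq_sum_of_monic (fun m => (hP.monic m).map _)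
    (fun m => by rw [natDegree_map, hP.natDegree_eq]) N q hq

/-- The coefficients of a skew-orthogonal expansion. -/
theorem IsSkewOrthogonal.cskew_sum {P : ℕ → ℝ[X]} (hP : IsSkewOrthogonal V P)
    (hU : IsPotential D (toC V)) (hD : 2 ≤ D) (hDe : Even D) {n k : ℕ} (hk : k < n) (c : ℕ → ℂ) :
    cskew hU hD (toC (P (2 * k))) (∑ j ∈ Finset.range (2 * n), c j • toC (P j))
        = c (2 * k + 1) * skewNorm V P k ∧
    cskew hU hD (toC (P (2 * k + 1))) (∑ j ∈ Finset.range (2 * n), c j • toC (P j))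
        = -(c (2 * k) * skewNorm V P k) := by
  constructor
  · rw [cskew_sum_right, Finset.sum_eq_single (2 * k + 1)]
    · rw [cskew_toC hU hD hDe]; rfl
    · intro j _ hj
      rw [cskew_toC hU hD hDe, hP.skewInner_eq_zero hU hD hDe (by omega)]; simp
    · intro h
      exact absurd (Finset.mem_range.2 (by omega)) h
  · rw [cskew_sum_right, Finset.sum_eq_single (2 * k)]
    · rw [cskew_toC hU hD hDe, skewInner_eq_skewForm hU hD hDe, skewForm_swap,
        ← skewInner_eq_skewForm]
      push_cast
      rw [mul_neg]; rfl
    · intro j _ hj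
      rw [cskew_toC hU hD hDe, hP.skewInner_eq_zero hU hD hDe (by omega)]; simp
    · intro h
      exact absurd (Finset.mem_range.2 (by omega)) h

/-- Expanding both arguments in a real skew-orthogonal sequence reduces antisymmetry to the real
form. -/
theorem cskew_swap {n : ℕ} (hDe : Even D) {p q : ℂ[X]} (hp : p.degree < (n : ℕ))
    (hq : q.degree < (n : ℕ)) : cskew hU hD p q = -cskew hU hD q p := by
  obtain ⟨P, hP⟩ := exists_isSkewOrthogonal hU hD hDe
  obtain ⟨c, rfl⟩ := hP.exists_eq_sum hp
  obtain ⟨d, rfl⟩ := hP.exists_eq_sum hq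
  simp only [cskew_sum_left, cskew_sum_right, Finset.mul_sum, ← Finset.sum_neg_distrib]
  rw [Finset.sum_comm]
  refine Finset.sum_congr rfl fun i _ => Finset.sum_congr rfl fun j _ => ?_
  rw [cskew_toC hU hD hDe, cskew_toC hU hD hDe, skewInner_eq_skewForm hU hD hDe, skewForm_swap,
    ← skewInner_eq_skewForm]
  push_cast; ring

/-- Pairing with `P_{2k}` and `P_{2k+1}` reads off the coefficients at `2k + 1` and `2k`, up to sign
and the factor `h_k ≠ 0`. -/
theorem eq_zero_of_cskew_right {n : ℕ} (hDe : Even D) {q : ℂ[X]} (hq : q.degree < (2 * n : ℕ))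
    (h : ∀ p : ℂ[X], p.degree < (2 * n : ℕ) → cskew hU hD p q = 0) : q = 0 := by
  obtain ⟨P, hP⟩ := exists_isSkewOrthogonal hU hD hDe
  obtain ⟨c, rfl⟩ := hP.exists_eq_sum hq
  have hdeg : ∀ m < 2 * n, (toC (P m)).degree < (2 * n : ℕ) := fun m hm => by
    rw [← natDegree_lt_iff_degree_lt ((hP.monic m).map _).ne_zero, natDegree_map, hP.natDegree_eq]
    exact hm
  refine Finset.sum_eq_zero fun j hj => ?_
  have hj' := Finset.mem_range.1 hj
  suffices c j = 0 by rw [this, zero_smul]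
  obtain ⟨k, rfl | rfl⟩ := Nat.even_or_odd' j
  · have h1 := (hP.cskew_sum hU hD hDe (n := n) (k := k) (by omega) c).2
    rw [h _ (hdeg _ (by omega)), eq_comm, neg_eq_zero] at h1
    exact (mul_eq_zero.1 h1).resolve_right
      (by exact_mod_cast (hP.skewNorm_pos hU hD hDe k).ne')
  · have h1 := (hP.cskew_sum hU hD hDe (n := n) (k := k) (by omega) c).1
    rw [h _ (hdeg _ (by omega)), eq_comm] at h1
    exact (mul_eq_zero.1 h1).resolve_right
      (by exact_mod_cast ne_of_gt (hP.skewNorm_pos hU hD hDe k))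

/-! ### The moment map -/

/-- The moments that determine the first column of the solution. -/
def momentMap (hU : IsPotential D (toC V)) (hD : 2 ≤ D) (n : ℕ) :
    degreeLT ℂ (2 * n + (D - 1)) →ₗ[ℂ] (Fin (2 * n) → ℂ) × (Fin (D - 1) → ℂ) :=
  LinearMap.prod
    (LinearMap.pi fun m => (arcMoment hU.two_mul hD (D / 2)) ∘ₗ
      (LinearMap.mulLeft ℂ (X ^ (m : ℕ) : ℂ[X])) ∘ₗ (degreeLT ℂ (2 * n + (D - 1))).subtype)
    (LinearMap.pi fun j => (arcMoment hU hD (j + 1)) ∘ₗ (degreeLT ℂ (2 * n + (D - 1))).subtype)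

/-- Write `p = p₀ + twist q`. The arc integrals see only `p₀`, whose degree is at most `D - 2`, and
force it to vanish; the moments against `e^{-2V}` are then the pairings of `q` with the monomials
below degree `2n`, and force `q = 0`. -/
theorem momentMap_injective (hDe : Even D) (n : ℕ) :
    Function.Injective (momentMap hU hD n) := by
  rw [← LinearMap.ker_eq_bot, LinearMap.ker_eq_bot']
  rintro ⟨p, hp⟩ h
  have h1 : ∀ m < 2 * n, arcMoment hU.two_mul hD (D / 2) (X ^ m * p) = 0 := fun m hm =>
    congrFun (congrArg Prod.fst h) ⟨m, hm⟩
  have h2 : ∀ j, 1 ≤ j → j < D → arcMoment hU hD j p = 0 := fun j hj0 hj => by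
    have := congrFun (congrArg Prod.snd h) ⟨j - 1, by omega⟩
    obtain ⟨i, rfl⟩ : ∃ i, j = i + 1 := ⟨j - 1, by omega⟩
    exact this
  obtain ⟨p₀, q, hp₀, hq, rfl⟩ := exists_eq_add_twist hU hD (2 * n) p (mem_degreeLT.1 hp)
  have hp₀0 : p₀ = 0 := eq_zero_of_arcMoment_eq_zero hU hD p₀ hp₀ fun j hj0 hj => by
    have := h2 j hj0 hj
    rwa [map_add, arcMoment_twist, add_zero] at this
  subst hp₀0
  have hq0 : q = 0 := eq_zero_of_cskew_right hU hD hDe hq fun p hp => by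
    have e : p = ∑ m ∈ Finset.range (2 * n), p.coeff m • X ^ m := by
      rcases eq_or_ne p 0 with rfl | hp0
      · simp
      · conv_lhs => rw [p.as_sum_range' (2 * n) ((natDegree_lt_iff_degree_lt hp0).2 hp)]
        simp [smul_X_eq_monomial]
    rw [e, cskew_sum_left]
    refine Finset.sum_eq_zero fun m hm => ?_
    have := h1 m (Finset.mem_range.1 hm)
    rw [zero_add] at this
    rw [cskew, this, mul_zero]
  subst hq0
  exact Subtype.ext (by simp [twist])

theorem momentMap_surjective (hDe : Even D) (n : ℕ) :
    Function.Surjective (momentMap hU hD n) := by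
  refine (LinearMap.injective_iff_surjective_of_finrank_eq_finrank ?_).1
    (momentMap_injective hU hD hDe n)
  rw [finrank_degreeLT, Module.finrank_prod, Module.finrank_fin_fun, Module.finrank_fin_fun]

/-- There is a polynomial of degree less than `2n + D - 1` with prescribed moments. -/
theorem exists_moments (hDe : Even D) (n : ℕ) (a : ℕ → ℂ) (b : ℕ → ℂ) :
    ∃ p : ℂ[X], p.degree < (2 * n + (D - 1) : ℕ) ∧
      (∀ m < 2 * n, arcMoment hU.two_mul hD (D / 2) (X ^ m * p) = a m) ∧
      ∀ j, 1 ≤ j → j < D → arcMoment hU hD j p = b j := by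
  obtain ⟨⟨p, hp⟩, h⟩ := momentMap_surjective hU hD hDe n (fun m => a m, fun j => b (j + 1))
  refine ⟨p, mem_degreeLT.1 hp, fun m hm => congrFun (congrArg Prod.fst h) ⟨m, hm⟩,
    fun j hj0 hj => ?_⟩
  have := congrFun (congrArg Prod.snd h) ⟨j - 1, by omega⟩
  obtain ⟨i, rfl⟩ : ∃ i, j = i + 1 := ⟨j - 1, by omega⟩
  exact this

end real

/-! ### The jump matrix -/

theorem fin_eq_one_iff {D : ℕ} (hD : 2 ≤ D) (j : Fin (D + 1)) : j = 1 ↔ (j : ℕ) = 1 := by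
  obtain ⟨d, rfl⟩ : ∃ d, D = d + 1 := ⟨D - 1, by omega⟩
  rw [Fin.ext_iff]; simp

theorem one_ne_zero_fin {D : ℕ} (hD : 2 ≤ D) : (1 : Fin (D + 1)) ≠ 0 := fun h => by
  rw [eq_comm, fin_eq_one_iff hD] at h; simp at h

/-- The potential that belongs to a column of the Riemann-Hilbert problem. -/
def colPot (V : ℝ[X]) {D : ℕ} (j : Fin (D + 1)) : ℂ[X] := if j = 1 then C 2 * toC V else toC V

/-- The index of the arc that belongs to a column of the Riemann-Hilbert problem. -/
def colArc {D : ℕ} (j : Fin (D + 1)) : ℕ := if j = 1 then D / 2 else j - 1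

theorem isPotential_colPot {V : ℝ[X]} {D : ℕ} (hU : IsPotential D (toC V)) (j : Fin (D + 1)) :
    IsPotential D (colPot V j) := by
  unfold colPot; split_ifs
  exacts [hU.two_mul, hU]

theorem colArc_mem {D : ℕ} (hD : 2 ≤ D) {j : Fin (D + 1)} (hj : j ≠ 0) :
    1 ≤ colArc j ∧ colArc j < D := by
  have h0 : (j : ℕ) ≠ 0 := fun h => hj (Fin.ext h)
  have := j.2
  unfold colArc
  split_ifs with h
  · omega
  · rw [fin_eq_one_iff hD] at h; omega

/-- The off-diagonal part of the first row of the jump matrix. -/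
def jumpRow (V : ℝ[X]) (D : ℕ) (x : ℂ) (j : Fin (D + 1)) : ℂ :=
  if j = 0 then 0 else Set.indicator (arc D (colArc j)) (weighted (colPot V j) 1) x

theorem mem_arc_half_iff {D : ℕ} (hD : 2 ≤ D) (hDe : Even D) (x : ℂ) :
    x ∈ arc D (D / 2) ↔ x.im = 0 := by
  rw [arc, Set.mem_union, mem_ray_iff, mem_ray_iff, dir_half hDe (by omega), dir_zero]
  simp only [div_one, div_neg, Complex.neg_re, Complex.neg_im, neg_eq_zero, ← or_and_right]
  refine and_iff_right ?_
  rcases le_total 0 x.re with h | h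
  exacts [Or.inl h, Or.inr (by linarith)]

theorem jump_eq {V : ℝ[X]} {D : ℕ} (hD : 2 ≤ D) (hDe : Even D) (x : ℂ) (i j : Fin (D + 1)) :
    jump V D x i j = (1 : Matrix (Fin (D + 1)) (Fin (D + 1)) ℂ) i j
      + if i = 0 then jumpRow V D x j else 0 := by
  by_cases hij : i = j
  · subst hij
    simp only [jump, Matrix.of_apply, if_true, Matrix.one_apply_eq, jumpRow]
    split_ifs <;> simp
  · rw [Matrix.one_apply_ne hij, zero_add]
    simp only [jump, Matrix.of_apply, if_neg hij]
    by_cases hi : i = 0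
    · have hj : j ≠ 0 := fun h => hij (hi.trans h.symm)
      rw [if_pos hi, if_pos hi, jumpRow, if_neg hj]
      by_cases h1 : j = 1
      · rw [if_pos h1, colArc, if_pos h1, colPot, if_pos h1]
        have hs : {w : ℂ | w.im = 0} = arc D (D / 2) := by
          ext w; exact (mem_arc_half_iff hD hDe w).symm
        rw [hs]
        refine congrFun (congrArg _ (_root_.funext fun w => ?_)) x
        simp only [weighted, aeval_eq_eval_toC, eval_mul, eval_C, eval_one, one_mul, neg_mul]
      · rw [if_neg h1, colArc, if_neg h1, colPot, if_neg h1]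
        refine congrFun (congrArg _ (_root_.funext fun w => ?_)) x
        simp only [weighted, aeval_eq_eval_toC, eval_one, one_mul]
    · rw [if_neg hi, if_neg hi]

theorem vecMul_jump {V : ℝ[X]} {D : ℕ} (hD : 2 ≤ D) (hDe : Even D) (x : ℂ) (b : Fin (D + 1) → ℂ) :
    Matrix.vecMul b (jump V D x) = fun j => b j + b 0 * jumpRow V D x j := by
  ext j
  simp only [Matrix.vecMul, dotProduct, jump_eq hD hDe, mul_add, Finset.sum_add_distrib, mul_ite,
    mul_zero, Finset.sum_ite_eq', Finset.mem_univ, if_true, Matrix.one_apply, mul_one]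

theorem det_jump {V : ℝ[X]} {D : ℕ} (hD : 2 ≤ D) (hDe : Even D) (x : ℂ) :
    (jump V D x).det = 1 := by
  rw [Matrix.det_of_isUpperTriangular]
  · refine Finset.prod_eq_one fun i _ => ?_
    rw [jump_eq hD hDe, Matrix.one_apply_eq, jumpRow]
    split_ifs <;> simp
  · intro i j hij
    have hij' : j < i := hij
    rw [jump_eq hD hDe, Matrix.one_apply_ne hij'.ne', if_neg (fun h => by simp [h] at hij'), add_zero]

/-! ### Row solutions -/

/-- A row vector with the analytic properties of a row of a solution of the Riemann-Hilbert
problem, without normalisation at infinity. -/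
structure IsRowSolution (V : ℝ[X]) (D : ℕ) (r : ℂ → Fin (D + 1) → ℂ) : Prop where
  analytic : ∀ j, DifferentiableOn ℂ (fun z => r z j) (contour D)ᶜ
  boundary : ∀ k < D, ∀ x ∈ ray D k, x ≠ 0 → ∃ b : Fin (D + 1) → ℂ,
    Tendsto r (𝓝[leftSide D k \ contour D] x) (𝓝 (Matrix.vecMul b (jump V D x))) ∧
    Tendsto r (𝓝[rightSide D k \ contour D] x) (𝓝 b)
  bounded_near_zero : ∃ ρ > (0 : ℝ), ∃ C : ℝ, ∀ z, z ∉ contour D → ‖z‖ < ρ → ∀ j, ‖r z j‖ ≤ C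

/-- The row with first entry `p`, completed by Cauchy transforms. -/
def cauchyRow (V : ℝ[X]) (D : ℕ) (p : ℂ[X]) (z : ℂ) (j : Fin (D + 1)) : ℂ :=
  if j = 0 then p.eval z else arcCauchy D (colArc j) (weighted (colPot V j) p) z

theorem exists_uniform_bound {ι : Type*} [Finite ι] {D : ℕ} {f : ι → ℂ → ℂ}
    (h : ∀ i, ∃ ρ > (0 : ℝ), ∃ C : ℝ, ∀ z, z ∉ contour D → ‖z‖ < ρ → ‖f i z‖ ≤ C) :
    ∃ ρ > (0 : ℝ), ∃ C : ℝ, ∀ z, z ∉ contour D → ‖z‖ < ρ → ∀ i, ‖f i z‖ ≤ C := by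
  choose ρ hρ C hC using h
  cases isEmpty_or_nonempty ι
  · exact ⟨1, one_pos, 0, fun z _ _ i => isEmptyElim i⟩
  obtain ⟨i₀, h₀⟩ := Finite.exists_min ρ
  obtain ⟨i₁, h₁⟩ := Finite.exists_max C
  exact ⟨ρ i₀, hρ i₀, C i₁, fun z hz hzr i => (hC i z hz (hzr.trans_le (h₀ i))).trans (h₁ i)⟩

/-- The jump condition asks that the first entry have no jump and every other entry jump by the
first times its weight, which is the Plemelj formula. -/
theorem isRowSolution_cauchyRow {V : ℝ[X]} {D : ℕ} (hU : IsPotential D (toC V)) (hD : 2 ≤ D)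
    (hDe : Even D) (p : ℂ[X]) : IsRowSolution V D (cauchyRow V D p) where
  analytic j := by
    by_cases hj : j = 0
    · simp only [cauchyRow, if_pos hj]
      exact p.differentiable.differentiableOn
    · simp only [cauchyRow, if_neg hj]
      exact differentiableOn_arcCauchy (isPotential_colPot hU j) hD (colArc_mem hD hj).2 p
  boundary k hk x hx hx0 := by
    have h : ∀ j : Fin (D + 1), ∃ b : ℂ,
        Tendsto (fun z => cauchyRow V D p z j) (𝓝[leftSide D k \ contour D] x)
          (𝓝 (b + p.eval x * jumpRow V D x j)) ∧
        Tendsto (fun z => cauchyRow V D p z j) (𝓝[rightSide D k \ contour D] x) (𝓝 b) ∧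
        (j = 0 → b = p.eval x) := by
      intro j
      by_cases hj : j = 0
      · refine ⟨p.eval x, ?_, ?_, fun _ => rfl⟩
        · simp only [cauchyRow, if_pos hj, jumpRow, mul_zero, add_zero]
          exact p.continuous.continuousAt.tendsto.mono_left nhdsWithin_le_nhds
        · simp only [cauchyRow, if_pos hj]
          exact p.continuous.continuousAt.tendsto.mono_left nhdsWithin_le_nhds
      · obtain ⟨b, h1, h2⟩ := tendsto_arcCauchy (isPotential_colPot hU j) hD (colArc_mem hD hj).1
          (colArc_mem hD hj).2 p hk hx hx0
        refine ⟨b, ?_, ?_, fun h => absurd h hj⟩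
        · simp only [cauchyRow, if_neg hj, jumpRow]
          have e : p.eval x * Set.indicator (arc D (colArc j)) (weighted (colPot V j) 1) x
              = Set.indicator (arc D (colArc j)) (weighted (colPot V j) p) x := by
            by_cases hm : x ∈ arc D (colArc j)
            · rw [Set.indicator_of_mem hm, Set.indicator_of_mem hm]; simp [weighted]
            · rw [Set.indicator_of_notMem hm, Set.indicator_of_notMem hm, mul_zero]
          rw [e]; exact h1
        · simp only [cauchyRow, if_neg hj]; exact h2
    choose b h1 h2 h3 using h
    refine ⟨b, ?_, tendsto_pi_nhds.2 h2⟩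
    rw [vecMul_jump hD hDe, h3 0 rfl]
    exact tendsto_pi_nhds.2 h1
  bounded_near_zero := by
    refine exists_uniform_bound (f := fun j z => cauchyRow V D p z j) fun j => ?_
    by_cases hj : j = 0
    · simp only [cauchyRow, if_pos hj]
      obtain ⟨B, hB, h⟩ := exists_norm_eval_le p le_rfl
      refine ⟨1, one_pos, B * (1 + 1) ^ p.natDegree, fun z _ hz => (h z).trans ?_⟩
      exact mul_le_mul_of_nonneg_left (pow_le_pow_left₀ (by positivity) (by linarith) _) hB
    · simp only [cauchyRow, if_neg hj]
      exact exists_norm_arcCauchy_le_near_zero (isPotential_colPot hU j) hD (colArc_mem hD hj).2 p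

/-- The jump adds multiples of the first entry to the others, so a row with zero first entry passes
unchanged. -/
theorem isRowSolution_single {V : ℝ[X]} {D : ℕ} (hD : 2 ≤ D) (hDe : Even D) {i : Fin (D + 1)}
    (hi : i ≠ 0) : IsRowSolution V D fun _ => Pi.single i 1 where
  analytic j := differentiableOn_const _
  boundary k hk x hx hx0 := by
    refine ⟨Pi.single i 1, ?_, tendsto_const_nhds⟩
    rw [vecMul_jump hD hDe]
    simp only [Pi.single_eq_of_ne hi.symm, zero_mul, add_zero]
    exact tendsto_const_nhds
  bounded_near_zero := ⟨1, one_pos, 1, fun z _ _ j => by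
    rw [Pi.single_apply]; split_ifs <;> simp⟩

theorem IsEvenSolution.isRowSolution {V : ℝ[X]} {D n : ℕ}
    {A : ℂ → Matrix (Fin (D + 1)) (Fin (D + 1)) ℂ} (hA : IsEvenSolution V D n A) (hD : 2 ≤ D)
    (i : Fin (D + 1)) : IsRowSolution V D fun z => A z i where
  analytic j := hA.analytic i j
  boundary k hk x hx hx0 := by
    obtain ⟨Ap, Am, -, -, h, hJ⟩ := hA.boundary
    obtain ⟨h1, h2⟩ := h k hk x hx hx0
    have hx' : x ∈ contour D \ {0} := ⟨(mem_contour_iff hD).2 ⟨k, hk, hx⟩, hx0⟩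
    refine ⟨Am x i, ?_, tendsto_pi_nhds.1 h2 i⟩
    have h3 := tendsto_pi_nhds.1 h1 i
    rw [hJ x hx'] at h3
    exact h3
  bounded_near_zero := by
    obtain ⟨ρ, hρ, C, h⟩ := hA.bounded_near_zero
    exact ⟨ρ, hρ, C, fun z hz hzr j => h z hz hzr i j⟩

theorem regularSpace_matrix (m : ℕ) : RegularSpace (Matrix (Fin m) (Fin m) ℂ) :=
  inferInstanceAs (RegularSpace (Fin m → Fin m → ℂ))

/-- Boundary values from one side of the rays are automatically continuous. -/
theorem exists_continuousOn_boundary_values {D m : ℕ} (hD : 2 ≤ D) (S : ℕ → Set ℂ)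
    {A : ℂ → Matrix (Fin m) (Fin m) ℂ}
    (hS : ∀ k < D, ∀ x ∈ ray D k, x ≠ 0 → x ∈ closure (S k))
    (h : ∀ k < D, ∀ x ∈ ray D k, x ≠ 0 → ∃ M, Tendsto A (𝓝[S k] x) (𝓝 M)) :
    ∃ Ap : ℂ → Matrix (Fin m) (Fin m) ℂ, ContinuousOn Ap (contour D \ {0}) ∧
      ∀ k < D, ∀ x ∈ ray D k, x ≠ 0 → Tendsto A (𝓝[S k] x) (𝓝 (Ap x)) := by
  classical
  have := regularSpace_matrix m
  let Ap : ℂ → Matrix (Fin m) (Fin m) ℂ := fun x =>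
    if hx : ∃ k < D, x ∈ ray D k then extendFrom (S hx.choose) A x else 0
  have hAp : ∀ k < D, ∀ x ∈ ray D k, x ≠ 0 → Ap x = extendFrom (S k) A x := by
    intro k hk x hx hx0
    have hex : ∃ k < D, x ∈ ray D k := ⟨k, hk, hx⟩
    have : hex.choose = k :=
      eq_of_mem_ray (by omega) hex.choose_spec.1 hk hx0 hex.choose_spec.2 hx
    simp only [Ap, dif_pos hex, this]
  have hlim : ∀ k < D, ∀ x ∈ ray D k, x ≠ 0 → Tendsto A (𝓝[S k] x) (𝓝 (Ap x)) := by
    intro k hk x hx hx0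
    rw [hAp k hk x hx hx0]
    exact tendsto_extendFrom (h k hk x hx hx0)
  refine ⟨Ap, fun x hx => ?_, hlim⟩
  obtain ⟨k, hk, hxk⟩ := (mem_contour_iff hD).1 hx.1
  -- Limits taken along a fixed set depend continuously on the point, and near `x` the contour
  -- consists of this one ray.
  have hc : ContinuousOn (extendFrom (S k) A) (ray D k \ {0}) :=
    continuousOn_extendFrom (fun y hy => hS k hk y hy.1 hy.2) fun y hy => h k hk y hy.1 hy.2
  have hmem : ray D k \ {0} ∈ 𝓝[contour D \ {0}] x := by
    filter_upwards [self_mem_nhdsWithin, nhdsWithin_le_nhds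
        (eventually_mem_contour_iff hD hk hxk hx.2), nhdsWithin_le_nhds
        ((isOpen_lt continuous_const (by fun_prop)).mem_nhds (div_dir_re_pos hxk hx.2) :
          {z : ℂ | 0 < (z / dir D k).re} ∈ 𝓝 x)] with y hy h1 h2
    exact ⟨mem_ray_iff.2 ⟨le_of_lt h2, h1.1 hy.1⟩, hy.2⟩
  have h1 : ContinuousWithinAt (extendFrom (S k) A) (contour D \ {0}) x :=
    (hc x ⟨hxk, hx.2⟩).mono_of_mem_nhdsWithin hmem
  refine h1.congr_of_eventuallyEq ?_ (hAp k hk x hxk hx.2)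
  filter_upwards [hmem] with y hy using hAp k hk y hy.1 hy.2

theorem isEvenSolution_of_rows {V : ℝ[X]} {D n : ℕ} (hD : 2 ≤ D)
    {A : ℂ → Matrix (Fin (D + 1)) (Fin (D + 1)) ℂ}
    (hA : ∀ i, IsRowSolution V D fun z => A z i)
    (hn : ∃ E : ℂ → Matrix (Fin (D + 1)) (Fin (D + 1)) ℂ,
      (∀ i j, (fun z => E z i j)
        =O[Bornology.cobounded ℂ ⊓ 𝓟 (contour D)ᶜ] (fun z : ℂ => z⁻¹)) ∧
      ∀ᶠ z in Bornology.cobounded ℂ ⊓ 𝓟 (contour D)ᶜ, A z = (1 + E z) * growth D n z) :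
    IsEvenSolution V D n A where
  analytic i j := (hA i).analytic j
  boundary := by
    have hb : ∀ k < D, ∀ x ∈ ray D k, x ≠ 0 → ∃ M : Matrix (Fin (D + 1)) (Fin (D + 1)) ℂ,
        Tendsto A (𝓝[leftSide D k \ contour D] x) (𝓝 (M * jump V D x)) ∧
        Tendsto A (𝓝[rightSide D k \ contour D] x) (𝓝 M) := by
      intro k hk x hx hx0
      choose b h1 h2 using fun i => (hA i).boundary k hk x hx hx0
      exact ⟨b, tendsto_pi_nhds.2 h1, tendsto_pi_nhds.2 h2⟩
    obtain ⟨Ap, hApc, hAp⟩ := exists_continuousOn_boundary_values (A := A) hD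
      (fun k => leftSide D k \ contour D) (fun k hk x hx hx0 => (mem_closure_side hD hk hx hx0).1)
      fun k hk x hx hx0 => ⟨_, (hb k hk x hx hx0).choose_spec.1⟩
    obtain ⟨Am, hAmc, hAm⟩ := exists_continuousOn_boundary_values (A := A) hD
      (fun k => rightSide D k \ contour D) (fun k hk x hx hx0 => (mem_closure_side hD hk hx hx0).2)
      fun k hk x hx hx0 => ⟨_, (hb k hk x hx hx0).choose_spec.2⟩
    refine ⟨Ap, Am, hApc, hAmc, fun k hk x hx hx0 => ⟨hAp k hk x hx hx0, hAm k hk x hx hx0⟩, ?_⟩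
    rintro x ⟨hxc, hx0⟩
    obtain ⟨k, hk, hx⟩ := (mem_contour_iff hD).1 hxc
    obtain ⟨M, h1, h2⟩ := hb k hk x hx hx0
    have := mem_closure_iff_nhdsWithin_neBot.1 (mem_closure_side hD hk hx hx0).1
    have := mem_closure_iff_nhdsWithin_neBot.1 (mem_closure_side hD hk hx hx0).2
    rw [tendsto_nhds_unique (hAp k hk x hx hx0) h1, tendsto_nhds_unique (hAm k hk x hx hx0) h2]
  bounded_near_zero := by
    obtain ⟨ρ, hρ, C, h⟩ := exists_uniform_bound (ι := Fin (D + 1) × Fin (D + 1))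
      (f := fun i z => A z i.1 i.2) (D := D) fun i => by
        obtain ⟨ρ, hρ, C, h⟩ := (hA i.1).bounded_near_zero
        exact ⟨ρ, hρ, C, fun z hz hzr => h z hz hzr i.2⟩
    exact ⟨ρ, hρ, C, fun z hz hzr i j => h z hz hzr (i, j)⟩
  normalised := hn

/-! ### Products of row solutions with the adjugate -/

theorem differentiableOn_det {m : ℕ} {A : ℂ → Matrix (Fin m) (Fin m) ℂ} {S : Set ℂ}
    (h : ∀ i j, DifferentiableOn ℂ (fun z => A z i j) S) :
    DifferentiableOn ℂ (fun z => (A z).det) S := by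
  simp only [Matrix.det_apply']
  exact DifferentiableOn.fun_sum fun σ _ => (DifferentiableOn.fun_finsetProd fun i _ =>
    h (σ i) i).const_mul _

theorem differentiableOn_adjugate {m : ℕ} {A : ℂ → Matrix (Fin m) (Fin m) ℂ} {S : Set ℂ}
    (h : ∀ i j, DifferentiableOn ℂ (fun z => A z i j) S) (i j : Fin m) :
    DifferentiableOn ℂ (fun z => (A z).adjugate i j) S := by
  simp only [Matrix.adjugate_apply]
  refine differentiableOn_det fun a b => ?_
  by_cases ha : a = j
  · subst ha
    simp only [Matrix.updateRow_self]
    exact differentiableOn_const _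
  · simp only [Matrix.updateRow_ne ha]
    exact h a b

/-- Rows and matrices with bounded entries form a compact set, so boundedness near the origin
carries over to any continuous expression in them. -/
theorem exists_norm_le_of_continuous {m : ℕ} {F : (Fin m → ℂ) × Matrix (Fin m) (Fin m) ℂ → ℂ}
    (hF : Continuous F) (C : ℝ) : ∃ B, ∀ (r : Fin m → ℂ) (M : Matrix (Fin m) (Fin m) ℂ),
      (∀ j, ‖r j‖ ≤ C) → (∀ i j, ‖M i j‖ ≤ C) → ‖F (r, M)‖ ≤ B := by
  have h1 : IsCompact {r : Fin m → ℂ | ∀ j, ‖r j‖ ≤ C} := by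
    convert isCompact_univ_pi fun _ : Fin m => isCompact_closedBall (0 : ℂ) C using 1
    ext r; simp
  have h2 : IsCompact {M : Matrix (Fin m) (Fin m) ℂ | ∀ i j, ‖M i j‖ ≤ C} := by
    have e : {M : Fin m → Fin m → ℂ | ∀ i j, ‖M i j‖ ≤ C}
        = Set.univ.pi fun _ => {r : Fin m → ℂ | ∀ j, ‖r j‖ ≤ C} := by
      ext M; simp
    have h := isCompact_univ_pi fun _ : Fin m => h1
    rw [← e] at h
    exact h
  obtain ⟨B, hB⟩ := (h1.prod h2).exists_bound_of_continuousOn hF.continuousOn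
  exact ⟨B, fun r M hr hM => hB (r, M) ⟨hr, hM⟩⟩

/-- A row solution times the inverse of a solution is entire. -/
theorem IsRowSolution.exists_entire {V : ℝ[X]} {D n : ℕ} {r : ℂ → Fin (D + 1) → ℂ}
    (hr : IsRowSolution V D r) {A : ℂ → Matrix (Fin (D + 1)) (Fin (D + 1)) ℂ}
    (hA : IsEvenSolution V D n A) (hD : 2 ≤ D) (hDe : Even D) (i : Fin (D + 1)) :
    ∃ g : ℂ → ℂ, Differentiable ℂ g ∧
      ∀ z, z ∉ contour D → Matrix.vecMul (r z) (A z).adjugate i = g z := by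
  have hF : Continuous fun p : (Fin (D + 1) → ℂ) × Matrix (Fin (D + 1)) (Fin (D + 1)) ℂ =>
      Matrix.vecMul p.1 p.2.adjugate i :=
    (continuous_apply i).comp (continuous_fst.matrix_vecMul continuous_snd.matrix_adjugate)
  refine exists_entire_of_no_jump hD (f := fun z => Matrix.vecMul (r z) (A z).adjugate i) ?_ ?_ ?_
  · simp only [Matrix.vecMul, dotProduct]
    exact DifferentiableOn.fun_sum fun k _ =>
      (hr.analytic k).mul (differentiableOn_adjugate hA.analytic k i)
  · intro k hk x hx hx0
    obtain ⟨b, h1, h2⟩ := hr.boundary k hk x hx hx0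
    obtain ⟨Ap, Am, -, -, h, hJ⟩ := hA.boundary
    obtain ⟨h3, h4⟩ := h k hk x hx hx0
    have hJx := hJ x ⟨(mem_contour_iff hD).2 ⟨k, hk, hx⟩, hx0⟩
    refine ⟨Matrix.vecMul b (Am x).adjugate i, ?_, ?_⟩
    · have := (hF.tendsto _).comp (h1.prodMk_nhds h3)
      -- The jump meets its own adjugate and leaves `det J = 1`. The adjugate stands in for the
      -- inverse, as invertibility of `A` is only a consequence of this lemma.
      have e : Matrix.vecMul (Matrix.vecMul b (jump V D x)) (Ap x).adjugate i
          = Matrix.vecMul b (Am x).adjugate i := by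
        rw [hJx, Matrix.adjugate_mul_distrib, Matrix.vecMul_vecMul, ← Matrix.mul_assoc,
          Matrix.mul_adjugate, det_jump hD hDe, one_smul, Matrix.one_mul]
      rw [e] at this
      exact this
    · exact (hF.tendsto _).comp (h2.prodMk_nhds h4)
  · obtain ⟨ρ, hρ, C, h⟩ := hr.bounded_near_zero
    obtain ⟨ρ', hρ', C', h'⟩ := hA.bounded_near_zero
    obtain ⟨B, hB⟩ := exists_norm_le_of_continuous hF (max C C')
    refine ⟨min ρ ρ', lt_min hρ hρ', B, fun z hz hzr => hB (r z) (A z) (fun j => ?_) fun a b => ?_⟩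
    · exact (h z hz (hzr.trans_le (min_le_left _ _)) j).trans (le_max_left _ _)
    · exact (h' z hz (hzr.trans_le (min_le_right _ _)) a b).trans (le_max_right _ _)

/-! ### Behaviour at infinity -/

/-- The exponents of the growth matrix. -/
def growthExp (D n : ℕ) (i : Fin (D + 1)) : ℤ :=
  if i = 0 then 2 * (n : ℤ) + D - 1 else if i = 1 then -2 * (n : ℤ) else -1

theorem growth_eq (D n : ℕ) (z : ℂ) :
    growth D n z = Matrix.diagonal fun i => z ^ growthExp D n i := by
  rw [growth]; congr 1; ext i; unfold growthExp; split_ifs <;> rfl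

/-- The exponents add up to zero: `(2n + D - 1) - 2n - (D - 1)`. -/
theorem det_growth {D n : ℕ} (hD : 2 ≤ D) {z : ℂ} (hz : z ≠ 0) : (growth D n z).det = 1 := by
  obtain ⟨d, rfl⟩ : ∃ d, D = d + 1 := ⟨D - 1, by omega⟩
  have h2 : ∀ i : Fin d, i.succ.succ ≠ (1 : Fin (d + 1 + 1)) := fun i h => by
    have := congrArg Fin.val h
    simp at this
  rw [growth_eq, Matrix.det_diagonal, Fin.prod_univ_succ, Fin.prod_univ_succ]
  simp only [growthExp, Fin.succ_ne_zero, if_false, if_true, h2, Fin.succ_zero_eq_one,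
    one_ne_zero]
  rw [Finset.prod_const, Finset.card_univ, Fintype.card_fin, ← zpow_natCast, ← zpow_mul,
    ← zpow_add₀ hz, ← zpow_add₀ hz]
  rw [show (2 * (n : ℤ) + (d + 1 : ℕ) - 1 + (-2 * (n : ℤ) + -1 * (d : ℕ))) = 0 by push_cast; ring,
    zpow_zero]

theorem adjugate_growth {D n : ℕ} (hD : 2 ≤ D) {z : ℂ} (hz : z ≠ 0) :
    (growth D n z).adjugate = Matrix.diagonal fun i => z ^ (-growthExp D n i) := by
  have h1 : growth D n z * (Matrix.diagonal fun i => z ^ (-growthExp D n i)) = 1 := by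
    rw [growth_eq, Matrix.diagonal_mul_diagonal, ← Matrix.diagonal_one]
    congr 1; ext i
    rw [← zpow_add₀ hz, add_neg_cancel, zpow_zero]
  have h2 := congrArg (fun M => (growth D n z).adjugate * M) h1
  simpa only [← Matrix.mul_assoc, Matrix.adjugate_mul, det_growth hD hz, one_smul, Matrix.one_mul,
    Matrix.mul_one] using h2.symm

section infinity

variable {V : ℝ[X]} {D n : ℕ} {A : ℂ → Matrix (Fin (D + 1)) (Fin (D + 1)) ℂ}

theorem tendsto_one_add_of_isBigO_inv {l : Filter ℂ} (hl : l ≤ Bornology.cobounded ℂ)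
    {E : ℂ → Matrix (Fin (D + 1)) (Fin (D + 1)) ℂ}
    (hE : ∀ i j, (fun z => E z i j) =O[l] (fun z : ℂ => z⁻¹)) :
    Tendsto (fun z => 1 + E z) l (𝓝 1) := by
  have : Tendsto E l (𝓝 0) := by
    refine tendsto_pi_nhds.2 fun i => tendsto_pi_nhds.2 fun j => ?_
    exact (hE i j).trans_tendsto (tendsto_inv₀_cobounded.mono_left hl)
  simpa using tendsto_const_nhds.add this

theorem IsEvenSolution.exists_adjugate_eq (hA : IsEvenSolution V D n A) :
    ∃ F G : ℂ → Matrix (Fin (D + 1)) (Fin (D + 1)) ℂ,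
      Tendsto F (Bornology.cobounded ℂ ⊓ 𝓟 (contour D)ᶜ) (𝓝 1) ∧
      Tendsto G (Bornology.cobounded ℂ ⊓ 𝓟 (contour D)ᶜ) (𝓝 1) ∧
      ∀ᶠ z in Bornology.cobounded ℂ ⊓ 𝓟 (contour D)ᶜ, z ≠ 0 ∧ A z = F z * growth D n z ∧
        (A z).adjugate = (growth D n z).adjugate * G z := by
  obtain ⟨E, hE, h⟩ := hA.normalised
  have h1 := tendsto_one_add_of_isBigO_inv inf_le_left hE
  refine ⟨fun z => 1 + E z, fun z => (1 + E z).adjugate, h1, ?_, ?_⟩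
  · have hc : Continuous fun M : Matrix (Fin (D + 1)) (Fin (D + 1)) ℂ => M.adjugate :=
      continuous_id.matrix_adjugate
    have h2 := (hc.tendsto 1).comp h1
    rw [Matrix.adjugate_one] at h2
    exact h2
  · filter_upwards [h, (Bornology.eventually_ne_cobounded (0 : ℂ)).filter_mono inf_le_left]
      with z hz hz0
    exact ⟨hz0, hz, by rw [hz, Matrix.adjugate_mul_distrib]⟩

/-- At infinity the growth matrix meets its adjugate and only factors tending to the identity
remain; the entries are entire, so Liouville applies. -/
theorem IsEvenSolution.mul_adjugate_eq_one {B : ℂ → Matrix (Fin (D + 1)) (Fin (D + 1)) ℂ}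
    (hB : IsEvenSolution V D n B) (hA : IsEvenSolution V D n A) (hD : 2 ≤ D) (hDe : Even D)
    {z : ℂ} (hz : z ∉ contour D) : B z * (A z).adjugate = 1 := by
  obtain ⟨F, _, hF, _, h1⟩ := hB.exists_adjugate_eq
  obtain ⟨_, G, _, hG, h2⟩ := hA.exists_adjugate_eq
  have hlim : Tendsto (fun z => B z * (A z).adjugate)
      (Bornology.cobounded ℂ ⊓ 𝓟 (contour D)ᶜ) (𝓝 1) := by
    have := hF.mul hG
    rw [Matrix.one_mul] at this
    refine this.congr' ?_
    filter_upwards [h1, h2] with w hw1 hw2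
    rw [hw1.2.1, hw2.2.2, Matrix.mul_assoc, ← Matrix.mul_assoc (growth D n w), Matrix.mul_adjugate,
      det_growth hD hw1.1, one_smul, Matrix.one_mul]
  ext i j
  obtain ⟨g, hg, hgz⟩ := (hB.isRowSolution hD i).exists_entire hA hD hDe j
  have e : ∀ w, w ∉ contour D → (B w * (A w).adjugate) i j = g w := fun w hw => hgz w hw
  rw [e z hz]
  refine eq_const_of_tendsto_cobounded_inf hg (dense_compl_contour hD) ?_ z
  refine (tendsto_pi_nhds.1 (tendsto_pi_nhds.1 hlim i) j).congr' ?_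
  rw [EventuallyEq, eventually_inf_principal]
  exact Eventually.of_forall fun w hw => e w hw

theorem IsEvenSolution.det_eq_one (hA : IsEvenSolution V D n A) (hD : 2 ≤ D) (hDe : Even D)
    {z : ℂ} (hz : z ∉ contour D) : (A z).det = 1 := by
  -- With both solutions equal, the product with the adjugate is `det A` times the identity.
  have h := hA.mul_adjugate_eq_one hA hD hDe hz
  rw [Matrix.mul_adjugate] at h
  have := congrFun (congrFun h 0) 0
  simpa using this

theorem IsEvenSolution.inv_eq_adjugate (hA : IsEvenSolution V D n A) (hD : 2 ≤ D) (hDe : Even D)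
    {z : ℂ} (hz : z ∉ contour D) : (A z)⁻¹ = (A z).adjugate := by
  rw [Matrix.inv_def, hA.det_eq_one hD hDe hz, Ring.inverse_one, one_smul]

theorem IsEvenSolution.unique {B : ℂ → Matrix (Fin (D + 1)) (Fin (D + 1)) ℂ}
    (hA : IsEvenSolution V D n A) (hB : IsEvenSolution V D n B) (hD : 2 ≤ D) (hDe : Even D)
    {z : ℂ} (hz : z ∉ contour D) : A z = B z := by
  have h := hA.mul_adjugate_eq_one hB hD hDe hz
  have h2 := congrArg (fun M => M * B z) h
  simpa only [Matrix.mul_assoc, Matrix.adjugate_mul, hB.det_eq_one hD hDe hz, one_smul,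
    Matrix.mul_one, Matrix.one_mul] using h2

end infinity

/-! ### Existence of the solution -/

section existence

variable {V : ℝ[X]} {D : ℕ}

theorem two_pi_I_ne_zero : (2 * Real.pi * Complex.I : ℂ) ≠ 0 := Complex.two_pi_I_ne_zero

/-- The polynomial in the first column of the `i`-th row. -/
theorem exists_row_polynomial (hU : IsPotential D (toC V)) (hD : 2 ≤ D) (hDe : Even D) (n : ℕ)
    (i : Fin (D + 1)) : ∃ p : ℂ[X],
      (p - if i = 0 then X ^ (2 * n + (D - 1)) else 0).degree < ((2 * n + (D - 1) : ℕ) : WithBot ℕ) ∧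
      (∀ m < 2 * n, arcMoment hU.two_mul hD (D / 2) (X ^ m * p)
        = if i = 1 ∧ m + 1 = 2 * n then -(2 * Real.pi * Complex.I) else 0) ∧
      ∀ j, 1 ≤ j → j < D → arcMoment hU hD j p
        = if (i : ℕ) = j + 1 then -(2 * Real.pi * Complex.I) else 0 := by
  -- Only the row of index 0 has a leading term prescribed; its moments are moved to the right-hand
  -- side. The values `-2πi` will cancel the factor `(2πi)⁻¹` of the Cauchy transform, up to the
  -- sign in its expansion at infinity.
  set base : ℂ[X] := if i = 0 then X ^ (2 * n + (D - 1)) else 0 with hbase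
  obtain ⟨q, hq, h1, h2⟩ := exists_moments hU hD hDe n
    (fun m => (if i = 1 ∧ m + 1 = 2 * n then -(2 * Real.pi * Complex.I) else 0)
      - arcMoment hU.two_mul hD (D / 2) (X ^ m * base))
    (fun j => (if (i : ℕ) = j + 1 then -(2 * Real.pi * Complex.I) else 0) - arcMoment hU hD j base)
  refine ⟨q + base, by rwa [add_sub_cancel_right], fun m hm => ?_, fun j hj0 hj => ?_⟩
  · rw [mul_add, map_add, h1 m hm, sub_add_cancel]
  · rw [map_add, h2 j hj0 hj, sub_add_cancel]

theorem isBigO_inv_of_degree_lt {q : ℂ[X]} {M : ℕ} (hM : 1 ≤ M) (hq : q.degree < (M : ℕ)) :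
    (fun z => q.eval z * (z ^ M)⁻¹) =O[Bornology.cobounded ℂ] fun z => z⁻¹ := by
  obtain ⟨N, rfl⟩ : ∃ N, M = N + 1 := ⟨M - 1, by omega⟩
  have hN : q.natDegree ≤ N := by
    rcases eq_or_ne q 0 with rfl | h0
    · simp
    · exact Nat.lt_succ_iff.1 ((natDegree_lt_iff_degree_lt h0).2 hq)
  obtain ⟨B, hB, h⟩ := exists_norm_eval_le q hN
  refine Asymptotics.IsBigO.of_bound (B * 2 ^ N) ?_
  filter_upwards [tendsto_norm_cobounded_atTop.eventually_ge_atTop 1] with z hz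
  have hz0 : ‖z‖ ≠ 0 := by linarith
  rw [norm_mul, norm_inv, norm_inv, norm_pow, pow_succ, mul_inv, ← mul_assoc]
  refine mul_le_mul_of_nonneg_right ?_ (by positivity)
  calc ‖q.eval z‖ * (‖z‖ ^ N)⁻¹ ≤ (B * (2 * ‖z‖) ^ N) * (‖z‖ ^ N)⁻¹ := by
        refine mul_le_mul_of_nonneg_right ((h z).trans ?_) (by positivity)
        exact mul_le_mul_of_nonneg_left (pow_le_pow_left₀ (by positivity) (by linarith) _) hB
    _ = B * 2 ^ N := by rw [mul_pow]; field_simp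

theorem exists_isEvenSolution (hU : IsPotential D (toC V)) (hD : 2 ≤ D) (hDe : Even D) (n : ℕ) :
    ∃ A, IsEvenSolution V D n A := by
  choose p hp1 hp2 hp3 using exists_row_polynomial hU hD hDe n
  let A : ℂ → Matrix (Fin (D + 1)) (Fin (D + 1)) ℂ := fun z i =>
    -- For `n = 0` the diagonal entry in column 1 must tend to 1, which a decaying Cauchy transform
    -- cannot do; a constant row takes its place.
    if n = 0 ∧ i = 1 then Pi.single 1 1 else cauchyRow V D (p i) z
  have h10 := one_ne_zero_fin hD
  set L := Bornology.cobounded ℂ ⊓ 𝓟 (contour D)ᶜ with hL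
  have hne : ∀ᶠ z in L, z ≠ 0 :=
    (Bornology.eventually_ne_cobounded (0 : ℂ)).filter_mono inf_le_left
  have hmem : ∀ᶠ z in L, z ∉ contour D := by
    rw [hL, eventually_inf_principal]; exact Eventually.of_forall fun z hz => hz
  refine ⟨A, isEvenSolution_of_rows hD (fun i => ?_) ⟨fun z => Matrix.of fun i j =>
    A z i j * z ^ (-growthExp D n j) - (1 : Matrix (Fin (D + 1)) (Fin (D + 1)) ℂ) i j,
    fun i j => ?_, ?_⟩⟩
  · by_cases hi : n = 0 ∧ i = 1
    · simp only [A, if_pos hi]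
      exact isRowSolution_single hD hDe h10
    · simp only [A, if_neg hi]
      exact isRowSolution_cauchyRow hU hD hDe (p i)
  · simp only [Matrix.of_apply]
    by_cases hi : n = 0 ∧ i = 1
    · have e : ∀ z, A z i j * z ^ (-growthExp D n j)
          - (1 : Matrix (Fin (D + 1)) (Fin (D + 1)) ℂ) i j = 0 := fun z => by
        simp only [A, if_pos hi]
        obtain ⟨rfl, rfl⟩ := hi
        by_cases hj : j = 1
        · subst hj
          simp [growthExp, h10]
        · rw [Pi.single_eq_of_ne hj, Matrix.one_apply_ne (Ne.symm hj)]; simp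
      simp only [e]
      exact Asymptotics.isBigO_zero _ _
    · simp only [A, if_neg hi]
      by_cases hj0 : j = 0
      · subst hj0
        have h1 := (isBigO_inv_of_degree_lt (M := 2 * n + (D - 1)) (by omega) (hp1 i)).mono
          (inf_le_left : L ≤ _)
        refine h1.congr' ?_ EventuallyEq.rfl
        filter_upwards [hne] with z hz
        have e : growthExp D n 0 = ((2 * n + (D - 1) : ℕ) : ℤ) := by
          simp only [growthExp, if_true]; push_cast [Nat.cast_sub (by omega : 1 ≤ D)]; ring
        rw [e, zpow_neg, zpow_natCast, cauchyRow, if_pos rfl, eval_sub, sub_mul, Matrix.one_apply]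
        split_ifs with h
        · rw [eval_pow, eval_X, mul_inv_cancel₀ (pow_ne_zero _ hz)]
        · rw [eval_zero, zero_mul]
      · by_cases hj1 : j = 1
        · subst hj1
          refine (arcCauchy_isBigO_inv hU.two_mul hD (j := D / 2) (by omega)
            (X ^ (2 * n) * p i)).congr' ?_ EventuallyEq.rfl
          filter_upwards [hmem, hne] with z hz hz0
          have e1 : growthExp D n 1 = -((2 * n : ℕ) : ℤ) := by
            simp only [growthExp, if_neg h10, if_true]; push_cast; ring
          rw [e1, neg_neg, zpow_natCast, cauchyRow, if_neg h10, colArc, if_pos rfl, colPot,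
            if_pos rfl]
          rcases Nat.eq_zero_or_pos n with rfl | hn
          · have hi1 : i ≠ 1 := fun h => hi ⟨rfl, h⟩
            rw [Matrix.one_apply_ne hi1]; simp
          · obtain ⟨N, hN⟩ : ∃ N, 2 * n = N + 1 := ⟨2 * n - 1, by omega⟩
            rw [arcCauchy_eq_pow hU.two_mul hD (by omega) (p i) hz N (fun m hm => by
                rw [hp2 i m (by omega), if_neg (by omega)]),
              arcCauchy_eq hU.two_mul hD (by omega) (X ^ N * p i) hz, hp2 i N (by omega), hN, Matrix.one_apply,
              pow_succ X, mul_comm (X ^ N) X, mul_assoc X, inv_pow]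
            have h2 := two_pi_I_ne_zero
            have hpi : (Real.pi : ℂ) ≠ 0 := by exact_mod_cast Real.pi_ne_zero
            by_cases hi1 : i = 1
            · rw [if_pos ⟨hi1, rfl⟩, if_pos hi1]
              field_simp
              ring
            · rw [if_neg (fun h => hi1 h.1), if_neg hi1]
              field_simp
              ring
        · have hjv : (j : ℕ) ≠ 1 := fun h => hj1 ((fin_eq_one_iff hD j).2 h)
          have hjv0 : (j : ℕ) ≠ 0 := fun h => hj0 (Fin.ext h)
          have hj2 := j.2
          refine (arcCauchy_isBigO_inv hU hD (j := (j : ℕ) - 1) (by omega)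
            (X * p i)).congr' ?_ EventuallyEq.rfl
          filter_upwards [hmem, hne] with z hz hz0
          have e1 : growthExp D n j = -1 := by simp only [growthExp, if_neg hj0, if_neg hj1]
          rw [e1, neg_neg, zpow_one, cauchyRow, if_neg hj0, colArc, if_neg hj1, colPot,
            if_neg hj1, arcCauchy_eq hU hD (by omega) (p i) hz, hp3 i _ (by omega) (by omega),
            Matrix.one_apply]
          have h2 := two_pi_I_ne_zero
          have hpi : (Real.pi : ℂ) ≠ 0 := by exact_mod_cast Real.pi_ne_zero
          by_cases hij : i = j
          · rw [if_pos (by rw [hij]; omega), if_pos hij]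
            field_simp
            ring
          · rw [if_neg (fun h => hij (Fin.ext (by omega))), if_neg hij]
            field_simp
            ring
  · filter_upwards [hne] with z hz
    ext i j
    rw [growth_eq, Matrix.mul_diagonal]
    simp only [Matrix.add_apply, Matrix.of_apply, add_sub_cancel]
    rw [mul_assoc, ← zpow_add₀ hz, neg_add_cancel, zpow_zero, mul_one]

end existence

/-! ### The Christoffel-Darboux formula -/

/-! ### The Cauchy transform at a point as a linear functional. -/

section linear

variable {D j : ℕ} {U : ℂ[X]}

theorem rayCauchy_add (hU : IsPotential D U) (hD : 2 ≤ D) (k : ℕ) (p q : ℂ[X]) {z : ℂ}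
    (hz : z ∉ ray D k) : rayCauchy D k (weighted U (p + q)) z
      = rayCauchy D k (weighted U p) z + rayCauchy D k (weighted U q) z := by
  have hz' : z / dir D k ∉ halfAxis := fun h => hz (div_dir_mem_halfAxis_iff.1 h)
  have hi : ∀ p, IntegrableOn (fun t : ℝ => weighted U p (t * dir D k) / (t - z / dir D k))
      (Set.Ioi 0) := fun p =>
    integrableOn_halfCauchy (f := fun u => weighted U p (u * dir D k)) (hU.stripDecay hD k p)
      ((continuous_weighted U p).comp (continuous_id.mul continuous_const)) hz'
  rw [rayCauchy, rayCauchy, rayCauchy, halfCauchy, halfCauchy, halfCauchy,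
    ← integral_add (hi p) (hi q)]
  congr 1; ext t
  simp only [weighted, eval_add]; ring

theorem rayCauchy_smul (k : ℕ) (c : ℂ) (p : ℂ[X]) (z : ℂ) :
    rayCauchy D k (weighted U (c • p)) z = c * rayCauchy D k (weighted U p) z := by
  rw [rayCauchy, rayCauchy, halfCauchy, halfCauchy, ← integral_const_mul]
  congr 1; ext t
  simp only [weighted, eval_smul, smul_eq_mul]; ring

/-- The Cauchy transform over an arc, at a fixed point, as a linear functional on polynomials. -/
def arcCauchyLinear (hU : IsPotential D U) (hD : 2 ≤ D) (hj : j < D) {z : ℂ}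
    (hz : z ∉ contour D) : ℂ[X] →ₗ[ℂ] ℂ where
  toFun p := arcCauchy D j (weighted U p) z
  map_add' p q := by
    rw [arcCauchy, arcCauchy, arcCauchy,
      rayCauchy_add hU hD 0 p q (notMem_ray_of_notMem_contour hD (by omega) hz),
      rayCauchy_add hU hD j p q (notMem_ray_of_notMem_contour hD hj hz)]
    ring
  map_smul' c p := by
    rw [arcCauchy, arcCauchy, rayCauchy_smul, rayCauchy_smul, RingHom.id_apply, smul_eq_mul]
    ring

theorem arcCauchyLinear_apply (hU : IsPotential D U) (hD : 2 ≤ D) (hj : j < D) {z : ℂ}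
    (hz : z ∉ contour D) (p : ℂ[X]) :
    arcCauchyLinear hU hD hj hz p = arcCauchy D j (weighted U p) z := rfl

theorem arcCauchyLinear_X_mul (hU : IsPotential D U) (hD : 2 ≤ D) (hj : j < D) {z : ℂ}
    (hz : z ∉ contour D) (p : ℂ[X]) :
    arcCauchyLinear hU hD hj hz (X * p)
      = z * arcCauchyLinear hU hD hj hz p + (2 * Real.pi * Complex.I)⁻¹ * arcMoment hU hD j p := by
  have h := arcCauchy_eq hU hD hj p hz
  rw [eq_inv_mul_iff_mul_eq₀ (ne_zero_of_notMem_contour hD hz)] at h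
  rw [arcCauchyLinear_apply, arcCauchyLinear_apply, h, sub_add_cancel]

/-- Multiplication by a polynomial commutes with the Cauchy transform up to a polynomial. -/
theorem exists_polynomial_arcCauchyLinear_mul (hU : IsPotential D U) (hD : 2 ≤ D) (hj : j < D)
    (p b : ℂ[X]) : ∃ S : ℂ[X], ∀ z (hz : z ∉ contour D),
      b.eval z * arcCauchyLinear hU hD hj hz p - arcCauchyLinear hU hD hj hz (b * p)
        = S.eval z := by
  induction b using Polynomial.induction_on with
  | C a =>
    refine ⟨0, fun z hz => ?_⟩
    rw [← smul_eq_C_mul, map_smul, eval_C, smul_eq_mul, sub_self, eval_zero]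
  | add b b' h h' =>
    obtain ⟨S, hS⟩ := h
    obtain ⟨S', hS'⟩ := h'
    refine ⟨S + S', fun z hz => ?_⟩
    rw [eval_add, eval_add, add_mul, add_mul, map_add, ← hS z hz, ← hS' z hz]
    ring
  | monomial m a h =>
    obtain ⟨S, hS⟩ := h
    refine ⟨X * S - C ((2 * Real.pi * Complex.I)⁻¹ * arcMoment hU hD j (C a * X ^ m * p)),
      fun z hz => ?_⟩
    have e : C a * X ^ (m + 1) * p = X * (C a * X ^ m * p) := by ring
    rw [e, arcCauchyLinear_X_mul, eval_sub (p := X * S), eval_mul (p := X), ← hS z hz]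
    simp only [eval_mul, eval_C, eval_pow, eval_X]
    ring

end linear

/-! ### The polynomial row of the inverse and its reproducing kernel. -/

section formula

variable {V : ℝ[X]} {D n : ℕ} {A : ℂ → Matrix (Fin (D + 1)) (Fin (D + 1)) ℂ}

/-- The second row of the inverse of the solution consists of polynomials. -/
theorem IsEvenSolution.exists_adjugate_row (hA : IsEvenSolution V D n A) (hD : 2 ≤ D)
    (hDe : Even D) (k : Fin (D + 1)) : ∃ b : ℂ[X], b.natDegree ≤ 2 * n ∧
      ∀ z, z ∉ contour D → (A z).adjugate 1 k = b.eval z := by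
  obtain ⟨g, hg, h⟩ := (isRowSolution_single (V := V) hD hDe (one_ne_zero_fin hD)).exists_entire
    hA hD hDe k
  have h' : ∀ z, z ∉ contour D → (A z).adjugate 1 k = g z := fun z hz => by
    rw [← h z hz]; simp [Matrix.vecMul, Pi.single_apply, dotProduct]
  obtain ⟨_, G, _, hG, h2⟩ := hA.exists_adjugate_eq
  have hmem : ∀ᶠ z in Bornology.cobounded ℂ ⊓ 𝓟 (contour D)ᶜ, z ∉ contour D := by
    rw [eventually_inf_principal]; exact Eventually.of_forall fun z hz => hz
  have hGk : Tendsto (fun z => G z 1 k) (Bornology.cobounded ℂ ⊓ 𝓟 (contour D)ᶜ)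
      (𝓝 ((1 : Matrix (Fin (D + 1)) (Fin (D + 1)) ℂ) 1 k)) :=
    (tendsto_pi_nhds.1 (tendsto_pi_nhds.1 hG 1) k)
  -- The row of index 1 in the adjugate of the growth matrix carries the power `z^{2n}`.
  have hO : g =O[Bornology.cobounded ℂ ⊓ 𝓟 (contour D)ᶜ] fun z => z ^ (2 * n) := by
    have := (Asymptotics.isBigO_refl (fun z : ℂ => z ^ (2 * n)) _).mul (hGk.isBigO_one ℂ)
    refine this.congr' ?_ (Eventually.of_forall fun z => by simp)
    filter_upwards [h2, hmem] with z ⟨hz0, _, hz2⟩ hz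
    rw [← h' z hz, hz2, adjugate_growth hD hz0, Matrix.diagonal_mul]
    congr 1
    simp only [growthExp, if_neg (one_ne_zero_fin hD), if_true]
    rw [← zpow_natCast]; congr 1; push_cast; ring
  obtain ⟨b, hb, hbe⟩ := exists_polynomial_of_isBigO_cobounded_inf (dense_compl_contour hD) _ hg hO
  exact ⟨b, hb, fun z hz => by rw [h' z hz, hbe]⟩

theorem degree_twist_lt (hU : IsPotential D (toC V)) (hD : 2 ≤ D) {q : ℂ[X]} {N : ℕ}
    (hq : q.degree < (N : ℕ)) :
    (twist (toC V) q).degree < ((N + (D - 1) : ℕ) : WithBot ℕ) := by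
  rcases eq_or_ne q 0 with rfl | h0
  · simp [twist]
  have hN : q.natDegree < N := (natDegree_lt_iff_degree_lt h0).2 hq
  have h1 : (twist (toC V) q).natDegree < N + (D - 1) := by
    refine (natDegree_sub_le _ _).trans_lt (max_lt ?_ ?_)
    · exact (natDegree_derivative_le q).trans_lt (by omega)
    · refine natDegree_mul_le.trans_lt ?_
      have := natDegree_derivative_eq_pred hU.natDegree_eq
      omega
  exact degree_le_natDegree.trans_lt (by exact_mod_cast h1)

/-- The row with first entry `q' - V'q` is carried by the inverse of the solution to a row of
Cauchy transforms. -/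
theorem IsEvenSolution.vecMul_cauchyRow_twist (hA : IsEvenSolution V D n A)
    (hU : IsPotential D (toC V)) (hD : 2 ≤ D) (hDe : Even D) {q : ℂ[X]}
    (hq : q.degree < (2 * n : ℕ)) (k : Fin (D + 1)) {b : ℂ[X]}
    (hb : ∀ z, z ∉ contour D → (A z).adjugate 1 k = b.eval z) {z : ℂ} (hz : z ∉ contour D) :
    Matrix.vecMul (cauchyRow V D (twist (toC V) q) z) (A z).adjugate k
      = b.eval z * arcCauchy D (D / 2) (weighted (C 2 * toC V) (twist (toC V) q)) z
        - arcCauchy D (D / 2) (weighted (C 2 * toC V) (b * twist (toC V) q)) z := by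
  set p := twist (toC V) q with hp
  have hj : D / 2 < D := by omega
  set L := Bornology.cobounded ℂ ⊓ 𝓟 (contour D)ᶜ with hL
  have hmem : ∀ᶠ z in L, z ∉ contour D := by
    rw [hL, eventually_inf_principal]; exact Eventually.of_forall fun z hz => hz
  have hinv : Tendsto (fun z : ℂ => z⁻¹) L (𝓝 0) := tendsto_inv₀_cobounded.mono_left inf_le_left
  obtain ⟨g, hg, h⟩ := (isRowSolution_cauchyRow hU hD hDe p).exists_entire hA hD hDe k
  obtain ⟨S, hS⟩ := exists_polynomial_arcCauchyLinear_mul hU.two_mul hD hj p b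
  simp only [arcCauchyLinear_apply] at hS
  obtain ⟨_, G, _, hG, h2⟩ := hA.exists_adjugate_eq
  -- Outside column 1 the row is negligible against the growth matrix: the polynomial has too low a
  -- degree, and in the other columns the leading moment vanishes, since `p e^{-V}` is a derivative.
  have hr : ∀ i, i ≠ 1 → Tendsto (fun z => cauchyRow V D p z i * z ^ (-growthExp D n i)) L
      (𝓝 0) := fun i hi => by
    by_cases hi0 : i = 0
    · subst hi0
      refine ((isBigO_inv_of_degree_lt (M := 2 * n + (D - 1)) (by omega)
        (degree_twist_lt hU hD hq)).mono (inf_le_left : L ≤ _)).trans_tendsto hinv |>.congr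
          fun z => ?_
      have e : growthExp D n 0 = ((2 * n + (D - 1) : ℕ) : ℤ) := by
        simp only [growthExp, if_true]; push_cast [Nat.cast_sub (by omega : 1 ≤ D)]; ring
      rw [e, zpow_neg, zpow_natCast, cauchyRow, if_pos rfl]
    · have hi2 := colArc_mem hD hi0
      refine ((arcCauchy_isBigO_inv hU hD hi2.2 (X * p)).trans_tendsto hinv).congr' ?_
      filter_upwards [hmem] with z hz
      have e1 : growthExp D n i = -1 := by simp only [growthExp, if_neg hi0, if_neg hi]
      rw [e1, neg_neg, zpow_one, cauchyRow, if_neg hi0, colPot, if_neg hi,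
        arcCauchy_eq hU hD hi2.2 p hz, hp, arcMoment_twist, mul_zero, sub_zero, mul_right_comm,
        inv_mul_cancel₀ (ne_zero_of_notMem_contour hD hz), one_mul]
  -- Column 1 contributes `b` times the transform of `p`, which is the polynomial `S` plus the
  -- decaying transform of `b * p`. Hence the entire function minus `S` tends to zero.
  have hlim : Tendsto (fun z => g z - S.eval z) L (𝓝 0) := by
    have h3 : Tendsto (fun z => ∑ i ∈ Finset.univ.erase (1 : Fin (D + 1)),
        cauchyRow V D p z i * z ^ (-growthExp D n i) * G z i k
          + arcCauchy D (D / 2) (weighted (C 2 * toC V) (b * p)) z) L (𝓝 0) := by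
      have h4 := tendsto_finsetSum (Finset.univ.erase (1 : Fin (D + 1))) fun i hi =>
        (hr i (Finset.ne_of_mem_erase hi)).mul (tendsto_pi_nhds.1 (tendsto_pi_nhds.1 hG i) k)
      have h5 := h4.add ((arcCauchy_isBigO_inv hU.two_mul hD hj (b * p)).trans_tendsto hinv)
      simpa using h5
    refine h3.congr' ?_
    filter_upwards [hmem, h2] with z hz ⟨hz0, _, hz2⟩
    rw [← h z hz, ← hS z hz, Matrix.vecMul, dotProduct,
      ← Finset.add_sum_erase _ _ (Finset.mem_univ (1 : Fin (D + 1))), hb z hz]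
    have e : cauchyRow V D p z 1 = arcCauchy D (D / 2) (weighted (C 2 * toC V) p) z := by
      rw [cauchyRow, if_neg (one_ne_zero_fin hD), colArc, colPot, if_pos rfl, if_pos rfl]
    rw [e, hz2, adjugate_growth hD hz0]
    simp only [Matrix.diagonal_mul, ← mul_assoc]
    ring
  have := eq_const_of_tendsto_cobounded_inf (hg.sub S.differentiable) (dense_compl_contour hD)
    hlim z
  rw [h z hz, hS z hz]
  exact sub_eq_zero.1 this

/-- For each `y` off the contour, `(A⁻¹(x) A(y))₂₁ / (x - y)` is a polynomial in `x` which
reproduces `q ↦ q' - V'q` at `y` up to a factor. -/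
theorem IsEvenSolution.exists_kernel (hA : IsEvenSolution V D n A) (hU : IsPotential D (toC V))
    (hD : 2 ≤ D) (hDe : Even D) {y : ℂ} (hy : y ∉ contour D) :
    ∃ K : ℂ[X], K.degree < (2 * n : ℕ) ∧
      (∀ x, x ∉ contour D → ((A x)⁻¹ * A y) 1 0 = (x - y) * K.eval x) ∧
      ∀ q : ℂ[X], q.degree < (2 * n : ℕ) →
        cskew hU hD K q = -(2 * Real.pi * Complex.I) * (twist (toC V) q).eval y := by
  choose b hb1 hb2 using hA.exists_adjugate_row hD hDe
  -- For fixed `y` this is `(A⁻¹(x) A(y))₂₁` as a polynomial in `x`. It vanishes at `x = y` because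
  -- an off-diagonal entry of the identity does.
  set F : ℂ[X] := ∑ k, A y k 0 • b k with hF
  have hFe : ∀ x, x ∉ contour D → ((A x)⁻¹ * A y) 1 0 = F.eval x := fun x hx => by
    rw [hA.inv_eq_adjugate hD hDe hx, Matrix.mul_apply, hF, eval_finsetSum]
    refine Finset.sum_congr rfl fun k _ => ?_
    rw [hb2 k x hx, eval_smul, smul_eq_mul, mul_comm]
  have hadj : (A y).adjugate * A y = 1 := by
    rw [Matrix.adjugate_mul, hA.det_eq_one hD hDe hy, one_smul]
  have hFy : F.eval y = 0 := by
    rw [← hFe y hy, hA.inv_eq_adjugate hD hDe hy, hadj, Matrix.one_apply_ne (one_ne_zero_fin hD)]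
  obtain ⟨K, hK⟩ := dvd_iff_isRoot.2 hFy
  have hFdeg : F.natDegree ≤ 2 * n := natDegree_sum_le_of_forall_le _ _ fun k _ =>
    (natDegree_smul_le _ _).trans (hb1 k)
  refine ⟨K, ?_, fun x hx => by rw [hFe x hx, hK, eval_mul, eval_sub, eval_X, eval_C],
    fun q hq => ?_⟩
  · rcases eq_or_ne K 0 with rfl | h0
    · rw [degree_zero]; exact WithBot.bot_lt_coe _
    · rw [← natDegree_lt_iff_degree_lt h0]
      have := congrArg natDegree hK
      rw [natDegree_mul (X_sub_C_ne_zero y) h0, natDegree_X_sub_C] at this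
      omega
  · set p := twist (toC V) q with hp
    have hj : D / 2 < D := by omega
    let T := arcCauchyLinear hU.two_mul hD hj hy
    have hT : ∀ f, T f = arcCauchy D (D / 2) (weighted (C 2 * toC V) f) y := fun _ => rfl
    -- The row times `A⁻¹ A` at the point `y` is evaluated twice: directly, and through the Cauchy
    -- transforms of the preceding lemma.
    have h1 : Matrix.vecMul (Matrix.vecMul (cauchyRow V D p y) (A y).adjugate) (A y) 0
        = p.eval y := by
      rw [Matrix.vecMul_vecMul, hadj, Matrix.vecMul_one, cauchyRow, if_pos rfl]
    have h2 : Matrix.vecMul (Matrix.vecMul (cauchyRow V D p y) (A y).adjugate) (A y) 0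
        = F.eval y * T p - T (F * p) := by
      rw [Matrix.vecMul, dotProduct, hF, eval_finsetSum, Finset.sum_mul, Finset.sum_mul, map_sum,
        ← Finset.sum_sub_distrib]
      refine Finset.sum_congr rfl fun k _ => ?_
      rw [hA.vecMul_cauchyRow_twist hU hD hDe hq k (hb2 k) hy, smul_mul_assoc, map_smul, hT, hT,
        eval_smul, smul_eq_mul, smul_eq_mul]
      ring
    -- The factor `X - y` of `F` cancels the Cauchy denominator at `y` and leaves a plain integral.
    have h3 : T (F * p) = (2 * Real.pi * Complex.I)⁻¹ * cskew hU hD K q := by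
      have e : F * p = X * (K * p) - y • (K * p) := by rw [hK, smul_eq_C_mul]; ring
      rw [e, map_sub, map_smul, arcCauchyLinear_X_mul, smul_eq_mul, cskew]
      ring
    rw [h1, hFy, h3] at h2
    have := two_pi_I_ne_zero
    rw [h2]
    field_simp
    ring

end formula

/-! ### Comparison with the pre-kernel. -/

section kernel

variable {V : ℝ[X]} {D n : ℕ} {A : ℂ → Matrix (Fin (D + 1)) (Fin (D + 1)) ℂ} {P : ℕ → ℝ[X]}

/-- The polynomial `x ↦ e^{V(x) + V(y)} S_n(x, y)`. -/
def kernelPoly (V : ℝ[X]) (P : ℕ → ℝ[X]) (n : ℕ) (y : ℂ) : ℂ[X] :=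
  ∑ k ∈ Finset.range n, (2 * (skewNorm V P k : ℂ))⁻¹ •
    ((twist (toC V) (toC (P (2 * k + 1)))).eval y • toC (P (2 * k))
      - (twist (toC V) (toC (P (2 * k)))).eval y • toC (P (2 * k + 1)))

theorem deriv_aeval_mul_exp (V P : ℝ[X]) (y : ℂ) :
    deriv (fun t : ℂ => aeval t P * Complex.exp (-aeval t V)) y
      = (twist (toC V) (toC P)).eval y * Complex.exp (-aeval y V) := by
  have e : (fun t : ℂ => aeval t P * Complex.exp (-aeval t V)) = weighted (toC V) (toC P) := by
    funext t; simp only [aeval_eq_eval_toC, weighted]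
  rw [e, deriv_weighted, weighted, aeval_eq_eval_toC]

theorem preKernelC_eq (V : ℝ[X]) (P : ℕ → ℝ[X]) (n : ℕ) (x y : ℂ) :
    preKernelC V P n x y
      = Complex.exp (-aeval x V - aeval y V) * (kernelPoly V P n y).eval x := by
  rw [preKernelC, kernelPoly, eval_finsetSum, Finset.mul_sum]
  refine Finset.sum_congr rfl fun k _ => ?_
  rw [deriv_aeval_mul_exp, deriv_aeval_mul_exp, sub_eq_add_neg (-aeval x V), Complex.exp_add]
  simp only [eval_smul, eval_sub, smul_eq_mul, aeval_eq_eval_toC]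
  ring

theorem continuous_preKernelC (V : ℝ[X]) (P : ℕ → ℝ[X]) (n : ℕ) :
    Continuous fun p : ℂ × ℂ => preKernelC V P n p.1 p.2 := by
  have h : ∀ (Q : ℝ[X]), Continuous fun z : ℂ => aeval z Q := fun Q => Q.continuous_aeval
  have h1 := fun Q => (h Q).comp (continuous_fst (X := ℂ) (Y := ℂ))
  have h2 := fun Q => (h Q).comp (continuous_snd (X := ℂ) (Y := ℂ))
  have h3 : ∀ Q : ℂ[X], Continuous fun p : ℂ × ℂ => Q.eval p.2 := fun Q =>
    Q.continuous.comp continuous_snd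
  simp only [Function.comp_def] at h1 h2
  simp only [preKernelC, deriv_aeval_mul_exp]
  refine continuous_finsetSum _ fun k _ => Continuous.div_const (Continuous.sub ?_ ?_) _
  · exact ((h1 _).mul (h1 _).neg.cexp).mul ((h3 _).mul (h2 _).neg.cexp)
  · exact ((h1 _).mul (h1 _).neg.cexp).mul ((h3 _).mul (h2 _).neg.cexp)

theorem ofReal_preKernel (V : ℝ[X]) (P : ℕ → ℝ[X]) (n : ℕ) (x y : ℝ) :
    (preKernel V P n x y : ℂ) = preKernelC V P n x y := by
  have ha : ∀ (Q : ℝ[X]) (t : ℝ), aeval (t : ℂ) Q = ((Q.eval t : ℝ) : ℂ) := fun Q t => by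
    rw [aeval_eq_eval_toC, eval_toC_ofReal]
  have hdv : ∀ Q : ℝ[X], derivative (toC Q) = toC (derivative Q) := fun Q => derivative_map Q _
  have hd : ∀ Q : ℝ[X], deriv (fun t : ℂ => aeval t Q * Complex.exp (-aeval t V)) y
      = ((deriv (fun t : ℝ => Q.eval t * Real.exp (-V.eval t)) y : ℝ) : ℂ) := fun Q => by
    have h1 := (Q.hasDerivAt y).mul ((V.hasDerivAt y).fun_neg.exp)
    have h2 : deriv (fun t : ℝ => Q.eval t * Real.exp (-V.eval t)) y = _ := h1.deriv
    rw [h2, deriv_aeval_mul_exp, ha, twist, eval_sub, eval_mul, hdv, hdv, eval_toC_ofReal, eval_toC_ofReal, eval_toC_ofReal]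
    push_cast; ring
  rw [preKernel, preKernelC]
  simp only [hd, ha]
  push_cast
  rfl

theorem sum_range_two_mul {M : Type*} [AddCommMonoid M] (f : ℕ → M) (n : ℕ) :
    ∑ j ∈ Finset.range (2 * n), f j = ∑ k ∈ Finset.range n, (f (2 * k) + f (2 * k + 1)) := by
  induction n with
  | zero => simp
  | succ n ih => rw [mul_add, mul_one, Finset.sum_range_succ, Finset.sum_range_succ,
      Finset.sum_range_succ, ih, add_assoc]

theorem IsSkewOrthogonal.degree_kernelPoly_lt (hP : IsSkewOrthogonal V P) (n : ℕ) (y : ℂ) :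
    (kernelPoly V P n y).degree < ((2 * n : ℕ) : WithBot ℕ) := by
  have hdeg : ∀ m < 2 * n, toC (P m) ∈ degreeLT ℂ (2 * n) := fun m hm => by
    rw [mem_degreeLT, ← natDegree_lt_iff_degree_lt ((hP.monic m).map _).ne_zero, natDegree_map,
      hP.natDegree_eq]
    exact hm
  rw [← mem_degreeLT]
  refine Submodule.sum_mem _ fun k hk => Submodule.smul_mem _ _ (Submodule.sub_mem _
    (Submodule.smul_mem _ _ (hdeg _ ?_)) (Submodule.smul_mem _ _ (hdeg _ ?_))) <;>
  · rw [Finset.mem_range] at hk; omega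

/-- The reproducing property of the pre-kernel. -/
theorem IsSkewOrthogonal.cskew_kernelPoly (hP : IsSkewOrthogonal V P) (hU : IsPotential D (toC V))
    (hD : 2 ≤ D) (hDe : Even D) (y : ℂ) {q : ℂ[X]} (hq : q.degree < ((2 * n : ℕ) : WithBot ℕ)) :
    cskew hU hD (kernelPoly V P n y) q = 2⁻¹ * (twist (toC V) q).eval y := by
  obtain ⟨c, rfl⟩ := hP.exists_eq_sum hq
  have h1 : ∀ Q, cskew hU hD (kernelPoly V P n y) Q
      = ∑ k ∈ Finset.range n, (2 * (skewNorm V P k : ℂ))⁻¹ *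
        ((twist (toC V) (toC (P (2 * k + 1)))).eval y
          * cskew hU hD (toC (P (2 * k))) Q
        - (twist (toC V) (toC (P (2 * k)))).eval y
          * cskew hU hD (toC (P (2 * k + 1))) Q) := fun Q => by
    simp only [cskew, kernelPoly]
    rw [Finset.sum_mul, map_sum]
    refine Finset.sum_congr rfl fun k _ => ?_
    rw [smul_mul_assoc, map_smul, sub_mul, map_sub, smul_mul_assoc, smul_mul_assoc, map_smul,
      map_smul, smul_eq_mul, smul_eq_mul, smul_eq_mul]
  rw [h1, twist_sum_smul, eval_finsetSum,
    sum_range_two_mul fun j => (c j • twist (toC V) (toC (P j))).eval y, Finset.mul_sum]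
  refine Finset.sum_congr rfl fun k hk => ?_
  obtain ⟨e1, e2⟩ := hP.cskew_sum hU hD hDe (Finset.mem_range.1 hk) c
  have h0 : (skewNorm V P k : ℂ) ≠ 0 := by
    exact_mod_cast (hP.skewNorm_pos hU hD hDe k).ne'
  rw [e1, e2, eval_smul, eval_smul, smul_eq_mul, smul_eq_mul]
  field_simp
  ring

/-- Both polynomials in `x` have degree less than `2n` and represent multiples of the functional `q
↦ (q' - V' q)(y)`, with factors `1/2` and `-2πi`. Non-degeneracy of the skew form makes them
proportional. -/
theorem IsEvenSolution.preKernelC_eq_cdRHS (hA : IsEvenSolution V D n A)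
    (hP : IsSkewOrthogonal V P) (hU : IsPotential D (toC V)) (hD : 2 ≤ D) (hDe : Even D) {x y : ℂ}
    (hx : x ∉ contour D) (hy : y ∉ contour D) (hxy : x ≠ y) :
    preKernelC V P n x y = cdRHS V D x y (A x) (A y) := by
  obtain ⟨K, hK1, hK2, hK3⟩ := hA.exists_kernel hU hD hDe hy
  set c : ℂ := (4 * Real.pi * Complex.I)⁻¹ with hc
  have hdeg : (kernelPoly V P n y + c • K).degree < ((2 * n : ℕ) : WithBot ℕ) := by
    rw [← mem_degreeLT]
    exact Submodule.add_mem _ (mem_degreeLT.2 (hP.degree_kernelPoly_lt n y))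
      (Submodule.smul_mem _ _ (mem_degreeLT.2 hK1))
  have h0 : kernelPoly V P n y + c • K = 0 := by
    refine eq_zero_of_cskew_right hU hD hDe hdeg fun p hp => ?_
    rw [cskew_swap hU hD hDe hp hdeg, neg_eq_zero]
    have e : cskew hU hD (kernelPoly V P n y + c • K) p
        = cskew hU hD (kernelPoly V P n y) p + c * cskew hU hD K p := by
      simp only [cskew]
      rw [add_mul, map_add, smul_mul_assoc, map_smul, smul_eq_mul]
    have hpi : (Real.pi : ℂ) ≠ 0 := by exact_mod_cast Real.pi_ne_zero
    rw [e, hP.cskew_kernelPoly hU hD hDe y hp, hK3 p hp, hc]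
    field_simp
    ring
  have hxy' : x - y ≠ 0 := sub_ne_zero.2 hxy
  rw [preKernelC_eq, eq_neg_of_add_eq_zero_left h0, cdRHS, hK2 x hx, mul_div_cancel_left₀ _ hxy',
    eval_neg, eval_smul, smul_eq_mul, hc, one_div]
  ring

/-! ### Passage to boundary values and to real points. -/

/-- One filter serves both sides of the contour, so the four combinations of boundary values need no
separate treatment. -/
theorem IsBoundaryValue.exists_tendsto {x : ℂ} {M : Matrix (Fin (D + 1)) (Fin (D + 1)) ℂ}
    (h : IsBoundaryValue D A x M) (hD : 2 ≤ D) :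
    ∃ l : Filter ℂ, l.NeBot ∧ l ≤ 𝓝 x ∧ (∀ᶠ z in l, z ∉ contour D) ∧ Tendsto A l (𝓝 M) := by
  obtain ⟨k, hk, hx, hx0, h | h⟩ := h
  · exact ⟨_, mem_closure_iff_nhdsWithin_neBot.1 (mem_closure_side hD hk hx hx0).1, inf_le_left,
      eventually_nhdsWithin_of_forall fun z hz => hz.2, h⟩
  · exact ⟨_, mem_closure_iff_nhdsWithin_neBot.1 (mem_closure_side hD hk hx hx0).2, inf_le_left,
      eventually_nhdsWithin_of_forall fun z hz => hz.2, h⟩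

theorem IsEvenSolution.det_boundary (hA : IsEvenSolution V D n A) (hD : 2 ≤ D) (hDe : Even D)
    {l : Filter ℂ} [l.NeBot] (hl : ∀ᶠ z in l, z ∉ contour D)
    {M : Matrix (Fin (D + 1)) (Fin (D + 1)) ℂ} (hM : Tendsto A l (𝓝 M)) : M.det = 1 := by
  have h : Tendsto (fun z => (A z).det) l (𝓝 M.det) :=
    ((continuous_id.matrix_det).tendsto M).comp hM
  refine tendsto_nhds_unique h (tendsto_const_nhds.congr' ?_)
  filter_upwards [hl] with z hz using (hA.det_eq_one hD hDe hz).symm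

/-- Let both points tend to the contour independently, along the product of the two filters. The
pre-kernel is continuous everywhere, and `x - y` stays away from zero. -/
theorem IsEvenSolution.preKernelC_eq_cdRHS_boundary (hA : IsEvenSolution V D n A)
    (hP : IsSkewOrthogonal V P) (hU : IsPotential D (toC V)) (hD : 2 ≤ D) (hDe : Even D) {x y : ℂ}
    (hxy : x ≠ y) {M N : Matrix (Fin (D + 1)) (Fin (D + 1)) ℂ}
    (hM : IsBoundaryValue D A x M) (hN : IsBoundaryValue D A y N) :
    IsUnit M.det ∧ preKernelC V P n x y = cdRHS V D x y M N := by
  obtain ⟨l, _, hl, hlc, hlM⟩ := hM.exists_tendsto hD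
  obtain ⟨l', _, hl', hlc', hlN⟩ := hN.exists_tendsto hD
  have hdet := hA.det_boundary hD hDe hlc hlM
  refine ⟨by rw [hdet]; exact isUnit_one, ?_⟩
  have hle : l ×ˢ l' ≤ 𝓝 (x, y) := by rw [nhds_prod_eq]; exact Filter.prod_mono hl hl'
  have hlim : Tendsto (fun p : ℂ × ℂ => preKernelC V P n p.1 p.2) (l ×ˢ l')
      (𝓝 (preKernelC V P n x y)) :=
    ((continuous_preKernelC V P n).tendsto (x, y)).mono_left hle
  refine tendsto_nhds_unique hlim ?_
  have hMN : Tendsto (fun p : ℂ × ℂ => ((A p.1).adjugate * A p.2) 1 0) (l ×ˢ l')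
      (𝓝 ((M.adjugate * N) 1 0)) := by
    have h1 : Tendsto (fun z => (A z).adjugate) l (𝓝 M.adjugate) :=
      (continuous_id.matrix_adjugate.tendsto M).comp hlM
    simp only [Matrix.mul_apply]
    refine tendsto_finsetSum _ fun k _ => ?_
    exact ((tendsto_pi_nhds.1 (tendsto_pi_nhds.1 h1 1) k).comp tendsto_fst).mul
      ((tendsto_pi_nhds.1 (tendsto_pi_nhds.1 hlN k) 0).comp tendsto_snd)
  have hexp : ContinuousAt (fun p : ℂ × ℂ => Complex.exp (-aeval p.1 V - aeval p.2 V)) (x, y) := by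
    have h : Continuous fun z : ℂ => aeval z V := V.continuous_aeval
    exact ((h.comp continuous_fst).neg.sub (h.comp continuous_snd)).cexp.continuousAt
  have hsub : ContinuousAt (fun p : ℂ × ℂ => p.1 - p.2) (x, y) :=
    (continuous_fst.sub continuous_snd).continuousAt
  have hMinv : M⁻¹ = M.adjugate := by rw [Matrix.inv_def, hdet, Ring.inverse_one, one_smul]
  rw [cdRHS, hMinv]
  refine (((tendsto_const_nhds (x := -(1 / (4 * Real.pi * Complex.I)))).mul
    (hexp.tendsto.mono_left hle)).mul (hMN.div (hsub.tendsto.mono_left hle)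
      (sub_ne_zero.2 hxy))).congr' ?_
  have hne : ∀ᶠ p in l ×ˢ l', p.1 ≠ p.2 :=
    hle ((isOpen_ne_fun continuous_fst continuous_snd).mem_nhds hxy)
  filter_upwards [hne, hlc.prod_mk hlc'] with p hp hpc
  rw [hA.preKernelC_eq_cdRHS hP hU hD hDe hpc.1 hpc.2 hp, cdRHS,
    hA.inv_eq_adjugate hD hDe hpc.1, Pi.div_apply]

theorem IsEvenSolution.tendsto_cdRHS (hA : IsEvenSolution V D n A)
    (hP : IsSkewOrthogonal V P) (hU : IsPotential D (toC V)) (hD : 2 ≤ D) (hDe : Even D) {x y : ℂ}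
    (hxy : x ≠ y) : Tendsto (fun p : ℂ × ℂ => cdRHS V D p.1 p.2 (A p.1) (A p.2))
      (𝓝[(contour D)ᶜ ×ˢ (contour D)ᶜ] (x, y)) (𝓝 (preKernelC V P n x y)) := by
  refine (((continuous_preKernelC V P n).tendsto (x, y)).mono_left
    (inf_le_left : 𝓝[(contour D)ᶜ ×ˢ (contour D)ᶜ] (x, y) ≤ _)).congr' ?_
  have hne : ∀ᶠ p in 𝓝[(contour D)ᶜ ×ˢ (contour D)ᶜ] (x, y), p.1 ≠ p.2 :=
    mem_nhdsWithin_of_mem_nhds ((isOpen_ne_fun continuous_fst continuous_snd).mem_nhds hxy)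
  filter_upwards [hne, self_mem_nhdsWithin] with p hp hpc
  exact hA.preKernelC_eq_cdRHS hP hU hD hDe hpc.1 hpc.2 hp

end kernel

end SkewRH

end

theorem mainTheorem1 (V : ℝ[X]) (D : ℕ) (hD : V.natDegree = D) (hD_even : Even D) (hD_two : 2 ≤ D)
    (hV : 0 < V.leadingCoeff) (n : ℕ) :
    -- skew-orthogonal polynomials exist and have positive skew norms
    (∃ P : ℕ → ℝ[X], SkewRH.IsSkewOrthogonal V P) ∧
    (∀ P : ℕ → ℝ[X], SkewRH.IsSkewOrthogonal V P → ∀ k, 0 < SkewRH.skewNorm V P k) ∧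
    -- the even Riemann-Hilbert problem has exactly one solution, and it is invertible
    (∃ A, SkewRH.IsEvenSolution V D n A) ∧
    (∀ A B, SkewRH.IsEvenSolution V D n A → SkewRH.IsEvenSolution V D n B →
      Set.EqOn A B (SkewRH.contour D)ᶜ) ∧
    (∀ A, SkewRH.IsEvenSolution V D n A → ∀ z, z ∉ SkewRH.contour D → IsUnit (A z).det) ∧
    ∀ P : ℕ → ℝ[X], SkewRH.IsSkewOrthogonal V P →
    ∀ A, SkewRH.IsEvenSolution V D n A →
      -- the formula off the contour
      (∀ x y : ℂ, x ∉ SkewRH.contour D → y ∉ SkewRH.contour D → x ≠ y →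
        SkewRH.preKernelC V P n x y = SkewRH.cdRHS V D x y (A x) (A y)) ∧
      -- the formula for real points, with either boundary value of `A` at each point
      (∀ x y : ℝ, x ≠ 0 → y ≠ 0 → x ≠ y → ∀ M N,
        SkewRH.IsBoundaryValue D A x M → SkewRH.IsBoundaryValue D A y N →
        IsUnit M.det ∧ (SkewRH.preKernel V P n x y : ℂ) = SkewRH.cdRHS V D x y M N) ∧
      -- the formula for all real points (including `0`), the right-hand side being extended by
      -- continuity from the complement of the contour
      (∀ x y : ℝ, x ≠ y →
        Tendsto (fun p : ℂ × ℂ => SkewRH.cdRHS V D p.1 p.2 (A p.1) (A p.2))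
          (𝓝[(SkewRH.contour D)ᶜ ×ˢ (SkewRH.contour D)ᶜ] ((x : ℂ), (y : ℂ)))
          (𝓝 (SkewRH.preKernel V P n x y : ℂ))) := by
  have hU := SkewRH.isPotential_toC hD hV
  refine ⟨SkewRH.exists_isSkewOrthogonal hU hD_two hD_even,
    fun P hP k => hP.skewNorm_pos hU hD_two hD_even k,
    SkewRH.exists_isEvenSolution hU hD_two hD_even n,
    fun A B hA hB z hz => hA.unique hB hD_two hD_even hz,
    fun A hA z hz => by rw [hA.det_eq_one hD_two hD_even hz]; exact isUnit_one,
    fun P hP A hA => ⟨fun x y hx hy hxy => hA.preKernelC_eq_cdRHS hP hU hD_two hD_even hx hy hxy,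
      fun x y _ _ hxy M N hM hN => ?_, fun x y hxy => ?_⟩⟩
  · rw [SkewRH.ofReal_preKernel]
    exact hA.preKernelC_eq_cdRHS_boundary hP hU hD_two hD_even (by exact_mod_cast hxy) hM hN
  · rw [SkewRH.ofReal_preKernel]
    exact hA.tendsto_cdRHS hP hU hD_two hD_even (by exact_mod_cast hxy)
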